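/- Let $d\ge 1$, $\Omega=[0,1]^d$, and let $K$ be a real-valued measurable function on $\mathbb R^d\times\mathbb R^d$ that is nonnegative and symmetric on $\Omega^2$, with $\sup_{x\in\Omega}\|K(x,\cdot)\|_{L^2(\Omega)}<\infty$. Let $\partial|\cdot|(x)$ be $\{1\}$ for $x>0$, $\{-1\}$ for $x<0$ and $[-1,1]$ for $x=0$. For $U,\eta\in L^1(\Omega)$ write $\eta\in\Delta_1^KU$ if $\eta(x)=-\int_\Omega K(x,y)w(x,y)\,dy$ a.e. for some measurable $w$ with $|w|\le1$, $w(x,y)=-w(y,x)$ and $w(x,y)\in\partial|\cdot|(U(y)-U(x))$ a.e. For time-independent $f$, a solution on $[0,T]$ of the problem with data $(f,g)$ is a function $u\in C([0,T];L^1(\Omega))\cap W^{1,1}(]0,T[;L^1(\Omega))$ with $u(\cdot,0)=g$ and $\partial_tu=-\eta+f$ a.e., where $\eta(\cdot,t)\in\Delta_1^Ku(\cdot,t)$ for a.e. $t$. Partition $\Omega$ (up to a null set) into $n^d$ boxes $\Omega_i=\prod_k\,]x^{(k)}_{i_k-1},x^{(k)}_{i_k}]$, where $0=x^{(k)}_0<\dots<x^{(k)}_n=1$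 for each axis $k$. Let $h_i=|\Omega_i|$, let $\delta_n$ be the largest side length, let $P$ denote cell averages (of functions on $\Omega$, or on $\Omega^2$ over the products $\Omega_i\times\Omega_j$) and $I$ the piecewise constant injection of vectors and matrices into functions on $\Omega$ and $\Omega^2$. Put $\mathbf K=PK$, $\mathbf f=Pf$, $\mathbf g=Pg$, $f_n=IPf$. Given $\alpha_k>0$ with $\sum_{k\ge 0}\alpha_k^2<\infty$, the forward Euler scheme is $\mathbf u^0=\mathbf g$, $t_0=0$, $$\boldsymbol\eta^k_i=-\sum_jh_j\mathbf K_{ij}\,\mathrm{sign}(\mathbf u^k_j-\mathbf u^k_i),\quad \tau_k=t_{k+1}-t_k=\frac{\alpha_k}{\max(\|I\boldsymbol\eta^k-f_n\|_{L^2(\Omega)},1)},\quad \frac{\mathbf u^{k+1}-\mathbf u^k}{\tau_k}=-\boldsymbol\eta^k+\mathbf f .$$ For a number $N$ of steps put $T=t_N$ and $\tau=\max_{k<N}\tau_k$. The discrete problem is said to have a stationary solution if there are a vector $\mathbf u^\star$ and an antisymmetric matrix $\mathbf w$ with $|\mathbf w_{ij}|\le1$, $\mathbf w_{ij}\in\partial|\cdot|(\mathbf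 u^\star_j-\mathbf u^\star_i)$ and $\mathbf f_i=-\sum_jh_j\mathbf K_{ij}\mathbf w_{ij}$ for all $i$. (i) Let $f,g\in L^2(\Omega)$. For every $T>0$ the continuum problem has exactly one solution on $[0,T]$. For every grid and every $(\alpha_k)$ the scheme defines $(t_k)$, $(\mathbf u^k)$ uniquely. For every $T>0$ there is a bound on $\|I\mathbf u^k\|_{L^2(\Omega)}$ valid for all grids, all $(\alpha_k)$ and all $k$ with $t_k\le T$. If the discrete problem has a stationary solution, then $(\|I\mathbf u^k\|_{L^2(\Omega)})_{k\ge0}$ is bounded. When $\mathbf f=0$, it is bounded uniformly over all grids and all $(\alpha_k)$ with $\sum_k\alpha_k^2\le S$, for every $S$. (ii) Let $f,g\in L^2(\Omega)$ and let $u$ be a solution of the continuum problem on $[0,T]$, $T=t_N$. Then $$\sup_{1\le k\le N,\ t\in]t_{k-1},t_k]}\|I\mathbf u^{k-1}-u(\cdot,t)\|_{L^2(\Omega)}\le e^{T/2}\Big(\|IPg-g\|_{L^2(\Omega)}+CT^{1/2}\big(\tau^{1/2}+\|f_n-f\|_{L^2(\Omega)}+\|IPK-K\|_{L^2(\Omega^2)}\big)\Big),$$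 where $C>0$ depends only on $K$ if the discrete problem has a stationary solution, and only on $K$ and $f$ in general. (iii) Let $s\in]0,1]$, $f,g\in\mathrm{Lip}(s,L^2(\Omega))$ and $K\in\mathrm{Lip}(s,L^2(\Omega^2))$, where $F\in\mathrm{Lip}(s,L^2(S))$ means that $F\in L^2(S)$ and $\sup_{h>0}h^{-s}\sup_{|z|<h}\big(\int_{x,x+z\in S}|F(x+z)-F(x)|^2dx\big)^{1/2}<\infty$. Then, with $u$ and $T$ as in (ii), $$\sup_{1\le k\le N,\ t\in]t_{k-1},t_k]}\|I\mathbf u^{k-1}-u(\cdot,t)\|_{L^2(\Omega)}\le Ce^{T/2}\big((1+T^{1/2})\delta_n^s+T^{1/2}\tau^{1/2}\big),$$ where $C>0$ depends only on $g$, $f$, $K$ and $s$. -/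

import Mathlib

open MeasureTheory Set
open scoped ENNReal

noncomputable section

namespace NonlocalOneLap

/-- The points of `ℝ^d`. -/
abbrev Pt (d : ℕ) : Type := Fin d → ℝ

/-- The domain `Ω = [0,1]^d`. -/
def Om (d : ℕ) : Set (Pt d) := Set.Icc 0 1

/-- Lebesgue measure on `Ω`. -/
def mu (d : ℕ) : Measure (Pt d) := volume.restrict (Om d)

/-- The norm of `L^2(Ω)` as a real number (used below only for functions that lie in `L^2(Ω)`). -/
def l2norm {d : ℕ} (F : Pt d → ℝ) : ℝ := (eLpNorm F 2 (mu d)).toReal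

/-- The norm of `L^2(Ω²)` as a real number (used below only for functions in `L^2(Ω²)`). -/
def l2norm₂ {d : ℕ} (F : Pt d → Pt d → ℝ) : ℝ :=
  (eLpNorm (Function.uncurry F) 2 ((mu d).prod (mu d))).toReal

/-- The norm of `L^{∞,2}(Ω²)`: the supremum over `x ∈ Ω` of the `L^2(Ω)` norm of `F(x, ·)`. -/
def linf2norm {d : ℕ} (F : Pt d → Pt d → ℝ) : ℝ≥0∞ := ⨆ x ∈ Om d, eLpNorm (F x) 2 (mu d)

section Lipschitz

variable {E : Type*} [NormedAddCommGroup E] [MeasureSpace E]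

/-- The first-order `L^q(S)` modulus of smoothness `ω(F,h)_q`. -/
def modulus (S : Set E) (q : ℝ≥0∞) (F : E → ℝ) (h : ℝ) : ℝ≥0∞ :=
  ⨆ (z : E) (_ : ‖z‖ < h),
    eLpNorm (fun x => F (x + z) - F x) q (volume.restrict {x | x ∈ S ∧ x + z ∈ S})

/-- The semi-norm `sup_{h > 0} h^{-s} ω(F,h)_q`. -/
def lipSeminorm (S : Set E) (s : ℝ) (q : ℝ≥0∞) (F : E → ℝ) : ℝ≥0∞ :=
  ⨆ (h : ℝ) (_ : 0 < h), ENNReal.ofReal (h ^ (-s)) * modulus S q F h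

/-- Membership in the Lipschitz space `Lip(s, L^q(S))`. As all norms of a finite-dimensional
space are equivalent, the space does not depend on the norm that measures the shift `z`. -/
def MemLip (S : Set E) (s : ℝ) (q : ℝ≥0∞) (F : E → ℝ) : Prop :=
  MemLp F q (volume.restrict S) ∧ lipSeminorm S s q F < ⊤

end Lipschitz

/-- The subdifferential of the absolute value on `ℝ`. -/
def absSubdiff (x : ℝ) : Set ℝ :=
  if 0 < x then {1} else if x < 0 then {-1} else Set.Icc (-1) 1

/-- `η ∈ Δ_1^K U`, where `Δ_1^K` is the set-valued nonlocal `1`-Laplacian on `L^1(Ω)`. -/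
def InOneLaplacian {d : ℕ} (K : Pt d → Pt d → ℝ) (U η : Pt d → ℝ) : Prop :=
  Integrable U (mu d) ∧ Integrable η (mu d) ∧
  ∃ w : Pt d → Pt d → ℝ,
    AEStronglyMeasurable (Function.uncurry w) ((mu d).prod (mu d)) ∧
    (∀ᵐ p ∂(mu d).prod (mu d), |w p.1 p.2| ≤ 1) ∧
    (∀ᵐ p ∂(mu d).prod (mu d), w p.1 p.2 = -w p.2 p.1) ∧
    (∀ᵐ p ∂(mu d).prod (mu d), w p.1 p.2 ∈ absSubdiff (U p.2 - U p.1)) ∧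
    ∀ᵐ x ∂mu d, η x = -∫ y, K x y * w x y ∂mu d

/-- `u` is a solution on `[0,T]` of `∂u/∂t ∈ -Δ_1^K u + f`, `u(·,0) = g`. The space
`W^{1,1}(]0,T[; L^1(Ω))` is described in the standard way through primitives: `u` has the weak
derivative `v ∈ L^1(]0,T[; L^1(Ω))` iff `u(t) = u(0) + ∫_0^t v(s) ds` (Bochner integral). -/
structure IsSolution {d : ℕ} (K : Pt d → Pt d → ℝ) (f : ℝ → Pt d → ℝ) (g : Pt d → ℝ) (T : ℝ)
    (u : ℝ → Lp ℝ 1 (mu d)) : Prop where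
  continuousOn : ContinuousOn u (Set.Icc 0 T)
  initial : (u 0 : Pt d → ℝ) =ᵐ[mu d] g
  evolution : ∃ v : ℝ → Lp ℝ 1 (mu d),
    IntegrableOn v (Set.Ioo 0 T) ∧
    (∀ t ∈ Set.Icc 0 T, u t = u 0 + ∫ s in (0 : ℝ)..t, v s) ∧
    ∀ᵐ t ∂(volume.restrict (Set.Ioo 0 T)), ∃ η : Pt d → ℝ,
      InOneLaplacian K (u t) η ∧ (v t : Pt d → ℝ) =ᵐ[mu d] fun x => -η x + f t x

/-- A partition of `Ω` into `n^d` boxes: along the `k`-th axis the points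
`0 = x_0 < x_1 < ⋯ < x_n = 1` (not necessarily equispaced). -/
structure Grid (d n : ℕ) where
  pts : Fin d → Fin (n + 1) → ℝ
  strictMono : ∀ k, StrictMono (pts k)
  first : ∀ k, pts k 0 = 0
  last : ∀ k, pts k (Fin.last n) = 1

/-- The multi-indices of the cells. -/
abbrev Idx (d n : ℕ) : Type := Fin d → Fin n

namespace Grid

variable {d n : ℕ} (G : Grid d n)

/-- The cell `Ω_i = ∏_k ]x_{i_k - 1}, x_{i_k}]` (the indices `i_k` start here at `0`). -/
def cell (i : Idx d n) : Set (Pt d) :=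
  {x | ∀ k, G.pts k (i k).castSucc < x k ∧ x k ≤ G.pts k (i k).succ}

/-- The size `h_i = |Ω_i|` of a cell. -/
def h (i : Idx d n) : ℝ := volume.real (G.cell i)

/-- The maximal mesh size `δ_n`. -/
def delta : ℝ := ⨆ p : Fin d × Fin n, (G.pts p.1 p.2.succ - G.pts p.1 p.2.castSucc)

/-- The projector `P_n` (cell averages). -/
def proj (u : Pt d → ℝ) (i : Idx d n) : ℝ := (G.h i)⁻¹ * ∫ x in G.cell i, u x

/-- The projector `P_n` for functions on `Ω²`. -/
def proj₂ (F : Pt d → Pt d → ℝ) (i j : Idx d n) : ℝ :=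
  (G.h i * G.h j)⁻¹ * ∫ p in G.cell i ×ˢ G.cell j, F p.1 p.2

/-- The piecewise constant injector `I_n`. -/
def inj (v : Idx d n → ℝ) (x : Pt d) : ℝ := ∑ i, v i * (G.cell i).indicator 1 x

/-- The piecewise constant injector `I_n` for matrices. -/
def inj₂ (A : Idx d n → Idx d n → ℝ) (x y : Pt d) : ℝ :=
  ∑ i, ∑ j, A i j * (G.cell i).indicator 1 x * (G.cell j).indicator 1 y

/-- `η ∈ Δ_1^A v`, the set-valued discrete `1`-Laplacian with kernel `A`. -/
def InDiscreteOneLaplacian (A : Idx d n → Idx d n → ℝ) (v η : Idx d n → ℝ) : Prop :=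
  ∃ w : Idx d n → Idx d n → ℝ,
    (∀ i j, |w i j| ≤ 1) ∧ (∀ i j, w i j = -w j i) ∧
    (∀ i j, w i j ∈ absSubdiff (v j - v i)) ∧
    ∀ i, η i = -∑ j, G.h j * A i j * w i j

/-- The selection of the discrete `1`-Laplacian that uses the sign function (`sign 0 = 0`). -/
def signLaplacian (A : Idx d n → Idx d n → ℝ) (v : Idx d n → ℝ) (i : Idx d n) : ℝ :=
  -∑ j, G.h j * A i j * Real.sign (v j - v i)

/-- `t` and `U` are the time nodes and the iterates of the forward Euler scheme with kernel
`P_n K`, source `P_n f` and initial datum `P_n g`; the steps are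
`τ_k = t_{k+1} - t_k = α_k / max (‖I_n η^k - I_n P_n f‖, 1)`. -/
structure IsForwardEuler (K : Pt d → Pt d → ℝ) (f g : Pt d → ℝ) (α : ℕ → ℝ)
    (t : ℕ → ℝ) (U : ℕ → Idx d n → ℝ) : Prop where
  time_zero : t 0 = 0
  step : ∀ k, t (k + 1) - t k =
    α k / max (l2norm fun x =>
      G.inj (G.signLaplacian (G.proj₂ K) (U k)) x - G.inj (G.proj f) x) 1
  initial : U 0 = G.proj g
  scheme : ∀ k i, (U (k + 1) i - U k i) / (t (k + 1) - t k) =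
    -G.signLaplacian (G.proj₂ K) (U k) i + G.proj f i

/-- The discrete problem has a stationary solution: `P_n f ∈ Δ_1^{P_n K} u⋆` for some `u⋆`. -/
def HasStationary (K : Pt d → Pt d → ℝ) (f : Pt d → ℝ) : Prop :=
  ∃ us : Idx d n → ℝ, G.InDiscreteOneLaplacian (G.proj₂ K) us (G.proj f)

/-- `sup_{1 ≤ k ≤ N, t ∈ ]t_{k-1},t_k]} ‖I_n U^{k-1} - u(·,t)‖_{L^2(Ω)} ≤ B`. -/
def ErrorLE (t : ℕ → ℝ) (U : ℕ → Idx d n → ℝ) (N : ℕ) (u : ℝ → Lp ℝ 1 (mu d)) (B : ℝ) : Prop :=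
  ∀ k < N, ∀ r ∈ Set.Ioc (t k) (t (k + 1)),
    eLpNorm (fun x => G.inj (U k) x - u r x) 2 (mu d) ≤ ENNReal.ofReal B

end Grid

/-- Admissible step parameters: positive and square-summable. -/
def IsStepSeq (α : ℕ → ℝ) : Prop := (∀ k, 0 < α k) ∧ Summable fun k => α k ^ 2

/-- The largest step `τ = max_{k < N} (t_{k+1} - t_k)`. -/
def maxStep (t : ℕ → ℝ) (N : ℕ) : ℝ := ⨆ k : Fin N, (t (k + 1) - t k)

end NonlocalOneLap

end

open NonlocalOneLap

/-! The operator is monotone with bounded range. Since `K` is symmetric and `w` antisymmetric,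
exchanging `x` and `y` turns the pairing of `η₁ - η₂` with `U₁ - U₂` into half the double integral
of `K (w₁ - w₂)` against the difference of the jumps of `U₁` and `U₂`, which is nonnegative because
the subdifferential of the absolute value is monotone (`InOneLaplacian.monotone`). Moreover the
`L^2` norm of `η` is at most that of `K`, whatever `U` is (`InOneLaplacian.memLp`). Hence an `L^1`
solution with `L^2` data is an `L^2` solution.

Continuum solutions, Euler schemes in `L^2(Ω)` and the fully discrete scheme are all instances of
one notion, `IsApprox`: a primitive of some `φ` that is within `b` of `f - ζ`, where `ζ` is taken at
a point within `ρ` of the current state. A Grönwall argument compares any two of them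
(`IsApprox.norm_sub_sq_le`). In the squared distance `b` enters quadratically and `ρ` only linearly;
this is the origin of the rate `τ^(1/2)`.

Uniqueness is the case `ρ = b = 0`. For existence, Euler schemes with `16 ^ n` steps form a Cauchy
sequence; their sign fields have a weak limit in space-time, and the relation `w D = |D|` survives
because the differences `D` converge almost everywhere (`weak_limit_mul_eq_abs`). The error estimate
takes `ρ` proportional to `τ` and for `b` the consistency error of `f` and `K`
(`Grid.norm_rhs_sub_le`).

Iterates are bounded on finite time intervals since the speed is bounded. With a stationary
solution, monotonicity makes the squared distance to it grow by at most `α k ^ 2` per step. For the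
Lipschitz rate, cell averages are best piecewise constant approximations, so they may be compared
with averages over cubes of side `δ_n`, which are controlled by shifts even when cells are very
thin. -/

noncomputable section

namespace NonlocalOneLap

/-! ### Grönwall's inequality and weak compactness in Hilbert space -/

section Hilbert

variable {H : Type*} [NormedAddCommGroup H] [InnerProductSpace ℝ H] [CompleteSpace H]

/-- A Grönwall inequality for primitives of bounded functions with values in a Hilbert space. -/
theorem norm_sq_le_of_inner_le {e φ : ℝ → H} {e₀ : H} {T R c : ℝ} (hT : 0 ≤ T) (hc : 0 ≤ c)
    (hφ : IntervalIntegrable φ volume 0 T)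
    (hR : ∀ᵐ s, s ∈ Ioc 0 T → ‖φ s‖ ≤ R)
    (he : ∀ t ∈ Icc 0 T, e t = e₀ + ∫ s in (0 : ℝ)..t, φ s)
    (hin : ∀ᵐ s, s ∈ Ioc 0 T → 2 * inner ℝ (φ s) (e s) ≤ ‖e s‖ ^ 2 + c) :
    ‖e T‖ ^ 2 ≤ Real.exp T * (‖e₀‖ ^ 2 + c * T) := by
  set E : ℝ → H := fun t => e₀ + ∫ s in (0 : ℝ)..t, φ s with hE
  have huIcc : uIcc 0 T = Icc 0 T := uIcc_of_le hT
  have hsub : ∀ s ∈ Icc 0 T, ∀ t ∈ Icc 0 T, IntervalIntegrable φ volume s t := fun s hs t ht =>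
    hφ.mono_set (by rw [huIcc]; exact (convex_Icc 0 T).ordConnected.uIcc_subset hs ht)
  have hLip : LipschitzOnWith (Real.toNNReal R) E (uIcc 0 T) := by
    rw [huIcc]
    apply LipschitzOnWith.of_dist_le_mul
    intro s hs t ht
    have h1 : E s - E t = ∫ r in t..s, φ r := by
      simp only [hE, add_sub_add_left_eq_sub]
      exact intervalIntegral.integral_interval_sub_left
        (hsub 0 ⟨le_rfl, hT⟩ s hs) (hsub 0 ⟨le_rfl, hT⟩ t ht)
    rw [dist_eq_norm, h1, Real.dist_eq]
    apply intervalIntegral.norm_integral_le_of_norm_le_const_ae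
    filter_upwards [hR] with r hr hrst
    refine (hr ?_).trans (Real.le_coe_toNNReal R)
    rw [uIoc, mem_Ioc] at hrst
    exact ⟨(le_min ht.1 hs.1).trans_lt hrst.1, hrst.2.trans (max_le ht.2 hs.2)⟩
  have hnorm : AbsolutelyContinuousOnInterval (fun t => ‖E t‖) 0 T := by
    apply LipschitzOnWith.absolutelyContinuousOnInterval (K := 1 * Real.toNNReal R)
    exact lipschitzWith_one_norm.comp_lipschitzOnWith hLip
  have hexp : AbsolutelyContinuousOnInterval (fun t : ℝ => Real.exp (-t)) 0 T :=
    ContDiffOn.absolutelyContinuousOnInterval (by fun_prop)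
  have hid : AbsolutelyContinuousOnInterval (fun t : ℝ => c * t) 0 T :=
    ContDiffOn.absolutelyContinuousOnInterval (by fun_prop)
  -- The scalar function `exp (-t) ‖E t‖² - c t` is absolutely continuous because `E` is Lipschitz,
  -- so its increment is the integral of its almost everywhere derivative. By `hin` that derivative
  -- is at most `exp (-t) c - c ≤ 0`.
  have hp := (hexp.mul (hnorm.mul hnorm)).sub hid
  have hint := hp.integral_deriv_eq_sub
  have hle : ∫ x in (0 : ℝ)..T, deriv (((fun t : ℝ => Real.exp (-t)) *
      ((fun t => ‖E t‖) * fun t => ‖E t‖)) - fun t : ℝ => c * t) x ≤ 0 := by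
    rw [intervalIntegral.integral_of_le hT]
    apply integral_nonpos_of_ae
    rw [Filter.EventuallyLE, ae_restrict_iff' measurableSet_Ioc]
    filter_upwards [hφ.ae_hasDerivAt_integral, hin] with x hx hx2 hxT
    have hxI : x ∈ Icc 0 T := Ioc_subset_Icc_self hxT
    have h1 : HasDerivAt E (φ x) x :=
      (hx (by rw [huIcc]; exact hxI) 0 (by rw [huIcc]; exact ⟨le_rfl, hT⟩)).const_add e₀
    have h2 : HasDerivAt (fun t => ‖E t‖ ^ 2) (2 * inner ℝ (E x) (φ x)) x := h1.norm_sq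
    have h3 : HasDerivAt (fun t : ℝ => Real.exp (-t)) (-Real.exp (-x)) x := by
      simpa using (hasDerivAt_neg x).exp
    have h4 := (h3.mul h2).sub ((hasDerivAt_id x).const_mul c)
    have h5 : deriv (((fun t : ℝ => Real.exp (-t)) *
        ((fun t => ‖E t‖) * fun t => ‖E t‖)) - fun t : ℝ => c * t) x =
        -Real.exp (-x) * ‖E x‖ ^ 2 + Real.exp (-x) * (2 * inner ℝ (E x) (φ x)) - c * 1 := by
      rw [← h4.deriv]
      congr 1
      ext t
      simp [sq]
    rw [h5]
    have h6 := hx2 hxT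
    rw [he x hxI, real_inner_comm] at h6
    change 2 * inner ℝ (E x) (φ x) ≤ ‖E x‖ ^ 2 + c at h6
    have h7 : Real.exp (-x) ≤ 1 := Real.exp_le_one_iff.2 (by linarith [hxI.1])
    have h8 := Real.exp_pos (-x)
    have h9 := mul_le_mul_of_nonneg_left h6 h8.le
    have h10 := mul_le_mul_of_nonneg_right h7 hc
    simp only [Pi.zero_apply]
    nlinarith
  rw [hint] at hle
  simp only [Pi.sub_apply, Pi.mul_apply] at hle
  have hE0 : E 0 = e₀ := by simp [hE]
  have hET : e T = E T := he T ⟨hT, le_rfl⟩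
  rw [hET]
  rw [hE0, neg_zero, Real.exp_zero] at hle
  have h11 : Real.exp T * Real.exp (-T) = 1 := by rw [← Real.exp_add]; simp
  have h12 : Real.exp (-T) * ‖E T‖ ^ 2 ≤ ‖e₀‖ ^ 2 + c * T := by nlinarith
  calc ‖E T‖ ^ 2 = Real.exp T * (Real.exp (-T) * ‖E T‖ ^ 2) := by rw [← mul_assoc, h11, one_mul]
    _ ≤ _ := by gcongr

/-- Bounded sequences have weak limits along the hyperfilter. -/
theorem exists_weak_limit (x : ℕ → H) {R : ℝ} (hx : ∀ n, ‖x n‖ ≤ R) :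
    ∃ W : H, ∀ φ : H, Filter.Tendsto (fun n => inner ℝ (x n) φ) (Filter.hyperfilter ℕ : Filter ℕ)
      (nhds (inner ℝ W φ)) := by
  let D : ℕ → WeakDual ℝ H := fun n => StrongDual.toWeakDual (InnerProductSpace.toDual ℝ H (x n))
  have hcpt := WeakDual.isCompact_closedBall (𝕜 := ℝ) (E := H) (0 : StrongDual ℝ H) R
  have hmem : ∀ n, D n ∈ (WeakDual.toStrongDual ⁻¹' Metric.closedBall (0 : StrongDual ℝ H) R) := by
    intro n
    simp [D, hx n]
  -- Banach–Alaoglu. An ultrafilter on a compact set converges, so no subsequence has to be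
  -- extracted, and one and the same filter serves every test vector.
  obtain ⟨L, -, hL⟩ := hcpt.ultrafilter_le_nhds ((Filter.hyperfilter ℕ).map D)
    (by
      rw [Filter.le_principal_iff]
      exact Filter.mem_map.2 (Filter.univ_mem' hmem))
  refine ⟨(InnerProductSpace.toDual ℝ H).symm (WeakDual.toStrongDual L), fun φ => ?_⟩
  rw [InnerProductSpace.toDual_symm_apply]
  have := ((WeakDual.eval_continuous (𝕜 := ℝ) (E := H) φ).tendsto L).comp
    (show Filter.Tendsto D (Filter.hyperfilter ℕ : Filter ℕ) (nhds L) from hL)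
  exact this

end Hilbert

/-! ### Comparison of approximate solutions of a monotone evolution -/

section Approx

variable {H : Type*} [NormedAddCommGroup H] [InnerProductSpace ℝ H]

/-- `u` is, on `[0,T]`, an approximate solution of `u' ∈ f - A u`, `u(0) = a`: its derivative `φ`
differs by at most `b` from `f - ζ`, where `ζ ∈ A(ub)` and `ub` differs from `u` by at most `ρ`. -/
structure IsApprox (A : H → H → Prop) (f a : H) (T R ρ b M : ℝ) (u φ ub : ℝ → H) : Prop where
  integrable : IntervalIntegrable φ volume 0 T
  bound : ∀ s ∈ Ioc 0 T, ‖φ s‖ ≤ R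
  primitive : ∀ s ∈ Icc 0 T, u s = a + ∫ r in (0 : ℝ)..s, φ r
  close : ∀ s ∈ Ioc 0 T, ‖u s - ub s‖ ≤ ρ
  evolution : ∀ᵐ s, s ∈ Ioc 0 T → ∃ ζ, A (ub s) ζ ∧ ‖ζ‖ ≤ M ∧ ‖φ s - (f - ζ)‖ ≤ b

theorem IsApprox.mono {A : H → H → Prop} {f a : H} {T R ρ b M : ℝ} {u φ ub : ℝ → H}
    (h : IsApprox A f a T R ρ b M u φ ub) {t : ℝ} (ht : t ∈ Icc 0 T) :
    IsApprox A f a t R ρ b M u φ ub where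
  integrable := h.integrable.mono_set (by
    rw [uIcc_of_le ht.1, uIcc_of_le (ht.1.trans ht.2)]; exact Icc_subset_Icc_right ht.2)
  bound s hs := h.bound s ⟨hs.1, hs.2.trans ht.2⟩
  primitive s hs := h.primitive s ⟨hs.1, hs.2.trans ht.2⟩
  close s hs := h.close s ⟨hs.1, hs.2.trans ht.2⟩
  evolution := h.evolution.mono fun s hs hst => hs ⟨hst.1, hst.2.trans ht.2⟩

/-- The monotone pairing is available at the points `ub`, not at `u`. Replacing one by the other
costs the pairing of `ζ₁ - ζ₂`, of norm at most `2M`, with a vector of norm at most `ρ₁ + ρ₂`; hence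
the term `4M(ρ₁ + ρ₂)`, linear in `ρ`. -/
theorem IsApprox.norm_sub_sq_le [CompleteSpace H] {A : H → H → Prop}
    (hA : ∀ U₁ ζ₁ U₂ ζ₂, A U₁ ζ₁ → A U₂ ζ₂ → 0 ≤ inner ℝ (ζ₁ - ζ₂) (U₁ - U₂))
    {f a₁ a₂ : H} {T R₁ R₂ ρ₁ ρ₂ b₁ b₂ M : ℝ} {u₁ φ₁ ub₁ u₂ φ₂ ub₂ : ℝ → H}
    (hT : 0 ≤ T) (hM : 0 ≤ M) (hρ₁ : 0 ≤ ρ₁) (hρ₂ : 0 ≤ ρ₂)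
    (h₁ : IsApprox A f a₁ T R₁ ρ₁ b₁ M u₁ φ₁ ub₁) (h₂ : IsApprox A f a₂ T R₂ ρ₂ b₂ M u₂ φ₂ ub₂) :
    ‖u₁ T - u₂ T‖ ^ 2 ≤
      Real.exp T * (‖a₁ - a₂‖ ^ 2 + ((b₁ + b₂) ^ 2 + 4 * M * (ρ₁ + ρ₂)) * T) := by
  apply norm_sq_le_of_inner_le (e := fun t => u₁ t - u₂ t) (φ := fun s => φ₁ s - φ₂ s)
    (R := R₁ + R₂) hT (by positivity) (h₁.integrable.sub h₂.integrable)
  · exact Filter.Eventually.of_forall fun s hs =>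
      (norm_sub_le _ _).trans (add_le_add (h₁.bound s hs) (h₂.bound s hs))
  · intro t ht
    have hi : ∀ {φ : ℝ → H}, IntervalIntegrable φ volume 0 T → IntervalIntegrable φ volume 0 t :=
      fun h => h.mono_set (by
        rw [uIcc_of_le ht.1, uIcc_of_le hT]; exact Icc_subset_Icc_right ht.2)
    rw [h₁.primitive t ht, h₂.primitive t ht,
      intervalIntegral.integral_sub (hi h₁.integrable) (hi h₂.integrable)]
    abel
  · filter_upwards [h₁.evolution, h₂.evolution] with s hs₁ hs₂ hs
    obtain ⟨ζ₁, hA₁, hM₁, hb₁⟩ := hs₁ hs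
    obtain ⟨ζ₂, hA₂, hM₂, hb₂⟩ := hs₂ hs
    have hc₁ := h₁.close s hs
    have hc₂ := h₂.close s hs
    have hmono := hA _ _ _ _ hA₁ hA₂
    set e := u₁ s - u₂ s with he
    set r := (φ₁ s - (f - ζ₁)) - (φ₂ s - (f - ζ₂)) with hr
    set p := (u₁ s - ub₁ s) - (u₂ s - ub₂ s) with hp
    have hdecomp : φ₁ s - φ₂ s = r - (ζ₁ - ζ₂) := by rw [hr]; abel
    have hedec : e = (ub₁ s - ub₂ s) + p := by rw [hp, he]; abel
    have hr' : ‖r‖ ≤ b₁ + b₂ := (norm_sub_le _ _).trans (add_le_add hb₁ hb₂)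
    have hp' : ‖p‖ ≤ ρ₁ + ρ₂ := (norm_sub_le _ _).trans (add_le_add hc₁ hc₂)
    have hζ : ‖ζ₁ - ζ₂‖ ≤ M + M := (norm_sub_le _ _).trans (add_le_add hM₁ hM₂)
    have e1 : inner ℝ (φ₁ s - φ₂ s) e =
        inner ℝ r e - inner ℝ (ζ₁ - ζ₂) (ub₁ s - ub₂ s) - inner ℝ (ζ₁ - ζ₂) p := by
      rw [hdecomp, inner_sub_left, sub_sub, ← inner_add_right, ← hedec]
    have e2 : inner ℝ r e ≤ (b₁ + b₂) * ‖e‖ :=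
      (real_inner_le_norm _ _).trans (by gcongr)
    have e3 : -inner ℝ (ζ₁ - ζ₂) p ≤ (M + M) * (ρ₁ + ρ₂) := by
      rw [← inner_neg_right]
      refine (real_inner_le_norm _ _).trans ?_
      rw [norm_neg]
      exact mul_le_mul hζ hp' (norm_nonneg _) (by positivity)
    change 2 * inner ℝ (φ₁ s - φ₂ s) e ≤ ‖e‖ ^ 2 + _
    rw [e1]
    -- Young's inequality bounds `2 (b₁ + b₂) ‖e‖` by `‖e‖² + (b₁ + b₂)²`. The coefficient 1 of
    -- `‖e‖²` is what gives the growth factor `exp T` for the square.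
    nlinarith [sq_nonneg (‖e‖ - (b₁ + b₂))]

end Approx

/-! ### Interpolation in time of explicit step schemes -/

section Steps

/-- The index of the step `]t_k, t_{k+1}]`, `k < N`, that contains `s`. -/
def stepIdx (t : ℕ → ℝ) (N : ℕ) (s : ℝ) : ℕ := ∑ j ∈ Finset.range N, (Ioi (t (j + 1))).indicator 1 s

theorem measurable_stepIdx (t : ℕ → ℝ) (N : ℕ) : Measurable (stepIdx t N) := by
  unfold stepIdx
  exact Finset.measurable_sum _ fun j _ => measurable_one.indicator measurableSet_Ioi

/-- `stepIdx` counts the nodes `t 1, …, t N` strictly below `s`. On the half-open interval `]t_k,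
t_{k+1}]` these are `t 1, …, t k`, so the count is the index of the left node. -/
theorem stepIdx_eq {t : ℕ → ℝ} (ht : StrictMono t) {N k : ℕ} (hk : k < N) {s : ℝ}
    (hs : s ∈ Ioc (t k) (t (k + 1))) : stepIdx t N s = k := by
  have h : ∀ j ∈ Finset.range N, (Ioi (t (j + 1))).indicator (1 : ℝ → ℕ) s =
      if j < k then 1 else 0 := by
    intro j _
    by_cases hj : j < k
    · have : t (j + 1) < s := (ht.monotone hj).trans_lt hs.1
      simp [hj, this]
    · have : s ≤ t (j + 1) := hs.2.trans (ht.monotone (by omega))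
      simp [hj, this]
  rw [stepIdx, Finset.sum_congr rfl h, Finset.sum_ite, Finset.sum_const_zero, add_zero,
    Finset.sum_const, smul_eq_mul, mul_one]
  have : (Finset.range N).filter (fun j => j < k) = Finset.range k := by
    ext j; simp only [Finset.mem_filter, Finset.mem_range]; omega
  rw [this, Finset.card_range]

theorem exists_mem_step {t : ℕ → ℝ} (h0 : t 0 = 0) {N : ℕ} {s : ℝ}
    (hs : s ∈ Ioc 0 (t N)) : ∃ k < N, s ∈ Ioc (t k) (t (k + 1)) := by
  induction N with
  | zero => rw [h0] at hs; exact absurd (hs.1.trans_le hs.2) (lt_irrefl _)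
  | succ N ih =>
    by_cases h : s ≤ t N
    · obtain ⟨k, hk, hk'⟩ := ih ⟨hs.1, h⟩
      exact ⟨k, by omega, hk'⟩
    · exact ⟨N, by omega, not_le.1 h, hs.2⟩

variable {H : Type*} [NormedAddCommGroup H]

theorem stronglyMeasurable_comp_stepIdx (t : ℕ → ℝ) (N : ℕ) (φ : ℕ → H) :
    StronglyMeasurable fun s => φ (stepIdx t N s) :=
  (StronglyMeasurable.of_discrete (f := φ)).comp_measurable (measurable_stepIdx t N)

theorem stepIdx_le (t : ℕ → ℝ) (N : ℕ) (s : ℝ) : stepIdx t N s ≤ N := by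
  have : ∀ j ∈ Finset.range N, (Ioi (t (j + 1))).indicator (1 : ℝ → ℕ) s ≤ 1 := by
    intro j _
    by_cases h : s ∈ Ioi (t (j + 1)) <;> simp [h]
  refine (Finset.sum_le_sum this).trans ?_
  simp

theorem intervalIntegrable_comp_stepIdx (t : ℕ → ℝ) (N : ℕ) (φ : ℕ → H) (a b : ℝ) :
    IntervalIntegrable (fun s => φ (stepIdx t N s)) volume a b := by
  have hb : ∀ s, ‖φ (stepIdx t N s)‖ ≤ ∑ k ∈ Finset.range (N + 1), ‖φ k‖ := fun s =>
    Finset.single_le_sum (f := fun k => ‖φ k‖) (fun k _ => norm_nonneg _)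
      (Finset.mem_range.2 (Nat.lt_succ_of_le (stepIdx_le t N s)))
  refine (intervalIntegrable_const (c := ∑ k ∈ Finset.range (N + 1), ‖φ k‖)).mono_fun
    (stronglyMeasurable_comp_stepIdx t N φ).aestronglyMeasurable
    (Filter.Eventually.of_forall fun s => (hb s).trans (le_abs_self _))

variable [InnerProductSpace ℝ H] [CompleteSpace H]

theorem integral_comp_stepIdx_of_mem {t : ℕ → ℝ} (ht : StrictMono t) {N k : ℕ} (hk : k < N)
    (φ : ℕ → H) {s : ℝ} (hs : s ∈ Icc (t k) (t (k + 1))) :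
    ∫ r in (t k)..s, φ (stepIdx t N r) = (s - t k) • φ k := by
  rw [← intervalIntegral.integral_const]
  apply intervalIntegral.integral_congr_ae
  refine Filter.Eventually.of_forall fun r hr => ?_
  rw [uIoc_of_le hs.1] at hr
  rw [stepIdx_eq ht hk ⟨hr.1, hr.2.trans hs.2⟩]

theorem primitive_comp_stepIdx {t : ℕ → ℝ} (h0 : t 0 = 0) (ht : StrictMono t) {N : ℕ}
    {V φ : ℕ → H} (hV : ∀ k < N, V (k + 1) = V k + (t (k + 1) - t k) • φ k) {k : ℕ} (hk : k ≤ N) :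
    V 0 + ∫ r in (0 : ℝ)..t k, φ (stepIdx t N r) = V k := by
  induction k with
  | zero => simp [h0]
  | succ k ih =>
    rw [← intervalIntegral.integral_add_adjacent_intervals
      (intervalIntegrable_comp_stepIdx t N φ 0 (t k))
      (intervalIntegrable_comp_stepIdx t N φ (t k) (t (k + 1))), ← add_assoc, ih (by omega),
      integral_comp_stepIdx_of_mem ht (by omega) φ ⟨(ht k.lt_succ_self).le, le_rfl⟩,
      hV k (by omega)]

/-- The approximate solution is the piecewise affine interpolant of the iterates, whose derivative
is the piecewise constant `φ`. The operator is evaluated at the left node, and the interpolant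
strays from it by at most the step length times `‖φ k‖`, whence `ρ`. -/
theorem isApprox_of_steps {t : ℕ → ℝ} (h0 : t 0 = 0) (ht : StrictMono t) {N : ℕ}
    {V φ : ℕ → H} (hV : ∀ k < N, V (k + 1) = V k + (t (k + 1) - t k) • φ k)
    {A : H → H → Prop} {f : H} {R ρ b M : ℝ} (hR : ∀ k < N, ‖φ k‖ ≤ R)
    (hρ : ∀ k < N, (t (k + 1) - t k) * ‖φ k‖ ≤ ρ)
    (hA : ∀ k < N, ∃ ζ, A (V k) ζ ∧ ‖ζ‖ ≤ M ∧ ‖φ k - (f - ζ)‖ ≤ b) :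
    IsApprox A f (V 0) (t N) R ρ b M (fun s => V 0 + ∫ r in (0 : ℝ)..s, φ (stepIdx t N r))
      (fun s => φ (stepIdx t N s)) (fun s => V (stepIdx t N s)) where
  integrable := intervalIntegrable_comp_stepIdx t N φ _ _
  bound s hs := by
    obtain ⟨k, hk, hks⟩ := exists_mem_step h0 hs
    rw [stepIdx_eq ht hk hks]
    exact hR k hk
  primitive s _ := rfl
  close s hs := by
    obtain ⟨k, hk, hks⟩ := exists_mem_step h0 hs
    rw [stepIdx_eq ht hk hks, ← intervalIntegral.integral_add_adjacent_intervals
      (intervalIntegrable_comp_stepIdx t N φ 0 (t k))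
      (intervalIntegrable_comp_stepIdx t N φ (t k) s), ← add_assoc,
      primitive_comp_stepIdx h0 ht hV hk.le,
      integral_comp_stepIdx_of_mem ht hk φ (Ioc_subset_Icc_self hks), add_sub_cancel_left,
      norm_smul, Real.norm_of_nonneg (sub_nonneg.2 hks.1.le)]
    refine le_trans ?_ (hρ k hk)
    gcongr
    exact hks.2
  evolution := Filter.Eventually.of_forall fun s hs => by
    obtain ⟨k, hk, hks⟩ := exists_mem_step h0 hs
    rw [stepIdx_eq ht hk hks]
    exact hA k hk

end Steps

/-! ### The nonlocal 1-Laplacian as a bounded monotone relation -/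

section

section AbsSubdiff

/-- This form has no case distinction: the equation `w * x = |x|` yields monotonicity by algebra and
can be passed to weak limits in `w`. -/
theorem mem_absSubdiff_iff {w x : ℝ} : w ∈ absSubdiff x ↔ |w| ≤ 1 ∧ w * x = |x| := by
  unfold absSubdiff
  split_ifs with h1 h2
  · rw [abs_of_pos h1, mem_singleton_iff]
    constructor
    · rintro rfl; simp
    · rintro ⟨-, h⟩; exact mul_right_cancel₀ h1.ne' (by linarith)
  · rw [abs_of_neg h2, mem_singleton_iff]
    constructor
    · rintro rfl; simp
    · rintro ⟨-, h⟩; exact mul_right_cancel₀ h2.ne (by linarith)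
  · have : x = 0 := le_antisymm (not_lt.1 h1) (not_lt.1 h2)
    subst this
    simp [abs_le]

theorem sign_mem_absSubdiff (x : ℝ) : Real.sign x ∈ absSubdiff x := by
  unfold absSubdiff
  split_ifs with h1 h2
  · simp [Real.sign_of_pos h1]
  · simp [Real.sign_of_neg h2]
  · have : x = 0 := le_antisymm (not_lt.1 h1) (not_lt.1 h2)
    simp [this]

theorem abs_sign_le_one (x : ℝ) : |Real.sign x| ≤ 1 :=
  (mem_absSubdiff_iff.1 (sign_mem_absSubdiff x)).1

theorem absSubdiff_monotone {w₁ w₂ a b : ℝ} (h₁ : w₁ ∈ absSubdiff a) (h₂ : w₂ ∈ absSubdiff b) :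
    0 ≤ (w₁ - w₂) * (a - b) := by
  rw [mem_absSubdiff_iff] at h₁ h₂
  have h3 : w₁ * b ≤ |b| := (le_abs_self _).trans (by
    rw [abs_mul]; exact mul_le_of_le_one_left (abs_nonneg _) h₁.1)
  have h4 : w₂ * a ≤ |a| := (le_abs_self _).trans (by
    rw [abs_mul]; exact mul_le_of_le_one_left (abs_nonneg _) h₂.1)
  nlinarith [h₁.2, h₂.2]

theorem measurable_sign : Measurable Real.sign := by
  unfold Real.sign
  exact Measurable.ite measurableSet_Iio measurable_const
    (Measurable.ite measurableSet_Ioi measurable_const measurable_const)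

end AbsSubdiff

section PartialIntegral

theorem eLpNorm_two_sq {α : Type*} [MeasurableSpace α] (μ : Measure α) (F : α → ℝ) :
    eLpNorm F 2 μ ^ 2 = ∫⁻ x, ‖F x‖ₑ ^ 2 ∂μ := by
  have := eLpNorm_nnreal_pow_eq_lintegral (μ := μ) (f := F) (p := 2) two_ne_zero
  norm_num at this
  exact_mod_cast this

variable {α : Type*} [MeasurableSpace α] {μ : Measure α} [IsProbabilityMeasure μ]
  {G w : α → α → ℝ}

theorem integrable_mul_of_abs_le_one
    (hG : MemLp (Function.uncurry G) 2 (μ.prod μ))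
    (hw : AEStronglyMeasurable (Function.uncurry w) (μ.prod μ))
    (hw1 : ∀ᵐ p ∂μ.prod μ, |w p.1 p.2| ≤ 1) :
    Integrable (fun p : α × α => G p.1 p.2 * w p.1 p.2) (μ.prod μ) :=
  (hG.integrable one_le_two).mul_bdd (c := 1) hw hw1

/-- On a probability space the `L^1` norm of each slice is at most its `L^2` norm; Tonelli then sums
the squares of the slices. -/
theorem eLpNorm_integral_mul_le
    (hG : MemLp (Function.uncurry G) 2 (μ.prod μ))
    (hw : AEStronglyMeasurable (Function.uncurry w) (μ.prod μ))
    (hw1 : ∀ᵐ p ∂μ.prod μ, |w p.1 p.2| ≤ 1) :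
    MemLp (fun x => ∫ y, G x y * w x y ∂μ) 2 μ ∧
    eLpNorm (fun x => ∫ y, G x y * w x y ∂μ) 2 μ ≤ eLpNorm (Function.uncurry G) 2 (μ.prod μ) := by
  have hint := integrable_mul_of_abs_le_one hG hw hw1
  have hmeas : AEStronglyMeasurable (fun x => ∫ y, G x y * w x y ∂μ) μ :=
    hint.aestronglyMeasurable.integral_prod_right'
  have hle : eLpNorm (fun x => ∫ y, G x y * w x y ∂μ) 2 μ ≤
      eLpNorm (Function.uncurry G) 2 (μ.prod μ) := by
    rw [← ENNReal.pow_le_pow_left_iff two_ne_zero, eLpNorm_two_sq, eLpNorm_two_sq,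
      lintegral_prod _ (by exact (hG.aestronglyMeasurable.enorm.pow_const 2))]
    apply lintegral_mono_ae
    filter_upwards [Measure.ae_ae_of_ae_prod hw1, hG.aestronglyMeasurable.prodMk_left]
      with x hx hGx
    change _ ≤ ∫⁻ y, ‖G x y‖ₑ ^ 2 ∂μ
    rw [← eLpNorm_two_sq]
    gcongr
    calc ‖∫ y, G x y * w x y ∂μ‖ₑ ≤ ∫⁻ y, ‖G x y * w x y‖ₑ ∂μ := enorm_integral_le_lintegral_enorm _
      _ ≤ ∫⁻ y, ‖G x y‖ₑ ∂μ := by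
        apply lintegral_mono_ae
        filter_upwards [hx] with y hy
        rw [enorm_mul]
        refine mul_le_of_le_one_right' ?_
        rw [← ofReal_norm, Real.norm_eq_abs]
        exact ENNReal.ofReal_le_one.2 hy
      _ = eLpNorm (G x) 1 μ := (eLpNorm_one_eq_lintegral_enorm).symm
      _ ≤ eLpNorm (G x) 2 μ := eLpNorm_le_eLpNorm_of_exponent_le one_le_two hGx
  exact ⟨⟨hmeas, hle.trans_lt hG.2⟩, hle⟩

end PartialIntegral

variable {d : ℕ}

instance isProbabilityMeasure_mu : IsProbabilityMeasure (mu d) := by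
  refine ⟨?_⟩
  rw [mu, Measure.restrict_apply_univ, Om, Real.volume_Icc_pi]
  simp

theorem ae_mem_Om : ∀ᵐ x ∂mu d, x ∈ Om d := ae_restrict_mem measurableSet_Icc

theorem mu_prod_mu : (mu d).prod (mu d) = (volume : Measure (Pt d × Pt d)).restrict
    (Om d ×ˢ Om d) := by
  rw [mu, Measure.prod_restrict]; rfl

theorem ae_mem_Om_prod : ∀ᵐ p ∂(mu d).prod (mu d), p.1 ∈ Om d ∧ p.2 ∈ Om d := by
  rw [mu_prod_mu]
  exact ae_restrict_mem (measurableSet_Icc.prod measurableSet_Icc)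

/-- A square integrable, nonnegative and symmetric kernel on `Ω²`. -/
structure IsKernel (K : Pt d → Pt d → ℝ) : Prop where
  memLp : MemLp (Function.uncurry K) 2 ((mu d).prod (mu d))
  nonneg : ∀ᵐ p ∂(mu d).prod (mu d), 0 ≤ K p.1 p.2
  symm : ∀ᵐ p ∂(mu d).prod (mu d), K p.1 p.2 = K p.2 p.1

theorem isKernel_of_linf2norm {K : Pt d → Pt d → ℝ} (hK_meas : Measurable (Function.uncurry K))
    (hK_nonneg : ∀ x ∈ Om d, ∀ y ∈ Om d, 0 ≤ K x y)
    (hK_symm : ∀ x ∈ Om d, ∀ y ∈ Om d, K x y = K y x) (hK_L2 : linf2norm K < ⊤) :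
    IsKernel K where
  memLp := by
    refine ⟨hK_meas.aestronglyMeasurable, ?_⟩
    have h : eLpNorm (Function.uncurry K) 2 ((mu d).prod (mu d)) ^ 2 ≤ linf2norm K ^ 2 := by
      rw [eLpNorm_two_sq, lintegral_prod _ (by fun_prop)]
      calc _ ≤ ∫⁻ _, linf2norm K ^ 2 ∂mu d := by
            apply lintegral_mono_ae
            filter_upwards [ae_mem_Om] with x hx
            change ∫⁻ y, ‖K x y‖ₑ ^ 2 ∂mu d ≤ _
            rw [← eLpNorm_two_sq]
            gcongr
            exact le_iSup₂ (f := fun x (_ : x ∈ Om d) => eLpNorm (K x) 2 (mu d)) x hx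
        _ = _ := by simp
    exact ((ENNReal.pow_le_pow_left_iff two_ne_zero).1 h).trans_lt hK_L2
  nonneg := ae_mem_Om_prod.mono fun p hp => hK_nonneg _ hp.1 _ hp.2
  symm := ae_mem_Om_prod.mono fun p hp => hK_symm _ hp.1 _ hp.2

/-- The bound does not involve `U`. It is what lifts solutions from `L^1` to `L^2` and bounds the
speed of every scheme. -/
theorem InOneLaplacian.memLp {K : Pt d → Pt d → ℝ} (hK : IsKernel K) {U η : Pt d → ℝ}
    (h : InOneLaplacian K U η) : MemLp η 2 (mu d) ∧
      eLpNorm η 2 (mu d) ≤ eLpNorm (Function.uncurry K) 2 ((mu d).prod (mu d)) := by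
  obtain ⟨-, -, w, hw, hw1, -, -, hη⟩ := h
  obtain ⟨h1, h2⟩ := eLpNorm_integral_mul_le hK.memLp hw hw1
  refine ⟨(memLp_congr_ae hη).2 h1.neg, ?_⟩
  rw [eLpNorm_congr_ae hη]
  exact (eLpNorm_neg (fun x => ∫ y, K x y * w x y ∂mu d) 2 _).trans_le h2

theorem InOneLaplacian.congr_ae {K : Pt d → Pt d → ℝ} {U U' η η' : Pt d → ℝ}
    (h : InOneLaplacian K U η) (hU : U =ᵐ[mu d] U') (hη : η =ᵐ[mu d] η') :
    InOneLaplacian K U' η' := by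
  obtain ⟨h1, h2, w, hw, hw1, hw2, hw3, h3⟩ := h
  refine ⟨h1.congr hU, h2.congr hη, w, hw, hw1, hw2, ?_, ?_⟩
  · filter_upwards [hw3, Measure.quasiMeasurePreserving_fst.ae hU,
      Measure.quasiMeasurePreserving_snd.ae hU] with p hp h4 h5
    rwa [← h4, ← h5]
  · filter_upwards [h3, hη] with x hx hx'
    rw [← hx', hx]

/-- The nonlocal `1`-Laplacian is monotone. -/
theorem InOneLaplacian.monotone {K : Pt d → Pt d → ℝ} (hK : IsKernel K)
    {U₁ U₂ η₁ η₂ : Pt d → ℝ} (h₁ : InOneLaplacian K U₁ η₁) (h₂ : InOneLaplacian K U₂ η₂)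
    (hU₁ : MemLp U₁ 2 (mu d)) (hU₂ : MemLp U₂ 2 (mu d)) :
    0 ≤ ∫ x, (η₁ x - η₂ x) * (U₁ x - U₂ x) ∂mu d := by
  obtain ⟨-, -, w₁, hw₁, hb₁, ha₁, hs₁, hη₁⟩ := h₁
  obtain ⟨-, -, w₂, hw₂, hb₂, ha₂, hs₂, hη₂⟩ := h₂
  set μ := mu d
  set D : Pt d → ℝ := fun x => U₁ x - U₂ x with hD
  have hDL : MemLp D 2 μ := hU₁.sub hU₂
  set B : Pt d × Pt d → ℝ := fun p =>
    K p.1 p.2 * w₁ p.1 p.2 - K p.1 p.2 * w₂ p.1 p.2 with hB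
  have hint₁ := integrable_mul_of_abs_le_one hK.memLp hw₁ hb₁
  have hint₂ := integrable_mul_of_abs_le_one hK.memLp hw₂ hb₂
  have hBL : MemLp B 2 (μ.prod μ) := by
    refine MemLp.sub ?_ ?_
    · refine hK.memLp.mono hint₁.aestronglyMeasurable ?_
      filter_upwards [hb₁] with p hp
      rw [norm_mul]
      exact mul_le_of_le_one_right (norm_nonneg _) hp
    · refine hK.memLp.mono hint₂.aestronglyMeasurable ?_
      filter_upwards [hb₂] with p hp
      rw [norm_mul]
      exact mul_le_of_le_one_right (norm_nonneg _) hp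
  have hD1 : MemLp (fun p : Pt d × Pt d => D p.1) 2 (μ.prod μ) := hDL.comp_fst μ
  have hD2 : MemLp (fun p : Pt d × Pt d => D p.2) 2 (μ.prod μ) := hDL.comp_snd μ
  have hi1 : Integrable (fun p => B p * D p.1) (μ.prod μ) := hBL.integrable_mul hD1
  have hi2 : Integrable (fun p => B p * D p.2) (μ.prod μ) := hBL.integrable_mul hD2
  have e1 : ∫ x, (η₁ x - η₂ x) * D x ∂μ = -∫ p, B p * D p.1 ∂μ.prod μ := by
    rw [integral_prod _ hi1, ← integral_neg]
    apply integral_congr_ae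
    filter_upwards [hη₁, hη₂, hint₁.prod_right_ae, hint₂.prod_right_ae] with x h1 h2 h3 h4
    rw [integral_mul_const, h1, h2, hB]
    simp only
    rw [integral_sub h3 h4]
    ring
  -- `B` is antisymmetric, being a symmetric kernel times an antisymmetric field. So the pairing `-∫
  -- B D(x)` is half of `∫ B (D(y) - D(x))`, whose integrand is nonnegative.
  have e2 : ∫ p, B p * D p.1 ∂μ.prod μ = -∫ p, B p * D p.2 ∂μ.prod μ := by
    rw [← integral_prod_swap, ← integral_neg]
    apply integral_congr_ae
    filter_upwards [hK.symm, ha₁, ha₂] with p h1 h2 h3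
    simp only [hB, Prod.fst_swap, Prod.snd_swap]
    rw [← h1, h2, h3]
    ring
  have e3 : 0 ≤ ∫ p, (B p * D p.2 - B p * D p.1) ∂μ.prod μ := by
    apply integral_nonneg_of_ae
    filter_upwards [hK.nonneg, hs₁, hs₂] with p h1 h2 h3
    have := mul_nonneg h1 (absSubdiff_monotone h2 h3)
    simp only [hB, hD, Pi.zero_apply]
    nlinarith
  rw [integral_sub hi2 hi1] at e3
  rw [e1]
  linarith

theorem inOneLaplacian_sign {K : Pt d → Pt d → ℝ} (hK : IsKernel K) {U : Pt d → ℝ}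
    (hU : MemLp U 2 (mu d)) :
    InOneLaplacian K U fun x => -∫ y, K x y * Real.sign (U y - U x) ∂mu d := by
  have hw : AEStronglyMeasurable (Function.uncurry fun x y => Real.sign (U y - U x))
      ((mu d).prod (mu d)) := by
    have h : AEStronglyMeasurable (fun p : Pt d × Pt d => U p.2 - U p.1) ((mu d).prod (mu d)) :=
      hU.aestronglyMeasurable.comp_snd.sub hU.aestronglyMeasurable.comp_fst
    exact (measurable_sign.comp_aemeasurable h.aemeasurable).aestronglyMeasurable
  have hb : ∀ᵐ p ∂(mu d).prod (mu d), |Real.sign (U p.2 - U p.1)| ≤ 1 :=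
    Filter.Eventually.of_forall fun p => abs_sign_le_one _
  refine ⟨hU.integrable one_le_two,
    ((eLpNorm_integral_mul_le hK.memLp hw hb).1.integrable one_le_two).neg, _, hw, hb, ?_, ?_, ?_⟩
  · exact Filter.Eventually.of_forall fun p => by rw [← Real.sign_neg, neg_sub]
  · exact Filter.Eventually.of_forall fun p => sign_mem_absSubdiff _
  · exact Filter.Eventually.of_forall fun p => rfl

/-- The nonlocal `1`-Laplacian as a relation on `L^2(Ω)`. -/
def LapRel (K : Pt d → Pt d → ℝ) (U ζ : Lp ℝ 2 (mu d)) : Prop := InOneLaplacian K U ζ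

theorem LapRel.monotone {K : Pt d → Pt d → ℝ} (hK : IsKernel K) (U₁ ζ₁ U₂ ζ₂ : Lp ℝ 2 (mu d))
    (h₁ : LapRel K U₁ ζ₁) (h₂ : LapRel K U₂ ζ₂) : 0 ≤ inner ℝ (ζ₁ - ζ₂) (U₁ - U₂) := by
  have h := InOneLaplacian.monotone hK h₁ h₂ (Lp.memLp U₁) (Lp.memLp U₂)
  rw [L2.inner_def]
  refine h.trans_eq (integral_congr_ae ?_)
  filter_upwards [Lp.coeFn_sub ζ₁ ζ₂, Lp.coeFn_sub U₁ U₂] with x hx hx'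
  rw [hx, hx']
  simp [mul_comm]

theorem LapRel.norm_le {K : Pt d → Pt d → ℝ} (hK : IsKernel K) {U ζ : Lp ℝ 2 (mu d)}
    (h : LapRel K U ζ) : ‖ζ‖ ≤ l2norm₂ K := by
  rw [Lp.norm_def]
  exact ENNReal.toReal_mono hK.memLp.2.ne (InOneLaplacian.memLp hK h).2

end

/-! ### Solutions in `L^1` are solutions in `L^2`; uniqueness -/

section

variable {d : ℕ}

/-- The embedding of `L^2(Ω)` into `L^1(Ω)`. -/
def inclL1 (d : ℕ) : Lp ℝ 2 (mu d) →L[ℝ] Lp ℝ 1 (mu d) :=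
  LinearMap.mkContinuous
    { toFun := fun F => ((Lp.memLp F).mono_exponent one_le_two).toLp F
      map_add' := fun F G => by
        rw [← MemLp.toLp_add]
        exact MemLp.toLp_congr _ _ (Lp.coeFn_add F G)
      map_smul' := fun c F => by
        rw [RingHom.id_apply, ← MemLp.toLp_const_smul]
        exact MemLp.toLp_congr _ _ (Lp.coeFn_smul c F) } 1 (fun F => by
      rw [one_mul]
      change ‖((Lp.memLp F).mono_exponent one_le_two).toLp F‖ ≤ ‖F‖
      rw [Lp.norm_toLp, Lp.norm_def]
      exact ENNReal.toReal_mono (Lp.memLp F).2.ne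
        (eLpNorm_le_eLpNorm_of_exponent_le one_le_two (Lp.aestronglyMeasurable F)))

theorem coeFn_inclL1 (F : Lp ℝ 2 (mu d)) : (inclL1 d F : Pt d → ℝ) =ᵐ[mu d] F :=
  MemLp.coeFn_toLp ((Lp.memLp F).mono_exponent one_le_two)

theorem inclL1_injective : Function.Injective (inclL1 d) := fun F G h => by
  apply Lp.ext
  exact (coeFn_inclL1 F).symm.trans ((Lp.ext_iff.1 h).trans (coeFn_inclL1 G))

/-- An injective continuous map between Polish spaces is a measurable embedding (Lusin–Souslin), so
measurability can be pulled back from `L^1` to `L^2` along the inclusion. -/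
theorem aestronglyMeasurable_of_inclL1_comp {ν : Measure ℝ} {v : ℝ → Lp ℝ 1 (mu d)}
    {w : ℝ → Lp ℝ 2 (mu d)} (hv : AEStronglyMeasurable v ν) (h : ∀ᵐ s ∂ν, inclL1 d (w s) = v s) :
    AEStronglyMeasurable w ν := by
  let _ : MeasurableSpace ↥(Lp ℝ 1 (mu d)) := borel _
  have : BorelSpace ↥(Lp ℝ 1 (mu d)) := ⟨rfl⟩
  let _ : MeasurableSpace ↥(Lp ℝ 2 (mu d)) := borel _
  have : BorelSpace ↥(Lp ℝ 2 (mu d)) := ⟨rfl⟩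
  have : Fact ((1 : ℝ≥0∞) ≠ ⊤) := ⟨ENNReal.one_ne_top⟩
  have : Fact ((2 : ℝ≥0∞) ≠ ⊤) := ⟨ENNReal.ofNat_ne_top⟩
  have hemb : MeasurableEmbedding (inclL1 d) :=
    (inclL1 d).continuous.measurableEmbedding inclL1_injective
  have h1 : AEMeasurable (fun s => inclL1 d (w s)) ν :=
    hv.aemeasurable.congr (h.mono fun s hs => hs.symm)
  exact (hemb.aemeasurable_comp_iff.1 h1).aestronglyMeasurable

/-- A solution takes values in `L^2(Ω)`, and solves the equation there. -/
theorem IsSolution.exists_isApprox {K : Pt d → Pt d → ℝ} (hK : IsKernel K) {f g : Pt d → ℝ}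
    (hf : MemLp f 2 (mu d)) (hg : MemLp g 2 (mu d)) {T : ℝ} (hT : 0 ≤ T)
    {u : ℝ → Lp ℝ 1 (mu d)} (hu : IsSolution K (fun _ => f) g T u) :
    ∃ U Φ : ℝ → Lp ℝ 2 (mu d),
      IsApprox (LapRel K) (hf.toLp f) (hg.toLp g) T (‖hf.toLp f‖ + l2norm₂ K) 0 0 (l2norm₂ K)
        U Φ U ∧ ∀ t ∈ Icc 0 T, inclL1 d (U t) = u t := by
  classical
  obtain ⟨v, hvint, hprim, hev⟩ := hu.evolution
  set M := l2norm₂ K with hM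
  have hM0 : 0 ≤ M := ENNReal.toReal_nonneg
  -- The derivative is lifted to `L^2` pointwise in time by choice. Measurability of the choice is
  -- recovered afterwards from the fact that its image in `L^1` is `v`.
  let Good : ℝ → Lp ℝ 2 (mu d) → Prop := fun s ψ => inclL1 d ψ = v s ∧ ∃ ζ : Lp ℝ 2 (mu d),
    InOneLaplacian K (u s) ζ ∧ ‖ζ‖ ≤ M ∧ ψ = hf.toLp f - ζ
  let Φ : ℝ → Lp ℝ 2 (mu d) := fun s => if h : ∃ ψ, Good s ψ then h.choose else 0
  have hgood : ∀ᵐ s ∂volume.restrict (Ioo 0 T), Good s (Φ s) := by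
    filter_upwards [hev] with s hs
    obtain ⟨η, hη, hvs⟩ := hs
    have hηL := (InOneLaplacian.memLp hK hη).1
    have : ∃ ψ, Good s ψ := by
      refine ⟨hf.toLp f - hηL.toLp η, ?_, hηL.toLp η, ?_, ?_, rfl⟩
      · apply Lp.ext
        filter_upwards [coeFn_inclL1 (hf.toLp f - hηL.toLp η), hvs,
          Lp.coeFn_sub (hf.toLp f) (hηL.toLp η), hf.coeFn_toLp, hηL.coeFn_toLp] with x a1 a2 a3 a4 a5
        rw [a1, a2, a3, Pi.sub_apply, a4, a5]
        ring
      · exact hη.congr_ae (ae_eq_refl _) hηL.coeFn_toLp.symm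
      · rw [Lp.norm_toLp, hM]
        exact ENNReal.toReal_mono hK.memLp.2.ne (InOneLaplacian.memLp hK hη).2
    simp only [Φ, dif_pos this]
    exact this.choose_spec
  have hΦbound : ∀ s, ‖Φ s‖ ≤ ‖hf.toLp f‖ + M := by
    intro s
    by_cases h : ∃ ψ, Good s ψ
    · simp only [Φ, dif_pos h]
      obtain ⟨-, ζ, -, hζ, he⟩ := h.choose_spec
      rw [he]
      exact (norm_sub_le _ _).trans (by gcongr)
    · simp only [Φ, dif_neg h, norm_zero]
      positivity
  have hΦmeas : AEStronglyMeasurable Φ (volume.restrict (Ioo 0 T)) :=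
    aestronglyMeasurable_of_inclL1_comp hvint.aestronglyMeasurable (hgood.mono fun s hs => hs.1)
  have hΦint : IntervalIntegrable Φ volume 0 T := by
    rw [intervalIntegrable_iff_integrableOn_Ioo_of_le hT]
    exact Integrable.of_bound hΦmeas _ (Filter.Eventually.of_forall hΦbound)
  have hIocIoo : ∀ {p : ℝ → Prop}, (∀ᵐ s ∂volume.restrict (Ioo 0 T), p s) →
      ∀ᵐ s, s ∈ Ioc 0 T → p s := by
    intro p hp
    rw [Measure.restrict_congr_set Ioo_ae_eq_Ioc, ae_restrict_iff' measurableSet_Ioc] at hp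
    exact hp
  have hu0 : inclL1 d (hg.toLp g) = u 0 := by
    apply Lp.ext
    exact (coeFn_inclL1 _).trans (hg.coeFn_toLp.trans hu.initial.symm)
  let U : ℝ → Lp ℝ 2 (mu d) := fun t => hg.toLp g + ∫ s in (0 : ℝ)..t, Φ s
  have hU : ∀ t ∈ Icc 0 T, inclL1 d (U t) = u t := by
    intro t ht
    have hΦt : IntervalIntegrable Φ volume 0 t := hΦint.mono_set (by
      rw [uIcc_of_le ht.1, uIcc_of_le hT]; exact Icc_subset_Icc_right ht.2)
    rw [hprim t ht, map_add, hu0, ← ContinuousLinearMap.intervalIntegral_comp_comm _ hΦt]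
    congr 1
    apply intervalIntegral.integral_congr_ae
    filter_upwards [hIocIoo hgood] with s hs hst
    rw [uIoc_of_le ht.1] at hst
    exact (hs ⟨hst.1, hst.2.trans ht.2⟩).1
  refine ⟨U, Φ, ⟨hΦint, fun s _ => hΦbound s, fun s _ => rfl, fun s _ => by simp, ?_⟩, hU⟩
  filter_upwards [hIocIoo hgood] with s hs hsT
  obtain ⟨-, ζ, hζ, hζM, he⟩ := hs hsT
  refine ⟨ζ, ?_, hζM, by simp [he]⟩
  refine hζ.congr_ae ?_ (ae_eq_refl _)
  rw [← hU s ⟨hsT.1.le, hsT.2⟩]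
  exact coeFn_inclL1 _

theorem l2norm₂_nonneg (F : Pt d → Pt d → ℝ) : 0 ≤ l2norm₂ F := ENNReal.toReal_nonneg

/-- Two solutions with the same data are exact instances of `IsApprox`, with `ρ = b = 0` and equal
initial values, so every term of the comparison estimate vanishes. -/
theorem IsSolution.unique {K : Pt d → Pt d → ℝ} (hK : IsKernel K) {f g : Pt d → ℝ}
    (hf : MemLp f 2 (mu d)) (hg : MemLp g 2 (mu d)) {T : ℝ} (hT : 0 ≤ T)
    {u v : ℝ → Lp ℝ 1 (mu d)} (hu : IsSolution K (fun _ => f) g T u)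
    (hv : IsSolution K (fun _ => f) g T v) {t : ℝ} (ht : t ∈ Icc 0 T) : u t = v t := by
  obtain ⟨U, Φ, hU, hUu⟩ := hu.exists_isApprox hK hf hg hT
  obtain ⟨V, Ψ, hV, hVv⟩ := hv.exists_isApprox hK hf hg hT
  have h := (hU.mono ht).norm_sub_sq_le (LapRel.monotone hK) ht.1 (l2norm₂_nonneg K) le_rfl le_rfl
    (hV.mono ht)
  simp only [sub_self, norm_zero] at h
  have h0 : ‖U t - V t‖ ^ 2 ≤ 0 := by simpa using h
  have h1 : U t = V t := by
    rw [← sub_eq_zero, ← norm_eq_zero]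
    exact pow_eq_zero_iff two_ne_zero |>.1 (le_antisymm h0 (sq_nonneg _))
  rw [← hUu t ht, ← hVv t ht, h1]

end

/-! ### Weak limits of sign fields, and measurability of curves in `L^2` -/

section

section WeakLimit

variable {α : Type*} [MeasurableSpace α] {ν : Measure α} [IsFiniteMeasure ν]

/-- Sequences bounded by `1` have weak limits along the hyperfilter. -/
theorem exists_weak_limit_of_abs_le_one (w : ℕ → α → ℝ) (hw : ∀ n, Measurable (w n))
    (hw1 : ∀ n a, |w n a| ≤ 1) :
    ∃ W : α → ℝ, StronglyMeasurable W ∧ (∀ᵐ a ∂ν, |W a| ≤ 1) ∧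
      ∀ φ, MemLp φ 2 ν → Filter.Tendsto (fun n => ∫ a, w n a * φ a ∂ν)
        (Filter.hyperfilter ℕ : Filter ℕ) (nhds (∫ a, W a * φ a ∂ν)) := by
  have hL : ∀ n, MemLp (w n) 2 ν := fun n =>
    MemLp.of_bound (hw n).aestronglyMeasurable 1 (Filter.Eventually.of_forall (hw1 n))
  have hbd : ∀ n, ‖(hL n).toLp (w n)‖ ≤ (eLpNorm (fun _ : α => (1 : ℝ)) 2 ν).toReal := by
    intro n
    rw [Lp.norm_toLp]
    refine ENNReal.toReal_mono (memLp_const (1 : ℝ)).2.ne (eLpNorm_mono fun a => ?_)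
    simpa using hw1 n a
  obtain ⟨W, hW⟩ := exists_weak_limit (fun n => (hL n).toLp (w n)) hbd
  have hlim : ∀ φ, MemLp φ 2 ν → Filter.Tendsto (fun n => ∫ a, w n a * φ a ∂ν)
      (Filter.hyperfilter ℕ : Filter ℕ) (nhds (∫ a, W a * φ a ∂ν)) := by
    intro φ hφ
    have h := hW (hφ.toLp φ)
    simp only [L2.inner_def] at h
    convert! h using 1
    · funext n
      apply integral_congr_ae
      filter_upwards [(hL n).coeFn_toLp, hφ.coeFn_toLp] with a h1 h2
      rw [h1, h2]; simp [mul_comm]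
    · congr 1
      apply integral_congr_ae
      filter_upwards [hφ.coeFn_toLp] with a h2
      rw [h2]; simp [mul_comm]
  refine ⟨W, Lp.stronglyMeasurable W, ?_, hlim⟩
  have hWint : Integrable (fun a => W a) ν := (Lp.memLp W).integrable one_le_two
  -- Testing with indicators gives convergence of all set integrals, and inequalities between set
  -- integrals are inequalities almost everywhere.
  have hset : ∀ s, MeasurableSet s → Filter.Tendsto (fun n => ∫ a in s, w n a ∂ν)
      (Filter.hyperfilter ℕ : Filter ℕ) (nhds (∫ a in s, W a ∂ν)) := by
    intro s hs
    have h := hlim (s.indicator fun _ => 1) ((memLp_const (1 : ℝ)).indicator hs)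
    have e : ∀ F : α → ℝ, ∫ a, F a * s.indicator (fun _ => (1 : ℝ)) a ∂ν = ∫ a in s, F a ∂ν := by
      intro F
      rw [← integral_indicator hs]
      congr 1; ext a
      by_cases ha : a ∈ s <;> simp [ha]
    simpa only [e] using h
  have hle : ∀ᵐ a ∂ν, W a ≤ 1 := by
    apply ae_le_of_forall_setIntegral_le hWint (integrable_const 1)
    intro s hs _
    refine le_of_tendsto (hset s hs) (Filter.Eventually.of_forall fun n => ?_)
    exact integral_mono ((hL n).integrable one_le_two).integrableOn (integrable_const 1)
      fun a => (le_abs_self _).trans (hw1 n a)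
  have hge : ∀ᵐ a ∂ν, -1 ≤ W a := by
    apply ae_le_of_forall_setIntegral_le (integrable_const (-1)) hWint
    intro s hs _
    refine ge_of_tendsto (hset s hs) (Filter.Eventually.of_forall fun n => ?_)
    exact integral_mono (integrable_const (-1)) ((hL n).integrable one_le_two).integrableOn
      fun a => (abs_le.1 (hw1 n a)).1
  filter_upwards [hle, hge] with a h1 h2 using abs_le.2 ⟨h2, h1⟩

variable {w : ℕ → α → ℝ} {W : α → ℝ}

/-- A weak limit of the `w n` and an almost everywhere limit of the `D n` can be multiplied: since
`w n * D n = |D n|`, the error `w n * D' - |D'|` is at most `2 |D n - D'|`. This is the closedness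
of the graph of the subdifferential. -/
theorem weak_limit_mul_eq_abs (hw : ∀ n, Measurable (w n)) (hw1 : ∀ n a, |w n a| ≤ 1)
    (hWm : StronglyMeasurable W) (hW1 : ∀ᵐ a ∂ν, |W a| ≤ 1)
    (hlim : ∀ φ, MemLp φ 2 ν → Filter.Tendsto (fun n => ∫ a, w n a * φ a ∂ν)
        (Filter.hyperfilter ℕ : Filter ℕ) (nhds (∫ a, W a * φ a ∂ν)))
    {D : ℕ → α → ℝ} {D' : α → ℝ} (hD' : Measurable D') (hwD : ∀ n a, w n a * D n a = |D n a|)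
    (hD : ∀ᵐ a ∂ν, Filter.Tendsto (fun n => D n a) Filter.atTop (nhds (D' a))) :
    ∀ᵐ a ∂ν, W a * D' a = |D' a| := by
  have hpos : ∀ a, 0 < 1 + |D' a| := fun a => by positivity
  -- `D'` need not be square integrable. Dividing by the positive function `1 + |D'|` gives a
  -- bounded test function without affecting the identity to be proved.
  set q : α → ℝ := fun a => D' a / (1 + |D' a|) with hq
  have hqm : Measurable q := hD'.div (measurable_const.add hD'.abs)
  have hq1 : ∀ a, |q a| ≤ 1 := fun a => by
    rw [hq]; simp only
    rw [abs_div, abs_of_pos (hpos a), div_le_one (hpos a)]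
    linarith
  have hqint : Integrable q ν :=
    Integrable.of_bound hqm.aestronglyMeasurable 1 (Filter.Eventually.of_forall hq1)
  have hWq : Integrable (fun a => W a * q a) ν :=
    Integrable.of_bound (hWm.aestronglyMeasurable.mul hqm.aestronglyMeasurable) 1 (by
      filter_upwards [hW1] with a ha
      rw [norm_mul]
      exact mul_le_one₀ ha (norm_nonneg _) (hq1 a))
  have key : (fun a => W a * q a) =ᵐ[ν] fun a => |q a| := by
    apply Integrable.ae_eq_of_forall_setIntegral_eq _ _ hWq hqint.abs
    intro s hs _
    have hφ : MemLp (s.indicator q) 2 ν := (MemLp.of_bound hqm.aestronglyMeasurable 1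
      (Filter.Eventually.of_forall hq1)).indicator hs
    have h1 := hlim _ hφ
    have e : ∀ F : α → ℝ, ∫ a, F a * s.indicator q a ∂ν = ∫ a in s, F a * q a ∂ν := by
      intro F
      rw [← integral_indicator hs]
      congr 1; ext a
      by_cases ha : a ∈ s <;> simp [ha]
    simp only [e] at h1
    have h2 : Filter.Tendsto (fun n => ∫ a in s, w n a * q a ∂ν) Filter.atTop
        (nhds (∫ a in s, |q a| ∂ν)) := by
      apply tendsto_integral_of_dominated_convergence (fun _ => 1)
      · exact fun n => ((hw n).mul hqm).aestronglyMeasurable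
      · exact integrable_const _
      · refine fun n => Filter.Eventually.of_forall fun a => ?_
        rw [norm_mul]
        exact mul_le_one₀ (hw1 n a) (norm_nonneg _) (hq1 a)
      · filter_upwards [ae_restrict_of_ae hD] with a ha
        rw [tendsto_iff_norm_sub_tendsto_zero]
        have hb : ∀ n, ‖w n a * q a - |q a|‖ ≤ 2 * |D n a - D' a| := by
          intro n
          have e1 : w n a * q a - |q a| =
              (|D n a| - |D' a| - w n a * (D n a - D' a)) / (1 + |D' a|) := by
            rw [hq]; simp only
            rw [abs_div, abs_of_pos (hpos a), ← hwD n a]; ring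
          rw [e1, Real.norm_eq_abs, abs_div, abs_of_pos (hpos a), div_le_iff₀ (hpos a)]
          have e2 : |(|D n a| - |D' a| - w n a * (D n a - D' a))| ≤
              |D n a - D' a| + |D n a - D' a| := by
            refine (abs_sub _ _).trans (add_le_add (abs_abs_sub_abs_le _ _) ?_)
            rw [abs_mul]
            exact mul_le_of_le_one_left (abs_nonneg _) (hw1 n a)
          nlinarith [abs_nonneg (D' a), abs_nonneg (D n a - D' a)]
        have h0 : Filter.Tendsto (fun n => 2 * |D n a - D' a|) Filter.atTop (nhds 0) := by
          have := (tendsto_iff_norm_sub_tendsto_zero.1 ha).const_mul 2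
          simpa using this
        exact squeeze_zero (fun n => norm_nonneg _) hb h0
    exact tendsto_nhds_unique h1 (h2.mono_left Nat.hyperfilter_le_atTop)
  filter_upwards [key] with a ha
  rw [hq] at ha
  simp only at ha
  rw [abs_div, abs_of_pos (hpos a), ← mul_div_assoc,
    div_left_inj' (hpos a).ne'] at ha
  exact ha

/-- Antisymmetry is a linear constraint: the integrals of the `w n` over a set and over its preimage
under `σ` are opposite, and this passes to the weak limit. -/
theorem weak_limit_comp_eq_neg (hWL : Integrable W ν)
    (hlim : ∀ φ, MemLp φ 2 ν → Filter.Tendsto (fun n => ∫ a, w n a * φ a ∂ν)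
        (Filter.hyperfilter ℕ : Filter ℕ) (nhds (∫ a, W a * φ a ∂ν)))
    {σ : α → α} (hσ : MeasurePreserving σ ν ν) (hσσ : ∀ a, σ (σ a) = a)
    (hwσ : ∀ n a, w n (σ a) = -w n a) : ∀ᵐ a ∂ν, W a = -W (σ a) := by
  have hemb : MeasurableEmbedding σ :=
    (MeasurableEquiv.ofInvolutive σ hσσ hσ.measurable).measurableEmbedding
  apply Integrable.ae_eq_of_forall_setIntegral_eq W (fun a => -W (σ a)) hWL
    (hσ.integrable_comp_of_integrable hWL).neg
  intro s hs _
  have h1 := hlim (s.indicator fun _ => 1) ((memLp_const (1 : ℝ)).indicator hs)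
  have h2 := hlim ((σ ⁻¹' s).indicator fun _ => 1)
    ((memLp_const (1 : ℝ)).indicator (hσ.measurable hs))
  have e : ∀ F : α → ℝ, ∀ s, MeasurableSet s →
      ∫ a, F a * s.indicator (fun _ => (1 : ℝ)) a ∂ν = ∫ a in s, F a ∂ν := by
    intro F s hs
    rw [← integral_indicator hs]
    congr 1; ext a
    by_cases ha : a ∈ s <;> simp [ha]
  have e' : ∀ F : α → ℝ, ∫ a in σ ⁻¹' s, F a ∂ν = ∫ a in s, F (σ a) ∂ν := by
    intro F
    rw [← hσ.setIntegral_preimage_emb hemb (fun a => F (σ a)) s]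
    simp only [hσσ]
  simp only [e _ _ hs] at h1
  simp only [e _ _ (hσ.measurable hs), e', hwσ, integral_neg] at h2
  have h3 := tendsto_nhds_unique h2 h1.neg
  rw [integral_neg, h3, neg_neg]

end WeakLimit

section Curry

variable {α β : Type*} [MeasurableSpace α] [MeasurableSpace β] {μ : Measure β} [SFinite μ]
  [MeasurableSpace.CountablyGenerated β]

/-- A jointly measurable function induces a strongly measurable function with values in `L^2`. -/
theorem aestronglyMeasurable_Lp_of_uncurry {ν : Measure α} {F : α → β → ℝ}
    (hF : Measurable (Function.uncurry F)) {v : α → Lp ℝ 2 μ}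
    (hv : ∀ᵐ s ∂ν, (v s : β → ℝ) =ᵐ[μ] F s) : AEStronglyMeasurable v ν := by
  classical
  have : Fact ((2 : ℝ≥0∞) ≠ ⊤) := ⟨ENNReal.ofNat_ne_top⟩
  let _ : MeasurableSpace ↥(Lp ℝ 2 μ) := borel _
  have : BorelSpace ↥(Lp ℝ 2 μ) := ⟨rfl⟩
  have hFs : ∀ s, Measurable (F s) := fun s => hF.comp measurable_prodMk_left
  have hmeas : ∀ c : β → ℝ, Measurable c →
      Measurable fun s => eLpNorm (fun x => F s x - c x) 2 μ := by
    intro c hc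
    have h : Measurable fun s => (∫⁻ x, ‖F s x - c x‖ₑ ^ 2 ∂μ) ^ (1 / 2 : ℝ) := by
      apply Measurable.pow_const
      apply Measurable.lintegral_prod_right' (f := fun p : α × β => ‖F p.1 p.2 - c p.2‖ₑ ^ 2)
      exact ((hF.sub (hc.comp measurable_snd)).enorm).pow_const 2
    convert! h using 2 with s
    rw [← eLpNorm_two_sq, ← ENNReal.rpow_natCast, ← ENNReal.rpow_mul]
    norm_num
  let G : Set α := {s | eLpNorm (F s) 2 μ < ⊤}
  have hG : MeasurableSet G := by
    have := hmeas (fun _ => 0) measurable_const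
    simp only [sub_zero] at this
    exact this measurableSet_Iio
  have hGm : ∀ s ∈ G, MemLp (F s) 2 μ := fun s hs => ⟨(hFs s).aestronglyMeasurable, hs⟩
  let v' : α → Lp ℝ 2 μ := fun s => if h : s ∈ G then (hGm s h).toLp (F s) else 0
  -- The distance from `F s` to a fixed element is measurable in `s` by Tonelli, and `L^2` is
  -- separable, so every open set is a countable union of balls, whose preimages are measurable.
  have hv' : Measurable v' := by
    apply measurable_of_isOpen
    intro U hU
    obtain ⟨S, hS, hSU⟩ : ∃ S : Set (Lp ℝ 2 μ × ℝ), S.Countable ∧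
        U = ⋃ p ∈ S, Metric.eball p.1 (ENNReal.ofReal p.2) := by
      obtain ⟨C, hC, hCd⟩ := TopologicalSpace.exists_countable_dense (Lp ℝ 2 μ)
      refine ⟨(C ×ˢ range ((↑) : ℚ → ℝ)) ∩ {p | Metric.eball p.1 (ENNReal.ofReal p.2) ⊆ U},
        (hC.prod (countable_range _)).mono inter_subset_left, ?_⟩
      apply subset_antisymm
      · intro y hy
        obtain ⟨ε, hε, hεU⟩ := Metric.isOpen_iff.1 hU y hy
        obtain ⟨c, hcC, hcy⟩ := hCd.exists_dist_lt y (half_pos hε)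
        obtain ⟨r, hr1, hr2⟩ := exists_rat_btwn hcy
        refine mem_biUnion (x := (c, (r : ℝ))) ⟨⟨hcC, mem_range_self r⟩, ?_⟩ ?_
        · simp only [mem_ofPred_eq, Metric.eball_ofReal]
          refine (Metric.ball_subset_ball' ?_).trans hεU
          rw [dist_comm] at hcy
          linarith
        · simp only [Metric.eball_ofReal]
          exact hr1
      · exact iUnion₂_subset fun p hp => hp.2
    rw [hSU, preimage_iUnion₂]
    refine MeasurableSet.biUnion hS fun p _ => ?_
    have hd : Measurable fun s => edist (v' s) p.1 := by
      have h1 : (fun s => edist (v' s) p.1) = fun s =>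
          if s ∈ G then eLpNorm (fun x => F s x - p.1 x) 2 μ else edist 0 p.1 := by
        ext s
        by_cases hs : s ∈ G
        · simp only [v', dif_pos hs, if_pos hs]
          rw [Lp.edist_def]
          apply eLpNorm_congr_ae
          filter_upwards [(hGm s hs).coeFn_toLp] with x hx
          simp [hx]
        · simp only [v', dif_neg hs, if_neg hs]
      rw [h1]
      exact Measurable.ite hG (hmeas _ (Lp.stronglyMeasurable p.1).measurable) measurable_const
    exact hd measurableSet_Iio
  refine ⟨v', hv'.stronglyMeasurable, ?_⟩
  filter_upwards [hv] with s hs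
  have hsG : s ∈ G := by
    change eLpNorm (F s) 2 μ < ⊤
    rw [← eLpNorm_congr_ae hs]
    exact (Lp.memLp (v s)).2
  simp only [v', dif_pos hsG]
  apply Lp.ext
  exact hs.trans (hGm s hsG).coeFn_toLp.symm

end Curry

end

/-! ### Convergence of Euler schemes in `L^2` -/

section

variable {d : ℕ} {K : Pt d → Pt d → ℝ}

/-- The selection of the nonlocal `1`-Laplacian by the sign function, on `L^2(Ω)`. -/
def signLapLp (hK : IsKernel K) (U : Lp ℝ 2 (mu d)) : Lp ℝ 2 (mu d) :=
  ((inOneLaplacian_sign hK (Lp.memLp U)).memLp hK).1.toLp _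

theorem coeFn_signLapLp (hK : IsKernel K) (U : Lp ℝ 2 (mu d)) :
    (signLapLp hK U : Pt d → ℝ) =ᵐ[mu d] fun x => -∫ y, K x y * Real.sign (U y - U x) ∂mu d :=
  MemLp.coeFn_toLp ((inOneLaplacian_sign hK (Lp.memLp U)).memLp hK).1

theorem lapRel_signLapLp (hK : IsKernel K) (U : Lp ℝ 2 (mu d)) : LapRel K U (signLapLp hK U) :=
  (inOneLaplacian_sign hK (Lp.memLp U)).congr_ae (ae_eq_refl _) (coeFn_signLapLp hK U).symm

/-- The forward Euler scheme in `L^2(Ω)` with step `τ`. -/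
def eulerSeq (hK : IsKernel K) (f g : Lp ℝ 2 (mu d)) (τ : ℝ) : ℕ → Lp ℝ 2 (mu d)
  | 0 => g
  | k + 1 => eulerSeq hK f g τ k + τ • (f - signLapLp hK (eulerSeq hK f g τ k))

theorem norm_sub_signLapLp_le (hK : IsKernel K) (f U : Lp ℝ 2 (mu d)) :
    ‖f - signLapLp hK U‖ ≤ ‖f‖ + l2norm₂ K :=
  (norm_sub_le _ _).trans (by gcongr; exact (lapRel_signLapLp hK U).norm_le hK)

/-- Space is not discretized here, so the consistency error `b` is zero and only the time lag `ρ`,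
proportional to `T / N`, remains. -/
theorem eulerSeq_isApprox (hK : IsKernel K) (f g : Lp ℝ 2 (mu d)) {T : ℝ} (hT : 0 < T) {N : ℕ}
    (hN : 0 < N) :
    IsApprox (LapRel K) f g T (‖f‖ + l2norm₂ K) (T / N * (‖f‖ + l2norm₂ K)) 0 (l2norm₂ K)
      (fun s => g + ∫ r in (0 : ℝ)..s, (f - signLapLp hK
        (eulerSeq hK f g (T / N) (stepIdx (fun k => k * (T / N)) N r))))
      (fun s => f - signLapLp hK
        (eulerSeq hK f g (T / N) (stepIdx (fun k => k * (T / N)) N s)))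
      (fun s => eulerSeq hK f g (T / N) (stepIdx (fun k => k * (T / N)) N s)) := by
  have hN' : (0 : ℝ) < N := Nat.cast_pos.2 hN
  have hτ : 0 < T / N := by positivity
  have hmono : StrictMono fun k : ℕ => (k : ℝ) * (T / N) := fun i j hij => by
    have : (i : ℝ) < j := Nat.cast_lt.2 hij
    simp only
    gcongr
  have hdiff : ∀ k : ℕ, ((k + 1 : ℕ) : ℝ) * (T / N) - k * (T / N) = T / N := fun k => by
    push_cast; ring
  have h := isApprox_of_steps (t := fun k : ℕ => (k : ℝ) * (T / N)) (by simp) hmono (N := N)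
    (V := eulerSeq hK f g (T / N))
    (φ := fun k => f - signLapLp hK (eulerSeq hK f g (T / N) k))
    (fun k _ => by rw [hdiff]; rfl) (A := LapRel K) (f := f) (R := ‖f‖ + l2norm₂ K)
    (ρ := T / N * (‖f‖ + l2norm₂ K)) (b := 0) (M := l2norm₂ K)
    (fun k _ => norm_sub_signLapLp_le hK f _)
    (fun k _ => by rw [hdiff]; gcongr; exact norm_sub_signLapLp_le hK f _)
    (fun k _ => ⟨_, lapRel_signLapLp hK _, (lapRel_signLapLp hK _).norm_le hK, by simp⟩)
  have hTN : (N : ℝ) * (T / N) = T := by field_simp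
  rw [hTN] at h
  exact h

/-- Any two of the schemes are comparable by `IsApprox.norm_sub_sq_le`, so they form a Cauchy
sequence at each time without any a priori knowledge of a solution. -/
theorem exists_euler_limit (hK : IsKernel K) (f g : Lp ℝ 2 (mu d)) {T : ℝ} (hT : 0 < T) :
    ∃ (idx : ℕ → ℝ → ℕ) (V : ℕ → ℕ → Lp ℝ 2 (mu d)) (u : ℝ → Lp ℝ 2 (mu d)) (C : ℝ),
      (∀ n, Measurable (idx n)) ∧
      (∀ n, ∀ s ∈ Ioc 0 T, ‖V n (idx n s) - u s‖ ≤ C * (1 / 4) ^ n) ∧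
      ∀ t ∈ Icc 0 T, Filter.Tendsto (fun n => g + ∫ r in (0 : ℝ)..t,
        (f - signLapLp hK (V n (idx n r)))) Filter.atTop (nhds (u t)) := by
  set M := l2norm₂ K with hM
  have hM0 : 0 ≤ M := l2norm₂_nonneg K
  set R := ‖f‖ + M with hR
  have hR0 : 0 ≤ R := by positivity
  -- The distance of consecutive schemes is of the order of the square root of the step, so `16 ^ n`
  -- steps make it geometric with ratio `1 / 4`.
  let N : ℕ → ℕ := fun n => 16 ^ n
  have hN : ∀ n, 0 < N n := fun n => by positivity
  let idx : ℕ → ℝ → ℕ := fun n => stepIdx (fun k => k * (T / N n)) (N n)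
  let V : ℕ → ℕ → Lp ℝ 2 (mu d) := fun n => eulerSeq hK f g (T / N n)
  let a : ℕ → ℝ → Lp ℝ 2 (mu d) := fun n s => g + ∫ r in (0 : ℝ)..s,
    (f - signLapLp hK (V n (idx n r)))
  have hap : ∀ n, IsApprox (LapRel K) f g T R (T / N n * R) 0 M (a n)
      (fun s => f - signLapLp hK (V n (idx n s))) (fun s => V n (idx n s)) :=
    fun n => eulerSeq_isApprox hK f g hT (hN n)
  set C₁ : ℝ := √(Real.exp T * (8 * M * (T * R)) * T) with hC₁
  have hdist : ∀ t ∈ Icc 0 T, ∀ n, dist (a n t) (a (n + 1) t) ≤ C₁ * (1 / 4) ^ n := by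
    intro t ht n
    have hp : ∀ n, 0 ≤ T / N n * R := fun n => by positivity
    have h := ((hap n).mono ht).norm_sub_sq_le (LapRel.monotone hK) ht.1 hM0 (hp n) (hp (n + 1))
      ((hap (n + 1)).mono ht)
    rw [dist_eq_norm]
    refine abs_le_of_sq_le_sq' (b := C₁ * (1 / 4) ^ n) ?_ (by positivity) |>.2
    refine h.trans ?_
    have hle : T / N (n + 1) * R ≤ T / N n * R := by
      have : (0 : ℝ) < N n := Nat.cast_pos.2 (hN n)
      gcongr
      exact Nat.pow_le_pow_right (by norm_num) n.le_succ
    have e1 : (C₁ * (1 / 4) ^ n) ^ 2 = Real.exp T * (8 * M * (T * R)) * T * (1 / 16) ^ n := by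
      rw [mul_pow, hC₁, Real.sq_sqrt (by positivity), ← pow_mul, mul_comm n 2, pow_mul]
      norm_num
    have e2 : T / N n * R = T * R * (1 / 16) ^ n := by
      simp only [N]; push_cast; rw [one_div, inv_pow]; field_simp
    rw [e1, sub_self, norm_zero]
    calc Real.exp t * (0 ^ 2 + ((0 + 0) ^ 2 + 4 * M * (T / N n * R + T / N (n + 1) * R)) * t)
        ≤ Real.exp T * (0 ^ 2 + ((0 + 0) ^ 2 + 4 * M * (T / N n * R + T / N n * R)) * T) := by
          have := ht.1
          have := hp n
          gcongr
          · exact ht.2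
          · exact ht.2
      _ = _ := by rw [e2]; ring
  have hlim : ∀ t ∈ Icc 0 T, ∃ l, Filter.Tendsto (fun n => a n t) Filter.atTop (nhds l) :=
    fun t ht => cauchySeq_tendsto_of_complete
      (cauchySeq_of_le_geometric (1 / 4) C₁ (by norm_num) (hdist t ht))
  choose! u hu using hlim
  refine ⟨idx, V, u, C₁ / (1 - 1 / 4) + T * R, fun n => measurable_stepIdx _ _, ?_, hu⟩
  intro n s hs
  have hs' : s ∈ Icc 0 T := Ioc_subset_Icc_self hs
  have h1 := dist_le_of_le_geometric_of_tendsto (1 / 4) C₁ (by norm_num) (hdist s hs') (hu s hs') n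
  have h2 := (hap n).close s hs
  rw [dist_eq_norm] at h1
  have e2 : T / N n * R ≤ T * R * (1 / 4) ^ n := by
    have : T / N n * R = T * R * (1 / 16) ^ n := by
      simp only [N]; push_cast; rw [one_div, inv_pow]; field_simp
    rw [this]
    gcongr
    norm_num
  rw [norm_sub_rev] at h2
  calc ‖V n (idx n s) - u s‖ ≤ ‖V n (idx n s) - a n s‖ + ‖a n s - u s‖ :=
        norm_sub_le_norm_sub_add_norm_sub _ _ _
    _ ≤ T * R * (1 / 4) ^ n + C₁ * (1 / 4) ^ n / (1 - 1 / 4) := add_le_add (h2.trans e2) h1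
    _ = _ := by ring

/-- The errors are summable in `L^1`, hence their sum is finite almost everywhere. The whole
sequence converges, so no subsequence depending on the time has to be chosen. -/
theorem ae_tendsto_of_norm_sub_le_geometric {α : Type*} [MeasurableSpace α] {μ : Measure α}
    [IsProbabilityMeasure μ] {F : ℕ → Lp ℝ 2 μ} {G : Lp ℝ 2 μ} {C : ℝ}
    (h : ∀ n, ‖F n - G‖ ≤ C * (1 / 4) ^ n) :
    ∀ᵐ x ∂μ, Filter.Tendsto (fun n => F n x) Filter.atTop (nhds (G x)) := by
  have h1 : ∀ n, ∫⁻ x, ‖F n x - G x‖ₑ ∂μ ≤ ENNReal.ofReal (C * (1 / 4) ^ n) := by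
    intro n
    calc ∫⁻ x, ‖F n x - G x‖ₑ ∂μ = eLpNorm (fun x => F n x - G x) 1 μ :=
          eLpNorm_one_eq_lintegral_enorm.symm
      _ ≤ eLpNorm (fun x => F n x - G x) 2 μ := eLpNorm_le_eLpNorm_of_exponent_le one_le_two
          ((Lp.aestronglyMeasurable _).sub (Lp.aestronglyMeasurable _))
      _ = ENNReal.ofReal ‖F n - G‖ := by
          rw [Lp.norm_def, ENNReal.ofReal_toReal (Lp.memLp _).2.ne]
          exact (eLpNorm_congr_ae (Lp.coeFn_sub (F n) G)).symm
      _ ≤ _ := ENNReal.ofReal_le_ofReal (h n)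
  have hC : 0 ≤ C := by simpa using (norm_nonneg _).trans (h 0)
  have hm : ∀ n, AEMeasurable (fun x => ‖F n x - G x‖ₑ) μ := fun n =>
    ((Lp.aestronglyMeasurable _).sub (Lp.aestronglyMeasurable _)).enorm
  have h2 : ∫⁻ x, ∑' n, ‖F n x - G x‖ₑ ∂μ ≠ ⊤ := by
    rw [lintegral_tsum hm]
    refine ne_top_of_le_ne_top ?_ (ENNReal.tsum_le_tsum h1)
    rw [← ENNReal.ofReal_tsum_of_nonneg (fun n => by positivity)
      ((summable_geometric_of_lt_one (by norm_num) (by norm_num)).mul_left C)]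
    exact ENNReal.ofReal_ne_top
  filter_upwards [ae_lt_top' (AEMeasurable.tsum hm) h2] with x hx
  rw [tendsto_iff_edist_tendsto_0]
  simpa [edist_eq_enorm_sub] using ENNReal.tendsto_atTop_zero_of_tsum_ne_top hx.ne

end

/-! ### The evolution equation tested in space-time -/

section

variable {d : ℕ} {K : Pt d → Pt d → ℝ}

/-- Space-time measure on `]0,T] × Ω²`. -/
def stMeasure (d : ℕ) (T : ℝ) : Measure (ℝ × (Pt d × Pt d)) :=
  (volume.restrict (Ioc 0 T)).prod ((mu d).prod (mu d))

instance isFiniteMeasure_stMeasure (T : ℝ) : IsFiniteMeasure (stMeasure d T) := by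
  unfold stMeasure; infer_instance

theorem memLp_kernel_stMeasure (hK : IsKernel K) (T : ℝ) :
    MemLp (fun p : ℝ × (Pt d × Pt d) => K p.2.1 p.2.2) 2 (stMeasure d T) :=
  hK.memLp.comp_snd (volume.restrict (Ioc 0 T))

/-- Tested with the indicator of `A`, the integrated equation is affine in `w`, with the square
integrable test function `K` restricted to `]0,t] × A × Ω`. In this form weak convergence of `w` in
space-time is enough to pass to the limit. -/
theorem inner_primitive_eq (hK : IsKernel K) {T t : ℝ} (ht : t ∈ Icc 0 T)
    {w : ℝ × (Pt d × Pt d) → ℝ} (hw : Measurable w) (hw1 : ∀ᵐ p ∂stMeasure d T, |w p| ≤ 1)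
    (f g : Lp ℝ 2 (mu d)) {Ψ : ℝ → Lp ℝ 2 (mu d)} (hΨ : IntervalIntegrable Ψ volume 0 t)
    (h : ∀ᵐ s ∂volume.restrict (Ioc 0 t),
      (Ψ s : Pt d → ℝ) =ᵐ[mu d] fun x => f x + ∫ y, K x y * w (s, (x, y)) ∂mu d)
    {A : Set (Pt d)} (hA : MeasurableSet A) :
    inner ℝ (indicatorConstLp 2 hA (measure_ne_top (mu d) A) (1 : ℝ))
        (g + ∫ s in (0 : ℝ)..t, Ψ s) =
      ∫ x in A, g x ∂mu d + t * ∫ x in A, f x ∂mu d +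
        ∫ p, w p * (Ioc 0 t ×ˢ (A ×ˢ univ)).indicator (fun p => K p.2.1 p.2.2) p
          ∂stMeasure d T := by
  set ψ := indicatorConstLp 2 hA (measure_ne_top (mu d) A) (1 : ℝ) with hψ
  have hψi : ∀ F : Lp ℝ 2 (mu d), inner ℝ ψ F = ∫ x in A, F x ∂mu d := fun F =>
    L2.inner_indicatorConstLp_one hA _ F
  have hS : MeasurableSet (Ioc 0 t ×ˢ (A ×ˢ (univ : Set (Pt d)))) :=
    measurableSet_Ioc.prod (hA.prod MeasurableSet.univ)
  have hres : (volume.restrict (Ioc 0 T)).restrict (Ioc 0 t) = volume.restrict (Ioc 0 t) := by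
    rw [Measure.restrict_restrict measurableSet_Ioc,
      inter_eq_left.2 (Ioc_subset_Ioc_right ht.2)]
  have hint : Integrable (fun p => w p * K p.2.1 p.2.2) (stMeasure d T) :=
    ((memLp_kernel_stMeasure hK T).integrable one_le_two).bdd_mul hw.aestronglyMeasurable hw1
  have e1 : ∫ p, w p * (Ioc 0 t ×ˢ (A ×ˢ univ)).indicator (fun p => K p.2.1 p.2.2) p
      ∂stMeasure d T = ∫ s in Ioc 0 t, ∫ x in A, ∫ y, K x y * w (s, (x, y)) ∂mu d ∂mu d := by
    have e0 : ∀ p, w p * (Ioc 0 t ×ˢ (A ×ˢ univ)).indicator (fun p => K p.2.1 p.2.2) p =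
        (Ioc 0 t ×ˢ (A ×ˢ univ)).indicator (fun p => w p * K p.2.1 p.2.2) p := by
      intro p
      by_cases hp : p ∈ Ioc 0 t ×ˢ (A ×ˢ (univ : Set (Pt d))) <;> simp [hp]
    simp only [e0]
    rw [integral_indicator hS, stMeasure, setIntegral_prod _ hint.integrableOn, hres]
    apply integral_congr_ae
    have hsec : ∀ᵐ s ∂volume.restrict (Ioc 0 T), Integrable (fun q : Pt d × Pt d =>
        w (s, q) * K q.1 q.2) ((mu d).prod (mu d)) := hint.prod_right_ae
    rw [← hres]
    filter_upwards [ae_restrict_of_ae hsec] with s hs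
    rw [setIntegral_prod _ hs.integrableOn, Measure.restrict_univ]
    simp only [mul_comm]
  have e2 : inner ℝ ψ (∫ s in (0 : ℝ)..t, Ψ s) = ∫ s in (0 : ℝ)..t, inner ℝ ψ (Ψ s) :=
    ((innerSL ℝ ψ).intervalIntegral_comp_comm hΨ).symm
  have hi : IntervalIntegrable (fun s => inner ℝ ψ (Ψ s)) volume 0 t :=
    (intervalIntegrable_iff_integrableOn_Ioc_of_le ht.1).2 ((innerSL ℝ ψ).integrable_comp hΨ.1)
  have e3 : ∫ s in Ioc 0 t, ∫ x in A, ∫ y, K x y * w (s, (x, y)) ∂mu d ∂mu d =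
      ∫ s in (0 : ℝ)..t, (inner ℝ ψ (Ψ s) - inner ℝ ψ f) := by
    rw [intervalIntegral.integral_of_le ht.1]
    apply integral_congr_ae
    filter_upwards [h] with s hs
    rw [hψi, hψi, ← integral_sub]
    · apply integral_congr_ae
      filter_upwards [ae_restrict_of_ae hs] with x hx
      rw [hx]; ring
    · exact ((Lp.memLp (Ψ s)).integrable one_le_two).integrableOn
    · exact ((Lp.memLp f).integrable one_le_two).integrableOn
  rw [e1, e3, intervalIntegral.integral_sub hi intervalIntegrable_const, inner_add_right, e2, hψi,
    intervalIntegral.integral_const, hψi f]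
  simp only [sub_zero, smul_eq_mul]
  ring

end

/-! ### Existence for the continuum problem -/

section

variable {d : ℕ} {K : Pt d → Pt d → ℝ}

theorem ext_of_setIntegral {F G : Lp ℝ 2 (mu d)}
    (h : ∀ A (hA : MeasurableSet A),
      inner ℝ (indicatorConstLp 2 hA (measure_ne_top (mu d) A) (1 : ℝ)) F =
      inner ℝ (indicatorConstLp 2 hA (measure_ne_top (mu d) A) (1 : ℝ)) G) : F = G := by
  apply Lp.ext
  apply Integrable.ae_eq_of_forall_setIntegral_eq _ _ ((Lp.memLp F).integrable one_le_two)
    ((Lp.memLp G).integrable one_le_two)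
  intro s hs _
  have := h s hs
  rwa [L2.inner_indicatorConstLp_one, L2.inner_indicatorConstLp_one] at this

/-- Existence for the continuum problem. -/
theorem exists_isSolution (hK : IsKernel K) (hKm : Measurable (Function.uncurry K))
    {f g : Pt d → ℝ} (hf : MemLp f 2 (mu d)) (hg : MemLp g 2 (mu d)) {T : ℝ} (hT : 0 < T) :
    ∃ u, IsSolution K (fun _ => f) g T u := by
  classical
  set f' := hf.toLp f with hf'
  set g' := hg.toLp g with hg'
  obtain ⟨idx, V, u, C, hidx, hclose, hlim⟩ := exists_euler_limit hK f' g' hT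
  -- the approximations as functions of time and space
  let q : ℕ → ℝ × Pt d → ℝ := fun n p => V n (idx n p.1) p.2
  have hq : ∀ n, Measurable (q n) := by
    intro n
    have h : Measurable fun p : ℕ × Pt d => (V n p.1 : Pt d → ℝ) p.2 :=
      measurable_from_prod_countable_right fun k => (Lp.stronglyMeasurable (V n k)).measurable
    exact h.comp (((hidx n).comp measurable_fst).prodMk measurable_snd)
  -- The limit curve is only given as a class in `L^2` at each time. The upper limit is a jointly
  -- measurable representative, agreeing with it for every `s` at almost every `x`.
  let u' : ℝ × Pt d → ℝ := fun p => Filter.limsup (fun n => q n p) Filter.atTop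
  have hu'm : Measurable u' := Measurable.limsup hq
  have hconv : ∀ s ∈ Ioc 0 T, ∀ᵐ x ∂mu d,
      Filter.Tendsto (fun n => q n (s, x)) Filter.atTop (nhds (u' (s, x))) ∧
        u' (s, x) = u s x := by
    intro s hs
    filter_upwards [ae_tendsto_of_norm_sub_le_geometric (fun n => hclose n s hs)] with x hx
    have : u' (s, x) = u s x := Filter.Tendsto.limsup_eq hx
    exact ⟨by rw [this]; exact hx, this⟩
  -- the signs of the differences
  let D : ℕ → ℝ × (Pt d × Pt d) → ℝ := fun n p => q n (p.1, p.2.2) - q n (p.1, p.2.1)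
  let D' : ℝ × (Pt d × Pt d) → ℝ := fun p => u' (p.1, p.2.2) - u' (p.1, p.2.1)
  let w : ℕ → ℝ × (Pt d × Pt d) → ℝ := fun n p => Real.sign (D n p)
  have hD : ∀ n, Measurable (D n) := fun n =>
    ((hq n).comp (by fun_prop)).sub ((hq n).comp (by fun_prop))
  have hD' : Measurable D' := (hu'm.comp (by fun_prop)).sub (hu'm.comp (by fun_prop))
  have hw : ∀ n, Measurable (w n) := fun n => measurable_sign.comp (hD n)
  have hw1 : ∀ n p, |w n p| ≤ 1 := fun n p => abs_sign_le_one _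
  have hDconv : ∀ᵐ p ∂stMeasure d T,
      Filter.Tendsto (fun n => D n p) Filter.atTop (nhds (D' p)) := by
    -- The set where convergence holds is measurable, so it suffices to treat each fixed time.
    rw [stMeasure, Measure.ae_prod_iff_ae_ae (measurableSet_tendsto_fun hD hD')]
    rw [ae_restrict_iff' measurableSet_Ioc]
    refine Filter.Eventually.of_forall fun s hs => ?_
    filter_upwards [Measure.quasiMeasurePreserving_fst.ae (hconv s hs),
      Measure.quasiMeasurePreserving_snd.ae (hconv s hs)] with p h1 h2
    exact h2.1.sub h1.1
  obtain ⟨W, hWm, hW1, hWlim⟩ := exists_weak_limit_of_abs_le_one (ν := stMeasure d T) w hw hw1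
  have hWD := weak_limit_mul_eq_abs hw hw1 hWm hW1 hWlim hD'
    (fun n p => (mem_absSubdiff_iff.1 (sign_mem_absSubdiff (D n p))).2) hDconv
  have hWint : Integrable W (stMeasure d T) :=
    Integrable.of_bound hWm.aestronglyMeasurable 1 hW1
  have hanti : ∀ᵐ p ∂stMeasure d T, W p = -W (p.1, p.2.swap) := by
    refine weak_limit_comp_eq_neg hWint hWlim (σ := Prod.map id Prod.swap) ?_ ?_ ?_
    · exact (MeasurePreserving.id _).prod Measure.measurePreserving_swap
    · exact fun p => rfl
    · intro n p
      simp only [w, D, Prod.map_fst, Prod.map_snd, id_eq, Prod.fst_swap, Prod.snd_swap]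
      rw [← Real.sign_neg, neg_sub]
  -- the right-hand side of the limit equation
  let η : ℝ → Pt d → ℝ := fun s x => -∫ y, K x y * W (s, (x, y)) ∂mu d
  let F : ℝ → Pt d → ℝ := fun s x => f' x + ∫ y, K x y * W (s, (x, y)) ∂mu d
  have hF : Measurable (Function.uncurry F) := by
    have h1 : StronglyMeasurable fun p : (ℝ × Pt d) × Pt d =>
        K p.1.2 p.2 * W (p.1.1, (p.1.2, p.2)) := by
      refine (hKm.comp (?_ : Measurable fun p : (ℝ × Pt d) × Pt d =>
        (p.1.2, p.2))).stronglyMeasurable.mul (hWm.comp_measurable ?_) <;> fun_prop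
    exact ((Lp.stronglyMeasurable f').comp_measurable measurable_snd).measurable.add
      h1.integral_prod_right'.measurable
  have hmain : ∀ᵐ s ∂volume.restrict (Ioc 0 T), InOneLaplacian K (u s) (η s) := by
    filter_upwards [Measure.ae_ae_of_ae_prod hW1, Measure.ae_ae_of_ae_prod hWD,
      Measure.ae_ae_of_ae_prod hanti, ae_restrict_mem measurableSet_Ioc] with s h1 h2 h3 hs
    have hwm : AEStronglyMeasurable (Function.uncurry fun x y => W (s, (x, y)))
        ((mu d).prod (mu d)) :=
      (hWm.comp_measurable (measurable_prodMk_left (x := s))).aestronglyMeasurable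
    refine ⟨(Lp.memLp (u s)).integrable one_le_two,
      ((eLpNorm_integral_mul_le hK.memLp hwm h1).1.integrable one_le_two).neg,
      fun x y => W (s, (x, y)), hwm, h1, h3, ?_, Filter.Eventually.of_forall fun x => rfl⟩
    filter_upwards [h1, h2, Measure.quasiMeasurePreserving_fst.ae (hconv s hs),
      Measure.quasiMeasurePreserving_snd.ae (hconv s hs)] with p a1 a2 a3 a4
    rw [mem_absSubdiff_iff]
    refine ⟨a1, ?_⟩
    rw [← a3.2, ← a4.2]
    exact a2
  have hηL : ∀ᵐ s ∂volume.restrict (Ioc 0 T), MemLp (η s) 2 (mu d) ∧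
      eLpNorm (η s) 2 (mu d) ≤ eLpNorm (Function.uncurry K) 2 ((mu d).prod (mu d)) :=
    hmain.mono fun s hs => hs.memLp hK
  -- The default value 0 occurs only on a null set of times, by `hηL`.
  let Ψ : ℝ → Lp ℝ 2 (mu d) := fun s =>
    if h : MemLp (η s) 2 (mu d) then f' - h.toLp (η s) else 0
  have hΨ : ∀ᵐ s ∂volume.restrict (Ioc 0 T), (Ψ s : Pt d → ℝ) =ᵐ[mu d] F s := by
    filter_upwards [hηL] with s hs
    simp only [Ψ, dif_pos hs.1]
    filter_upwards [Lp.coeFn_sub f' (hs.1.toLp (η s)), hs.1.coeFn_toLp] with x h1 h2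
    rw [h1, Pi.sub_apply, h2]
    simp [F, η]
  have hΨm : AEStronglyMeasurable Ψ (volume.restrict (Ioc 0 T)) :=
    aestronglyMeasurable_Lp_of_uncurry hF hΨ
  have hΨint : IntervalIntegrable Ψ volume 0 T := by
    rw [intervalIntegrable_iff_integrableOn_Ioc_of_le hT.le]
    refine Integrable.of_bound hΨm (‖f'‖ + l2norm₂ K) ?_
    filter_upwards [hηL] with s hs
    simp only [Ψ, dif_pos hs.1]
    refine (norm_sub_le _ _).trans ?_
    gcongr
    rw [Lp.norm_toLp]
    exact ENNReal.toReal_mono hK.memLp.2.ne hs.2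
  have hΨt : ∀ t ∈ Icc 0 T, IntervalIntegrable Ψ volume 0 t := fun t ht =>
    hΨint.mono_set (by
      rw [uIcc_of_le ht.1, uIcc_of_le hT.le]; exact Icc_subset_Icc_right ht.2)
  -- the limit of the approximations satisfies the limit equation
  have hu : ∀ t ∈ Icc 0 T, g' + ∫ s in (0 : ℝ)..t, Ψ s = u t := by
    intro t ht
    apply ext_of_setIntegral
    intro A hA
    have hφ : MemLp ((Ioc 0 t ×ˢ (A ×ˢ univ)).indicator (fun p => K p.2.1 p.2.2)) 2
        (stMeasure d T) := (memLp_kernel_stMeasure hK T).indicator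
      (measurableSet_Ioc.prod (hA.prod MeasurableSet.univ))
    have h1 : ∀ n, IntervalIntegrable (fun r => f' - signLapLp hK (V n (idx n r))) volume 0 t := by
      intro n
      refine (intervalIntegrable_const (c := ‖f'‖ + l2norm₂ K)).mono_fun ?_ ?_
      · exact ((StronglyMeasurable.of_discrete (f := fun k => f' - signLapLp hK
          (V n k))).comp_measurable (hidx n)).aestronglyMeasurable
      · exact Filter.Eventually.of_forall fun r =>
          (norm_sub_signLapLp_le hK f' _).trans (le_abs_self _)
    have h2 := fun n => inner_primitive_eq hK ht (hw n)
      (Filter.Eventually.of_forall (hw1 n)) f' g' (h1 n) (Filter.Eventually.of_forall fun s => by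
        filter_upwards [Lp.coeFn_sub f' (signLapLp hK (V n (idx n s))),
          coeFn_signLapLp hK (V n (idx n s))] with x a1 a2
        rw [a1, Pi.sub_apply, a2, sub_neg_eq_add]) hA
    have h3 := inner_primitive_eq hK ht hWm.measurable hW1 f' g' (hΨt t ht)
      (ae_restrict_of_ae_restrict_of_subset (Ioc_subset_Ioc_right ht.2) hΨ) hA
    rw [h3]
    have h4 : Filter.Tendsto (fun n => inner ℝ
        (indicatorConstLp 2 hA (measure_ne_top (mu d) A) (1 : ℝ))
        (g' + ∫ r in (0 : ℝ)..t, (f' - signLapLp hK (V n (idx n r)))))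
        (Filter.hyperfilter ℕ : Filter ℕ) (nhds (inner ℝ
        (indicatorConstLp 2 hA (measure_ne_top (mu d) A) (1 : ℝ)) (u t))) :=
      ((innerSL ℝ (indicatorConstLp 2 hA (measure_ne_top (mu d) A) (1 : ℝ))).continuous.tendsto
        _).comp ((hlim t ht).mono_left Nat.hyperfilter_le_atTop)
    simp only [h2] at h4
    -- The left side converges because the sign fields converge weakly, the right side because the
    -- Euler curves converge in norm; both limits are along the hyperfilter.
    exact tendsto_nhds_unique ((hWlim _ hφ).const_add _) h4
  have hcomm : ∀ t ∈ Icc 0 T, ∫ s in (0 : ℝ)..t, inclL1 d (Ψ s) =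
      inclL1 d (∫ s in (0 : ℝ)..t, Ψ s) := fun t ht =>
    (inclL1 d).intervalIntegral_comp_comm (hΨt t ht)
  refine ⟨fun t => inclL1 d (g' + ∫ s in (0 : ℝ)..t, Ψ s), ?_, ?_, fun s => inclL1 d (Ψ s),
    ?_, ?_, ?_⟩
  · refine (inclL1 d).continuous.comp_continuousOn (continuousOn_const.add ?_)
    have := intervalIntegral.continuousOn_primitive_interval'
      hΨint (left_mem_uIcc)
    rwa [uIcc_of_le hT.le] at this
  · filter_upwards [coeFn_inclL1 (g' + ∫ s in (0 : ℝ)..0, Ψ s), hg.coeFn_toLp] with x h1 h2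
    rw [h1, intervalIntegral.integral_same, add_zero, hg', h2]
  · have : IntegrableOn Ψ (Ioc 0 T) := hΨint.1
    exact ((inclL1 d).integrable_comp this).mono_measure
      (Measure.restrict_mono Ioo_subset_Ioc_self le_rfl)
  · intro t ht
    rw [hcomm t ht, intervalIntegral.integral_same, add_zero, map_add]
  · have h1 := ae_restrict_of_ae_restrict_of_subset 
      (show Ioo 0 T ⊆ Ioc 0 T from Ioo_subset_Ioc_self) hmain
    have h2 := ae_restrict_of_ae_restrict_of_subset 
      (show Ioo 0 T ⊆ Ioc 0 T from Ioo_subset_Ioc_self) hΨ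
    filter_upwards [h1, h2, ae_restrict_mem measurableSet_Ioo] with s a1 a2 hs
    refine ⟨η s, a1.congr_ae ?_ (ae_eq_refl _), ?_⟩
    · rw [hu s (Ioo_subset_Icc_self hs)]
      exact (coeFn_inclL1 _).symm
    · filter_upwards [coeFn_inclL1 (Ψ s), a2, hf.coeFn_toLp] with x b1 b2 b3
      rw [b1, b2]
      simp only [F, η, hf', b3]
      ring

end

/-! ### Partitions, cell averages and grids -/

section

section Partition

variable {α ι : Type*} [MeasurableSpace α] {μ : Measure α}

theorem eLpNorm_two_sq_eq_integral {F : α → ℝ} (hF : MemLp F 2 μ) :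
    eLpNorm F 2 μ ^ 2 = ENNReal.ofReal (∫ x, F x ^ 2 ∂μ) := by
  rw [eLpNorm_two_sq, ofReal_integral_eq_lintegral_ofReal hF.integrable_sq
    (Filter.Eventually.of_forall fun x => sq_nonneg _)]
  congr 1; ext x
  rw [← ofReal_norm, ← ENNReal.ofReal_pow (norm_nonneg _), Real.norm_eq_abs, sq_abs]

theorem eLpNorm_le_of_integral_sq_le {β : Type*} [MeasurableSpace β] {ν : Measure β}
    {F : α → ℝ} {G : β → ℝ} (hF : MemLp F 2 μ) (hG : MemLp G 2 ν)
    (h : ∫ x, F x ^ 2 ∂μ ≤ ∫ x, G x ^ 2 ∂ν) : eLpNorm F 2 μ ≤ eLpNorm G 2 ν := by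
  rw [← ENNReal.pow_le_pow_left_iff two_ne_zero, eLpNorm_two_sq_eq_integral hF,
    eLpNorm_two_sq_eq_integral hG]
  exact ENNReal.ofReal_le_ofReal h

/-- The decomposition of a second moment into variance and squared bias. It yields the optimality of
cell averages, the contraction property of the projection (`c = 0`), and a form of Jensen's
inequality. -/
theorem setIntegral_sub_const_sq [IsFiniteMeasure μ] {F : α → ℝ} (hF : MemLp F 2 μ) {B : Set α}
    (hB : 0 < μ.real B) (c : ℝ) :
    ∫ x in B, (F x - c) ^ 2 ∂μ = ∫ x in B, (F x - (μ.real B)⁻¹ * ∫ y in B, F y ∂μ) ^ 2 ∂μ +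
      μ.real B * ((μ.real B)⁻¹ * ∫ y in B, F y ∂μ - c) ^ 2 := by
  set a := (μ.real B)⁻¹ * ∫ y in B, F y ∂μ with ha'
  have hi : IntegrableOn F B μ := (hF.integrable one_le_two).integrableOn
  have hi2 : IntegrableOn (fun x => F x ^ 2) B μ := hF.integrable_sq.integrableOn
  have ha : ∫ x in B, F x ∂μ = μ.real B * a := by
    rw [ha', ← mul_assoc, mul_inv_cancel₀ hB.ne', one_mul]
  have key : ∀ b : ℝ, ∫ x in B, (F x - b) ^ 2 ∂μ =
      ∫ x in B, F x ^ 2 ∂μ - 2 * b * ∫ x in B, F x ∂μ + μ.real B * b ^ 2 := by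
    intro b
    have e : (fun x => (F x - b) ^ 2) = fun x => F x ^ 2 - 2 * b * F x + b ^ 2 := by
      ext x; ring
    have hib : IntegrableOn (fun x => 2 * b * F x) B μ := hi.const_mul _
    have his : IntegrableOn (fun x => F x ^ 2 - 2 * b * F x) B μ := hi2.sub hib
    rw [e, integral_add his (integrable_const _), integral_sub hi2 hib, integral_const_mul,
      setIntegral_const, smul_eq_mul]
  rw [key, key, ha]
  ring

/-- A finite partition, up to a null set, into sets of positive measure. -/
structure IsPartition (μ : Measure α) (C : ι → Set α) : Prop where
  measurableSet : ∀ i, MeasurableSet (C i)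
  disjoint : Pairwise fun i j => Disjoint (C i) (C j)
  cover : ∀ᵐ x ∂μ, ∃ i, x ∈ C i
  pos : ∀ i, 0 < μ.real (C i)

/-- The average of `F` over the `i`-th cell. -/
def cellAvg (μ : Measure α) (C : ι → Set α) (F : α → ℝ) (i : ι) : ℝ :=
  (μ.real (C i))⁻¹ * ∫ x in C i, F x ∂μ

theorem IsPartition.setIntegral_sub_sq [IsFiniteMeasure μ] {C : ι → Set α} (h : IsPartition μ C)
    {F : α → ℝ} (hF : MemLp F 2 μ) (i : ι) (c : ℝ) :
    ∫ x in C i, (F x - c) ^ 2 ∂μ =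
      ∫ x in C i, (F x - cellAvg μ C F i) ^ 2 ∂μ + μ.real (C i) * (cellAvg μ C F i - c) ^ 2 :=
  setIntegral_sub_const_sq hF (h.pos i) c

variable [Fintype ι]

/-- The piecewise constant function with the values `v i` on `C i`. -/
def pc (C : ι → Set α) (v : ι → ℝ) (x : α) : ℝ := ∑ i, v i * (C i).indicator 1 x

namespace IsPartition

variable {C : ι → Set α}

theorem pc_eq (h : IsPartition μ C) (v : ι → ℝ) {i : ι} {x : α} (hx : x ∈ C i) :
    pc C v x = v i := by
  unfold pc
  rw [Finset.sum_eq_single i]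
  · simp [hx]
  · intro j _ hj
    have : x ∉ C j := fun hxj => (h.disjoint hj).le_bot ⟨hxj, hx⟩
    simp [this]
  · simp

theorem measurable_pc (h : IsPartition μ C) (v : ι → ℝ) : Measurable (pc C v) := by
  unfold pc
  exact Finset.measurable_sum _ fun i _ =>
    (measurable_one.indicator (h.measurableSet i)).const_mul _

theorem integral_eq_sum (h : IsPartition μ C) {F : α → ℝ} (hF : Integrable F μ) :
    ∫ x, F x ∂μ = ∑ i, ∫ x in C i, F x ∂μ := by
  rw [← integral_iUnion_fintype h.measurableSet h.disjoint fun i => hF.integrableOn]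
  rw [← setIntegral_univ]
  apply setIntegral_congr_set
  filter_upwards [h.cover] with x hx
  exact propext (iff_of_true trivial (mem_iUnion.2 hx))

variable [IsFiniteMeasure μ]

theorem memLp_pc (h : IsPartition μ C) (v : ι → ℝ) : MemLp (pc C v) 2 μ := by
  refine MemLp.of_bound (h.measurable_pc v).aestronglyMeasurable (∑ i, |v i|)
    (Filter.Eventually.of_forall fun x => ?_)
  unfold pc
  refine (norm_sum_le _ _).trans (Finset.sum_le_sum fun i _ => ?_)
  rw [norm_mul, Real.norm_eq_abs]
  refine mul_le_of_le_one_right (abs_nonneg _) ?_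
  by_cases hx : x ∈ C i <;> simp [hx]

theorem integral_sub_pc_sq (h : IsPartition μ C) {F : α → ℝ} (hF : MemLp F 2 μ) (c : ι → ℝ) :
    ∫ x, (F x - pc C c x) ^ 2 ∂μ = ∑ i, ∫ x in C i, (F x - c i) ^ 2 ∂μ := by
  have hi : Integrable (fun x => (F x - pc C c x) ^ 2) μ := (hF.sub (h.memLp_pc c)).integrable_sq
  rw [h.integral_eq_sum hi]
  exact Finset.sum_congr rfl fun i _ => setIntegral_congr_fun (h.measurableSet i)
    fun x hx => by simp only [h.pc_eq c hx]

theorem integral_pc_sq (h : IsPartition μ C) (v : ι → ℝ) :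
    ∫ x, pc C v x ^ 2 ∂μ = ∑ i, μ.real (C i) * v i ^ 2 := by
  rw [h.integral_eq_sum (h.memLp_pc v).integrable_sq]
  refine Finset.sum_congr rfl fun i _ => ?_
  rw [setIntegral_congr_fun (h.measurableSet i)
    (fun x hx => by simp only [h.pc_eq v hx] : EqOn (fun x => pc C v x ^ 2) (fun _ => v i ^ 2) (C i)),
    setIntegral_const, smul_eq_mul]

/-- The cell averages give the best piecewise constant approximation. -/
theorem eLpNorm_pc_cellAvg_sub_le (h : IsPartition μ C) {F : α → ℝ} (hF : MemLp F 2 μ)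
    (c : ι → ℝ) : eLpNorm (fun x => pc C (cellAvg μ C F) x - F x) 2 μ ≤
      eLpNorm (fun x => F x - pc C c x) 2 μ := by
  apply eLpNorm_le_of_integral_sq_le ((h.memLp_pc _).sub hF) (hF.sub (h.memLp_pc _))
  have e : (fun x => (pc C (cellAvg μ C F) x - F x) ^ 2) =
      fun x => (F x - pc C (cellAvg μ C F) x) ^ 2 := by ext x; ring
  change ∫ x, (pc C (cellAvg μ C F) x - F x) ^ 2 ∂μ ≤ ∫ x, (F x - pc C c x) ^ 2 ∂μ
  rw [e, h.integral_sub_pc_sq hF, h.integral_sub_pc_sq hF]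
  refine Finset.sum_le_sum fun i _ => ?_
  rw [h.setIntegral_sub_sq hF i (c i)]
  exact le_add_of_nonneg_right (mul_nonneg (h.pos i).le (sq_nonneg _))

theorem eLpNorm_pc_cellAvg_le (h : IsPartition μ C) {F : α → ℝ} (hF : MemLp F 2 μ) :
    eLpNorm (pc C (cellAvg μ C F)) 2 μ ≤ eLpNorm F 2 μ := by
  apply eLpNorm_le_of_integral_sq_le (h.memLp_pc _) hF
  rw [h.integral_pc_sq, h.integral_eq_sum hF.integrable_sq]
  refine Finset.sum_le_sum fun i _ => ?_
  have := h.setIntegral_sub_sq hF i 0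
  simp only [sub_zero] at this
  rw [this]
  exact le_add_of_nonneg_left (integral_nonneg fun _ => sq_nonneg _)

end IsPartition

end Partition

namespace Grid

variable {d n : ℕ} (G : Grid d n)

theorem cell_eq_pi (i : Idx d n) :
    G.cell i = Set.pi univ fun k => Ioc (G.pts k (i k).castSucc) (G.pts k (i k).succ) := by
  ext x; simp [cell, mem_pi]

theorem measurableSet_cell (i : Idx d n) : MeasurableSet (G.cell i) := by
  rw [cell_eq_pi]
  exact MeasurableSet.univ_pi fun k => measurableSet_Ioc

theorem pts_nonneg (k : Fin d) (j : Fin (n + 1)) : 0 ≤ G.pts k j := by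
  rw [← G.first k]; exact (G.strictMono k).monotone (Fin.zero_le j)

theorem pts_le_one (k : Fin d) (j : Fin (n + 1)) : G.pts k j ≤ 1 := by
  rw [← G.last k]; exact (G.strictMono k).monotone (Fin.le_last j)

theorem cell_subset (i : Idx d n) : G.cell i ⊆ Om d := fun _ hx =>
  ⟨fun k => (G.pts_nonneg k _).trans (hx k).1.le, fun k => (hx k).2.trans (G.pts_le_one k _)⟩

theorem restrict_cell (i : Idx d n) : (mu d).restrict (G.cell i) = volume.restrict (G.cell i) := by
  rw [mu, Measure.restrict_restrict (G.measurableSet_cell i),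
    inter_eq_left.2 (G.cell_subset i)]

theorem mu_real_cell (i : Idx d n) : (mu d).real (G.cell i) = G.h i := by
  rw [h, measureReal_def, measureReal_def, ← Measure.restrict_apply_self, restrict_cell,
    Measure.restrict_apply_self]

theorem h_pos (i : Idx d n) : 0 < G.h i := by
  rw [h, measureReal_def, cell_eq_pi, Real.volume_pi_Ioc_toReal]
  · exact Finset.prod_pos fun k _ => sub_pos.2 (G.strictMono k (Fin.castSucc_lt_succ))
  · exact fun k => (G.strictMono k (Fin.castSucc_lt_succ)).le

theorem disjoint_cell {i j : Idx d n} (hij : i ≠ j) : Disjoint (G.cell i) (G.cell j) := by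
  obtain ⟨k, hk⟩ := Function.ne_iff.1 hij
  rw [Set.disjoint_left]
  intro x hi hj
  wlog hlt : i k < j k generalizing i j
  · exact this hij.symm hk.symm hj hi (lt_of_le_of_ne (not_lt.1 hlt) hk.symm)
  have h1 : G.pts k (i k).succ ≤ G.pts k (j k).castSucc :=
    (G.strictMono k).monotone (Fin.succ_le_castSucc_iff.2 hlt)
  linarith [(hi k).2, (hj k).1]

theorem exists_mem_Ioc (k : Fin d) {y : ℝ} (h0 : 0 < y) (h1 : y ≤ 1) :
    ∃ i : Fin n, G.pts k i.castSucc < y ∧ y ≤ G.pts k i.succ := by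
  have key : ∀ m : ℕ, ∀ hm : m < n + 1, y ≤ G.pts k ⟨m, hm⟩ →
      ∃ i : Fin n, G.pts k i.castSucc < y ∧ y ≤ G.pts k i.succ := by
    intro m
    induction m with
    | zero =>
      intro hm hy
      have : G.pts k ⟨0, hm⟩ = 0 := G.first k
      linarith
    | succ m ih =>
      intro hm hy
      by_cases h : y ≤ G.pts k ⟨m, by omega⟩
      · exact ih _ h
      · exact ⟨⟨m, by omega⟩, not_le.1 h, hy⟩
  refine key n (by omega) ?_
  have : G.pts k ⟨n, by omega⟩ = 1 := G.last k
  rwa [this]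

theorem ae_exists_mem_cell : ∀ᵐ x ∂mu d, ∃ i, x ∈ G.cell i := by
  -- Cells are open on the left, so the points of `Ω` that they miss lie on the faces `x k = 0`,
  -- which are null.
  have h0 : ∀ᵐ x ∂mu d, ∀ k, x k ≠ 0 := by
    rw [ae_all_iff]
    intro k
    apply ae_restrict_of_ae
    exact (Measure.ae_eval_ne _ k 0)
  filter_upwards [h0, ae_mem_Om] with x hx hO
  have : ∀ k, ∃ i : Fin n, G.pts k i.castSucc < x k ∧ x k ≤ G.pts k i.succ := fun k =>
    G.exists_mem_Ioc k (lt_of_le_of_ne (hO.1 k) (hx k).symm) (hO.2 k)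
  choose i hi using this
  exact ⟨i, hi⟩

theorem isPartition : IsPartition (mu d) G.cell where
  measurableSet := G.measurableSet_cell
  disjoint _ _ hij := G.disjoint_cell hij
  cover := G.ae_exists_mem_cell
  pos i := by rw [mu_real_cell]; exact G.h_pos i

theorem inj_eq_pc (v : Idx d n → ℝ) : G.inj v = pc G.cell v := rfl

theorem proj_eq_cellAvg (u : Pt d → ℝ) : G.proj u = cellAvg (mu d) G.cell u := by
  ext i
  rw [proj, cellAvg, mu_real_cell, restrict_cell]

/-- The cells of `Ω²`. -/
def cell₂ (p : Idx d n × Idx d n) : Set (Pt d × Pt d) := G.cell p.1 ×ˢ G.cell p.2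

theorem isPartition₂ : IsPartition ((mu d).prod (mu d)) G.cell₂ where
  measurableSet p := (G.measurableSet_cell p.1).prod (G.measurableSet_cell p.2)
  disjoint p q hpq := by
    change Disjoint (G.cell p.1 ×ˢ G.cell p.2) (G.cell q.1 ×ˢ G.cell q.2)
    rw [Set.disjoint_prod]
    by_cases h : p.1 = q.1
    · exact Or.inr (G.disjoint_cell fun h2 => hpq (Prod.ext h h2))
    · exact Or.inl (G.disjoint_cell h)
  cover := by
    filter_upwards [Measure.quasiMeasurePreserving_fst.ae G.ae_exists_mem_cell,
      Measure.quasiMeasurePreserving_snd.ae G.ae_exists_mem_cell] with p h1 h2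
    obtain ⟨i, hi⟩ := h1
    obtain ⟨j, hj⟩ := h2
    exact ⟨(i, j), hi, hj⟩
  pos p := by
    rw [cell₂, measureReal_prod_prod, mu_real_cell, mu_real_cell]
    exact mul_pos (G.h_pos _) (G.h_pos _)

theorem inj₂_eq_pc (A : Idx d n → Idx d n → ℝ) :
    Function.uncurry (G.inj₂ A) = pc G.cell₂ (Function.uncurry A) := by
  ext ⟨x, y⟩
  rw [pc, Fintype.sum_prod_type]
  refine Finset.sum_congr rfl fun i _ => Finset.sum_congr rfl fun j _ => ?_
  by_cases hx : x ∈ G.cell i <;> by_cases hy : y ∈ G.cell j <;> simp [cell₂, hx, hy]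

theorem proj₂_eq_cellAvg (F : Pt d → Pt d → ℝ) :
    Function.uncurry (G.proj₂ F) =
      cellAvg ((mu d).prod (mu d)) G.cell₂ (Function.uncurry F) := by
  ext ⟨i, j⟩
  rw [cellAvg, cell₂, measureReal_prod_prod, mu_real_cell, mu_real_cell, ← Measure.prod_restrict,
    restrict_cell, restrict_cell, Measure.prod_restrict]
  rfl

theorem memLp_inj (v : Idx d n → ℝ) : MemLp (G.inj v) 2 (mu d) := G.isPartition.memLp_pc v

theorem memLp_inj₂ (A : Idx d n → Idx d n → ℝ) :
    MemLp (Function.uncurry (G.inj₂ A)) 2 ((mu d).prod (mu d)) := by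
  rw [inj₂_eq_pc]; exact G.isPartition₂.memLp_pc _

theorem inj_of_mem (v : Idx d n → ℝ) {i : Idx d n} {x : Pt d} (hx : x ∈ G.cell i) :
    G.inj v x = v i := G.isPartition.pc_eq v hx

theorem inj₂_of_mem (A : Idx d n → Idx d n → ℝ) {i j : Idx d n} {x y : Pt d} (hx : x ∈ G.cell i)
    (hy : y ∈ G.cell j) : G.inj₂ A x y = A i j := by
  have := congrFun (G.inj₂_eq_pc A) (x, y)
  rw [G.isPartition₂.pc_eq _ (i := (i, j)) ⟨hx, hy⟩] at this
  exact this

theorem eLpNorm_inj_proj_le {f : Pt d → ℝ} (hf : MemLp f 2 (mu d)) :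
    eLpNorm (G.inj (G.proj f)) 2 (mu d) ≤ eLpNorm f 2 (mu d) := by
  rw [proj_eq_cellAvg, inj_eq_pc]
  exact G.isPartition.eLpNorm_pc_cellAvg_le hf

theorem eLpNorm_inj₂_proj₂_le {F : Pt d → Pt d → ℝ}
    (hF : MemLp (Function.uncurry F) 2 ((mu d).prod (mu d))) :
    eLpNorm (Function.uncurry (G.inj₂ (G.proj₂ F))) 2 ((mu d).prod (mu d)) ≤
      eLpNorm (Function.uncurry F) 2 ((mu d).prod (mu d)) := by
  rw [inj₂_eq_pc, proj₂_eq_cellAvg]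
  exact G.isPartition₂.eLpNorm_pc_cellAvg_le hF

/-- The discrete nonlocal operator is the continuum one with piecewise constant arguments. -/
theorem inj_sum_eq (A w : Idx d n → Idx d n → ℝ) :
    G.inj (fun i => -∑ j, G.h j * A i j * w i j) =ᵐ[mu d]
      fun x => -∫ y, G.inj₂ A x y * G.inj₂ w x y ∂mu d := by
  filter_upwards [G.ae_exists_mem_cell] with x hx
  obtain ⟨i, hi⟩ := hx
  rw [G.inj_of_mem _ hi]
  congr 1
  have e : (fun y => G.inj₂ A x y * G.inj₂ w x y) =ᵐ[mu d] G.inj fun j => A i j * w i j := by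
    filter_upwards [G.ae_exists_mem_cell] with y hy
    obtain ⟨j, hj⟩ := hy
    rw [G.inj₂_of_mem _ hi hj, G.inj₂_of_mem _ hi hj, G.inj_of_mem _ hj]
  rw [integral_congr_ae e, G.isPartition.integral_eq_sum ((G.memLp_inj _).integrable one_le_two)]
  refine Finset.sum_congr rfl fun j _ => ?_
  rw [setIntegral_congr_fun (g := fun _ => A i j * w i j) (G.measurableSet_cell j)
    (fun y hy => G.inj_of_mem _ hy), setIntegral_const, mu_real_cell, smul_eq_mul, mul_assoc]

theorem abs_inj₂_le_one {w : Idx d n → Idx d n → ℝ} (hw : ∀ i j, |w i j| ≤ 1) :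
    ∀ᵐ p ∂(mu d).prod (mu d), |G.inj₂ w p.1 p.2| ≤ 1 := by
  filter_upwards [G.isPartition₂.cover] with p hp
  obtain ⟨⟨i, j⟩, hi, hj⟩ := hp
  rw [G.inj₂_of_mem _ hi hj]
  exact hw i j

/-- The discrete operator has bounded range uniformly over all grids: it is an integral operator
with kernel `I P K`, and the projection does not increase the norm of `K`. -/
theorem eLpNorm_inj_sum_le {K : Pt d → Pt d → ℝ} (hK : IsKernel K)
    {w : Idx d n → Idx d n → ℝ} (hw : ∀ i j, |w i j| ≤ 1) :
    eLpNorm (G.inj fun i => -∑ j, G.h j * G.proj₂ K i j * w i j) 2 (mu d) ≤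
      eLpNorm (Function.uncurry K) 2 ((mu d).prod (mu d)) := by
  rw [eLpNorm_congr_ae (G.inj_sum_eq _ w)]
  refine (eLpNorm_neg (fun x => ∫ y, G.inj₂ (G.proj₂ K) x y * G.inj₂ w x y ∂mu d) 2 _).trans_le ?_
  exact (eLpNorm_integral_mul_le (G.memLp_inj₂ _) (G.memLp_inj₂ w).aestronglyMeasurable
    (G.abs_inj₂_le_one hw)).2.trans (G.eLpNorm_inj₂_proj₂_le hK.memLp)

end Grid

end

/-! ### The forward Euler scheme as an approximate solution; the error estimate -/

section

theorem maxStep_le {t : ℕ → ℝ} {N k : ℕ} (hk : k < N) : t (k + 1) - t k ≤ maxStep t N :=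
  le_ciSup (f := fun k : Fin N => t (k + 1) - t k) (Finite.bddAbove_range _) ⟨k, hk⟩

namespace Grid

variable {d n : ℕ} (G : Grid d n) {K : Pt d → Pt d → ℝ} {f g : Pt d → ℝ} {α t : ℕ → ℝ}
  {U : ℕ → Idx d n → ℝ}

theorem inj_add (v w : Idx d n → ℝ) (x : Pt d) :
    G.inj (fun i => v i + w i) x = G.inj v x + G.inj w x := by
  simp only [inj, add_mul, Finset.sum_add_distrib]

theorem inj_smul (c : ℝ) (v : Idx d n → ℝ) (x : Pt d) :
    G.inj (fun i => c * v i) x = c * G.inj v x := by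
  simp only [inj, Finset.mul_sum, mul_assoc]

theorem inj_sub (v w : Idx d n → ℝ) (x : Pt d) :
    G.inj (fun i => v i - w i) x = G.inj v x - G.inj w x := by
  simp only [inj, sub_mul, Finset.sum_sub_distrib]

/-- The piecewise constant injection into `L^2(Ω)`. -/
def injLp (v : Idx d n → ℝ) : Lp ℝ 2 (mu d) := (G.memLp_inj v).toLp (G.inj v)

theorem coeFn_injLp (v : Idx d n → ℝ) : (G.injLp v : Pt d → ℝ) =ᵐ[mu d] G.inj v :=
  (G.memLp_inj v).coeFn_toLp

theorem norm_injLp (v : Idx d n → ℝ) : ‖G.injLp v‖ = l2norm (G.inj v) := Lp.norm_toLp _ _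

theorem eLpNorm_inj_le_ofReal {v : Idx d n → ℝ} {M : ℝ} (h : ‖G.injLp v‖ ≤ M) :
    eLpNorm (G.inj v) 2 (mu d) ≤ ENNReal.ofReal M := by
  rw [← ENNReal.ofReal_toReal (G.memLp_inj v).2.ne]
  rw [norm_injLp] at h
  exact ENNReal.ofReal_le_ofReal h

theorem injLp_add (v w : Idx d n → ℝ) : G.injLp (fun i => v i + w i) = G.injLp v + G.injLp w := by
  rw [injLp, injLp, injLp, ← MemLp.toLp_add]
  exact MemLp.toLp_congr _ _ (Filter.Eventually.of_forall fun x => G.inj_add v w x)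

theorem injLp_smul (c : ℝ) (v : Idx d n → ℝ) : G.injLp (fun i => c * v i) = c • G.injLp v := by
  rw [injLp, injLp, ← MemLp.toLp_const_smul]
  exact MemLp.toLp_congr _ _ (Filter.Eventually.of_forall fun x => G.inj_smul c v x)

theorem norm_injLp_proj_le (hf : MemLp f 2 (mu d)) : ‖G.injLp (G.proj f)‖ ≤ ‖hf.toLp f‖ := by
  rw [norm_injLp, Lp.norm_toLp]
  exact ENNReal.toReal_mono hf.2.ne (G.eLpNorm_inj_proj_le hf)

theorem norm_injLp_sum_le (hK : IsKernel K) {w : Idx d n → Idx d n → ℝ} (hw : ∀ i j, |w i j| ≤ 1) :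
    ‖G.injLp fun i => -∑ j, G.h j * G.proj₂ K i j * w i j‖ ≤ l2norm₂ K := by
  rw [norm_injLp]
  exact ENNReal.toReal_mono hK.memLp.2.ne (G.eLpNorm_inj_sum_le hK hw)

theorem norm_injLp_signLaplacian_le (hK : IsKernel K) (v : Idx d n → ℝ) :
    ‖G.injLp (G.signLaplacian (G.proj₂ K) v)‖ ≤ l2norm₂ K :=
  G.norm_injLp_sum_le hK fun _ _ => abs_sign_le_one _

/-- A stationary solution bounds the discrete source in terms of the kernel. -/
theorem norm_injLp_proj_le_of_hasStationary (hK : IsKernel K) (hs : G.HasStationary K f) :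
    ‖G.injLp (G.proj f)‖ ≤ l2norm₂ K := by
  obtain ⟨us, w, hw, -, -, hf⟩ := hs
  rw [show G.proj f = _ from funext hf]
  exact G.norm_injLp_sum_le hK hw

/-- The right-hand side of the forward Euler scheme. -/
def rhs (K : Pt d → Pt d → ℝ) (f : Pt d → ℝ) (v : Idx d n → ℝ) (i : Idx d n) : ℝ :=
  -G.signLaplacian (G.proj₂ K) v i + G.proj f i

theorem injLp_rhs (v : Idx d n → ℝ) : G.injLp (G.rhs K f v) =
    G.injLp (G.proj f) - G.injLp (G.signLaplacian (G.proj₂ K) v) := by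
  have : G.rhs K f v = fun i => (-1) * G.signLaplacian (G.proj₂ K) v i + G.proj f i := by
    ext i; simp [rhs]
  rw [this, injLp_add, injLp_smul]
  simp only [neg_smul, one_smul]
  abel

theorem norm_injLp_rhs_le (hK : IsKernel K) {B : ℝ} (hB : ‖G.injLp (G.proj f)‖ ≤ B)
    (v : Idx d n → ℝ) : ‖G.injLp (G.rhs K f v)‖ ≤ B + l2norm₂ K := by
  rw [injLp_rhs]
  exact (norm_sub_le _ _).trans (add_le_add hB (G.norm_injLp_signLaplacian_le hK v))

theorem l2norm_eq_norm_rhs (v : Idx d n → ℝ) :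
    (l2norm fun x => G.inj (G.signLaplacian (G.proj₂ K) v) x - G.inj (G.proj f) x) =
      ‖G.injLp (G.rhs K f v)‖ := by
  rw [norm_injLp, l2norm, l2norm, ← eLpNorm_neg]
  congr 2
  ext x
  have : G.rhs K f v = fun i => G.proj f i - G.signLaplacian (G.proj₂ K) v i := by
    ext i; simp only [rhs]; ring
  rw [this, inj_sub]
  simp

theorem inj₂_sign_ae (v : Idx d n → ℝ) : ∀ᵐ x ∂mu d, ∀ᵐ y ∂mu d,
    G.inj₂ (fun i j => Real.sign (v j - v i)) x y = Real.sign (G.inj v y - G.inj v x) := by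
  filter_upwards [G.ae_exists_mem_cell] with x hx
  filter_upwards [G.ae_exists_mem_cell] with y hy
  obtain ⟨i, hi⟩ := hx
  obtain ⟨j, hj⟩ := hy
  rw [G.inj₂_of_mem _ hi hj, G.inj_of_mem _ hi, G.inj_of_mem _ hj]

/-- The consistency error of the discretization in space. -/
theorem norm_rhs_sub_le (hK : IsKernel K) (hf : MemLp f 2 (mu d)) (v : Idx d n → ℝ) :
    ‖G.injLp (G.rhs K f v) - (hf.toLp f - signLapLp hK (G.injLp v))‖ ≤
      l2norm (fun x => G.inj (G.proj f) x - f x) +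
        l2norm₂ (fun x y => G.inj₂ (G.proj₂ K) x y - K x y) := by
  set w : Idx d n → Idx d n → ℝ := fun i j => Real.sign (v j - v i) with hw
  have hw1 := G.abs_inj₂_le_one (w := w) fun _ _ => abs_sign_le_one _
  have hwm := (G.memLp_inj₂ w).aestronglyMeasurable
  have hD : MemLp (Function.uncurry fun x y => G.inj₂ (G.proj₂ K) x y - K x y) 2
      ((mu d).prod (mu d)) := (G.memLp_inj₂ _).sub hK.memLp
  obtain ⟨hr, hrle⟩ := eLpNorm_integral_mul_le hD hwm hw1
  have hs : MemLp (fun x => G.inj (G.proj f) x - f x) 2 (mu d) := (G.memLp_inj _).sub hf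
  -- Both operators use the same signs, those of the piecewise constant function. So the difference
  -- is linear in `I P f - f` and in `I P K - K`, the latter integrated against a field bounded by
  -- 1.
  have e : G.injLp (G.rhs K f v) - (hf.toLp f - signLapLp hK (G.injLp v)) =
      hs.toLp _ + hr.toLp _ := by
    rw [injLp_rhs]
    apply Lp.ext
    have hi1 := (integrable_mul_of_abs_le_one (G.memLp_inj₂ (G.proj₂ K)) hwm hw1).prod_right_ae
    have hi2 := (integrable_mul_of_abs_le_one hK.memLp hwm hw1).prod_right_ae
    filter_upwards [Lp.coeFn_sub (G.injLp (G.proj f) - G.injLp (G.signLaplacian (G.proj₂ K) v))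
      (hf.toLp f - signLapLp hK (G.injLp v)), Lp.coeFn_sub (G.injLp (G.proj f))
      (G.injLp (G.signLaplacian (G.proj₂ K) v)), Lp.coeFn_sub (hf.toLp f)
      (signLapLp hK (G.injLp v)), Lp.coeFn_add (hs.toLp _) (hr.toLp _), hs.coeFn_toLp,
      hr.coeFn_toLp, hf.coeFn_toLp, G.coeFn_injLp (G.proj f),
      G.coeFn_injLp (G.signLaplacian (G.proj₂ K) v), coeFn_signLapLp hK (G.injLp v),
      G.inj_sum_eq (G.proj₂ K) w, hi1, hi2, G.inj₂_sign_ae v, G.coeFn_injLp v]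
      with x a1 a2 a3 a4 a5 a6 a7 a8 a9 a10 a11 a12 a13 a14 a15
    have a16 : ∫ y, K x y * Real.sign (G.injLp v y - G.injLp v x) ∂mu d =
        ∫ y, K x y * G.inj₂ w x y ∂mu d := by
      apply integral_congr_ae
      filter_upwards [a14, G.coeFn_injLp v] with y b1 b2
      rw [a15, b2, hw, b1]
    have a17 : G.inj (G.signLaplacian (G.proj₂ K) v) x =
        -∫ y, G.inj₂ (G.proj₂ K) x y * G.inj₂ w x y ∂mu d := a11
    rw [a1, Pi.sub_apply, a2, a3, a4, Pi.sub_apply, Pi.sub_apply, Pi.add_apply, a5, a6, a7, a8, a9,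
      a10, a16, a17]
    simp only [sub_mul]
    rw [integral_sub a12 a13]
    ring
  rw [e]
  refine (norm_add_le _ _).trans (add_le_add ?_ ?_)
  · rw [Lp.norm_toLp]; rfl
  · rw [Lp.norm_toLp]
    exact ENNReal.toReal_mono hD.2.ne hrle

namespace IsForwardEuler

variable {G}

theorem step_eq (h : G.IsForwardEuler K f g α t U) (k : ℕ) :
    t (k + 1) - t k = α k / max ‖G.injLp (G.rhs K f (U k))‖ 1 := by
  rw [h.step, l2norm_eq_norm_rhs]

theorem step_pos (hα : IsStepSeq α) (h : G.IsForwardEuler K f g α t U) (k : ℕ) :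
    0 < t (k + 1) - t k := by
  rw [h.step_eq]
  exact div_pos (hα.1 k) (lt_max_of_lt_right one_pos)

theorem strictMono (hα : IsStepSeq α) (h : G.IsForwardEuler K f g α t U) : StrictMono t :=
  strictMono_nat_of_lt_succ fun k => sub_pos.1 (h.step_pos hα k)

/-- The purpose of the normalization of the step: no iterate moves by more than `α k`. -/
theorem step_mul_norm_le (hα : IsStepSeq α) (h : G.IsForwardEuler K f g α t U) (k : ℕ) :
    (t (k + 1) - t k) * ‖G.injLp (G.rhs K f (U k))‖ ≤ α k := by
  rw [h.step_eq, div_mul_eq_mul_div, div_le_iff₀ (lt_max_of_lt_right one_pos)]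
  exact mul_le_mul_of_nonneg_left (le_max_left _ _) (hα.1 k).le

theorem succ_eq (hα : IsStepSeq α) (h : G.IsForwardEuler K f g α t U) (k : ℕ) :
    U (k + 1) = fun i => U k i + (t (k + 1) - t k) * G.rhs K f (U k) i := by
  ext i
  have := h.scheme k i
  rw [div_eq_iff (h.step_pos hα k).ne'] at this
  simp only [rhs]
  linarith

theorem injLp_succ (hα : IsStepSeq α) (h : G.IsForwardEuler K f g α t U) (k : ℕ) :
    G.injLp (U (k + 1)) = G.injLp (U k) + (t (k + 1) - t k) • G.injLp (G.rhs K f (U k)) := by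
  rw [h.succ_eq hα, injLp_add, injLp_smul]

theorem isApprox (hK : IsKernel K) (hf : MemLp f 2 (mu d)) (hα : IsStepSeq α)
    (h : G.IsForwardEuler K f g α t U) {N : ℕ} {B : ℝ} (hB : ‖G.injLp (G.proj f)‖ ≤ B) :
    IsApprox (LapRel K) (hf.toLp f) (G.injLp (U 0)) (t N) (B + l2norm₂ K)
      (maxStep t N * (B + l2norm₂ K))
      (l2norm (fun x => G.inj (G.proj f) x - f x) +
        l2norm₂ (fun x y => G.inj₂ (G.proj₂ K) x y - K x y)) (l2norm₂ K)
      (fun s => G.injLp (U 0) + ∫ r in (0 : ℝ)..s, G.injLp (G.rhs K f (U (stepIdx t N r))))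
      (fun s => G.injLp (G.rhs K f (U (stepIdx t N s))))
      (fun s => G.injLp (U (stepIdx t N s))) := by
  refine isApprox_of_steps (V := fun k => G.injLp (U k)) (φ := fun k => G.injLp (G.rhs K f (U k)))
    h.time_zero (h.strictMono hα) (fun k _ => h.injLp_succ hα k)
    (fun k _ => G.norm_injLp_rhs_le hK hB _) (fun k hk => ?_) (fun k _ => ?_)
  · exact mul_le_mul (maxStep_le hk) (G.norm_injLp_rhs_le hK hB _) (norm_nonneg _)
      ((h.step_pos hα k).le.trans (maxStep_le hk))
  · exact ⟨signLapLp hK (G.injLp (U k)), lapRel_signLapLp hK _, (lapRel_signLapLp hK _).norm_le hK,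
      G.norm_rhs_sub_le hK hf _⟩

/-- The error estimate, with a constant that depends on a bound of the discrete source. -/
theorem errorLE (hK : IsKernel K) (hf : MemLp f 2 (mu d)) (hg : MemLp g 2 (mu d))
    (hα : IsStepSeq α) (h : G.IsForwardEuler K f g α t U) {N : ℕ} {B : ℝ}
    (hB : ‖G.injLp (G.proj f)‖ ≤ B) {u : ℝ → Lp ℝ 1 (mu d)}
    (hu : IsSolution K (fun _ => f) g (t N) u) :
    G.ErrorLE t U N u (Real.exp (t N / 2) *
      (l2norm (fun x => G.inj (G.proj g) x - g x) +
        (1 + (B + l2norm₂ K) + 2 * √(l2norm₂ K * (B + l2norm₂ K))) * √(t N) *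
          (√(maxStep t N) + l2norm (fun x => G.inj (G.proj f) x - f x) +
            l2norm₂ (fun x y => G.inj₂ (G.proj₂ K) x y - K x y)))) := by
  intro k hk r hr
  have hmono := h.strictMono hα
  set M := l2norm₂ K with hM
  have hM0 : 0 ≤ M := l2norm₂_nonneg K
  have hB0 : 0 ≤ B := (norm_nonneg _).trans hB
  set R := B + M with hR
  have hR0 : 0 ≤ R := by positivity
  set T := t N with hT
  set τ := maxStep t N with hτ
  have hτ0 : 0 ≤ τ := (h.step_pos hα k).le.trans (maxStep_le hk)
  have htk0 : ∀ j, 0 ≤ t j := fun j => by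
    rw [← h.time_zero]; exact hmono.monotone (Nat.zero_le j)
  have hT0 : 0 ≤ T := htk0 N
  -- This lets `τ` be bounded by `√τ * √T`, so that the lag of the interpolant has the same form as
  -- the other time errors.
  have hτT : τ ≤ T := by
    have : Nonempty (Fin N) := ⟨⟨k, hk⟩⟩
    refine ciSup_le fun j => ?_
    have h1 : t (j + 1) ≤ T := hmono.monotone j.2
    linarith [htk0 j]
  have hr0 : 0 < r := (htk0 k).trans_lt hr.1
  have hrT : r ≤ T := hr.2.trans (hmono.monotone hk)
  obtain ⟨W, Φ, hW, hWu⟩ := hu.exists_isApprox hK hf hg hT0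
  have hap := h.isApprox hK hf hα (N := N) hB
  set b := l2norm (fun x => G.inj (G.proj f) x - f x) with hb
  set c := l2norm₂ (fun x y => G.inj₂ (G.proj₂ K) x y - K x y) with hc
  have hb0 : 0 ≤ b := ENNReal.toReal_nonneg
  have hc0 : 0 ≤ c := ENNReal.toReal_nonneg
  have hcomp := (hap.mono ⟨hr0.le, hrT⟩).norm_sub_sq_le (LapRel.monotone hK) hr0.le hM0
    (by positivity) le_rfl (hW.mono ⟨hr0.le, hrT⟩)
  have hclose := hap.close r ⟨hr0, hrT⟩
  rw [stepIdx_eq hmono hk hr] at hclose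
  set Ur := G.injLp (U 0) + ∫ s in (0 : ℝ)..r, G.injLp (G.rhs K f (U (stepIdx t N s))) with hUr
  set e₀ := l2norm (fun x => G.inj (G.proj g) x - g x) with he₀
  have he₀0 : 0 ≤ e₀ := ENNReal.toReal_nonneg
  have hinit : ‖G.injLp (U 0) - hg.toLp g‖ = e₀ := by
    rw [Lp.norm_def, he₀, l2norm]
    congr 1
    apply eLpNorm_congr_ae
    filter_upwards [Lp.coeFn_sub (G.injLp (U 0)) (hg.toLp g), G.coeFn_injLp (U 0),
      hg.coeFn_toLp] with x a1 a2 a3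
    rw [a1, Pi.sub_apply, a2, a3, h.initial]
  rw [hinit] at hcomp
  have hexp : Real.exp (T / 2) ^ 2 = Real.exp T := by
    rw [← Real.exp_nat_mul]; congr 1; push_cast; ring
  have hexp1 : 1 ≤ Real.exp (T / 2) := Real.one_le_exp (by positivity)
  have hsqT : √T ^ 2 = T := Real.sq_sqrt hT0
  have hsqτ : √τ ^ 2 = τ := Real.sq_sqrt hτ0
  have hsqMR : √(M * R) ^ 2 = M * R := Real.sq_sqrt (by positivity)
  have h1 : ‖Ur - W r‖ ≤ Real.exp (T / 2) * (e₀ + √T * (b + c + 2 * √(M * R) * √τ)) := by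
    refine (abs_le_of_sq_le_sq' (b := Real.exp (T / 2) *
      (e₀ + √T * (b + c + 2 * √(M * R) * √τ))) ?_ (by positivity)).2
    rw [mul_pow, hexp]
    refine hcomp.trans ?_
    have h2 : e₀ ^ 2 + ((b + c + 0) ^ 2 + 4 * M * (τ * R + 0)) * r ≤
        (e₀ + √T * (b + c + 2 * √(M * R) * √τ)) ^ 2 := by
      calc e₀ ^ 2 + ((b + c + 0) ^ 2 + 4 * M * (τ * R + 0)) * r
          ≤ e₀ ^ 2 + ((b + c + 0) ^ 2 + 4 * M * (τ * R + 0)) * T := by gcongr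
        _ = e₀ ^ 2 + √T ^ 2 * ((b + c) ^ 2 + 4 * √(M * R) ^ 2 * √τ ^ 2) := by
            rw [hsqT, hsqτ, hsqMR]; ring
        _ ≤ e₀ ^ 2 + √T ^ 2 * ((b + c) ^ 2 + 4 * √(M * R) ^ 2 * √τ ^ 2) +
            (2 * e₀ * (√T * (b + c + 2 * √(M * R) * √τ)) +
              √T ^ 2 * (2 * (b + c) * (2 * √(M * R) * √τ))) :=
            le_add_of_nonneg_right (by positivity)
        _ = _ := by ring
    exact mul_le_mul (Real.exp_le_exp.2 hrT) h2 (by positivity) (Real.exp_pos _).le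
  have h3 : τ * R ≤ Real.exp (T / 2) * (R * √τ * √T) := by
    calc τ * R = R * √τ * √τ := by rw [mul_assoc, ← sq, hsqτ, mul_comm]
      _ ≤ R * √τ * √T := by gcongr
      _ ≤ Real.exp (T / 2) * (R * √τ * √T) := le_mul_of_one_le_left (by positivity) hexp1
  -- In the constant, 1 pays for the consistency error, `R` for the distance from the node value to
  -- the interpolant, and `2 √(M R)` for the lag in the comparison estimate. The last inequality
  -- only adds nonnegative terms to reach a common factor.
  have h4 : ‖G.injLp (U k) - W r‖ ≤ Real.exp (T / 2) *
      (e₀ + (1 + R + 2 * √(M * R)) * √T * (√τ + b + c)) := by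
    calc ‖G.injLp (U k) - W r‖ ≤ ‖G.injLp (U k) - Ur‖ + ‖Ur - W r‖ :=
          norm_sub_le_norm_sub_add_norm_sub _ _ _
      _ ≤ Real.exp (T / 2) * (R * √τ * √T) +
          Real.exp (T / 2) * (e₀ + √T * (b + c + 2 * √(M * R) * √τ)) := by
          rw [norm_sub_rev] at hclose
          exact add_le_add (hclose.trans h3) h1
      _ ≤ Real.exp (T / 2) * (R * √τ * √T) +
          Real.exp (T / 2) * (e₀ + √T * (b + c + 2 * √(M * R) * √τ)) +
          Real.exp (T / 2) * (√T * √τ + (R + 2 * √(M * R)) * √T * (b + c)) :=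
          le_add_of_nonneg_right (by positivity)
      _ = _ := by ring
  rw [Lp.norm_def] at h4
  have h5 : eLpNorm (fun x => G.inj (U k) x - u r x) 2 (mu d) =
      eLpNorm (G.injLp (U k) - W r : Lp ℝ 2 (mu d)) 2 (mu d) := by
    apply eLpNorm_congr_ae
    filter_upwards [Lp.coeFn_sub (G.injLp (U k)) (W r), G.coeFn_injLp (U k),
      coeFn_inclL1 (W r)] with x a1 a2 a3
    rw [a1, Pi.sub_apply, a2, ← hWu r ⟨hr0.le, hrT⟩, a3]
  rw [h5, ← ENNReal.ofReal_toReal (Lp.memLp (G.injLp (U k) - W r)).2.ne]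
  exact ENNReal.ofReal_le_ofReal h4

end IsForwardEuler

end Grid

end

/-! ### Well-posedness and boundedness of the scheme -/

section

namespace Grid

variable {d n : ℕ} (G : Grid d n) {K : Pt d → Pt d → ℝ} {f g : Pt d → ℝ} {α t : ℕ → ℝ}
  {U : ℕ → Idx d n → ℝ}

/-- The recursion of the forward Euler scheme. -/
def eulerState (K : Pt d → Pt d → ℝ) (f g : Pt d → ℝ) (α : ℕ → ℝ) : ℕ → ℝ × (Idx d n → ℝ)
  | 0 => (0, G.proj g)
  | k + 1 =>
    let s := eulerState K f g α k
    let τ := α k / max ‖G.injLp (G.rhs K f s.2)‖ 1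
    (s.1 + τ, fun i => s.2 i + τ * G.rhs K f s.2 i)

/-- Positive `α` makes every step positive, so the difference quotient can be solved for the next
iterate. -/
theorem existsUnique_isForwardEuler (K : Pt d → Pt d → ℝ) (f g : Pt d → ℝ) (hα : IsStepSeq α) :
    ∃! s : (ℕ → ℝ) × (ℕ → Idx d n → ℝ), G.IsForwardEuler K f g α s.1 s.2 := by
  refine ⟨(fun k => (G.eulerState K f g α k).1, fun k => (G.eulerState K f g α k).2),
    ⟨rfl, fun k => ?_, rfl, fun k i => ?_⟩, ?_⟩
  · rw [l2norm_eq_norm_rhs]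
    simp only [eulerState, add_sub_cancel_left]
  · simp only [eulerState, add_sub_cancel_left]
    have hpos : 0 < α k / max ‖G.injLp (G.rhs K f (G.eulerState K f g α k).2)‖ 1 :=
      div_pos (hα.1 k) (lt_max_of_lt_right one_pos)
    rw [mul_div_cancel_left₀ _ hpos.ne', rhs]
  · rintro ⟨t, U⟩ h
    have key : ∀ k, t k = (G.eulerState K f g α k).1 ∧ U k = (G.eulerState K f g α k).2 := by
      intro k
      induction k with
      | zero => exact ⟨h.time_zero, h.initial⟩
      | succ k ih =>
        have h1 := h.step_eq k
        have h2 := h.succ_eq hα k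
        simp only at h1 h2
        rw [h1] at h2
        rw [ih.2] at h1 h2
        refine ⟨?_, h2⟩
        rw [sub_eq_iff_eq_add', ih.1] at h1
        exact h1
    exact Prod.ext (funext fun k => (key k).1) (funext fun k => (key k).2)

theorem inOneLaplacian_inj {A : Idx d n → Idx d n → ℝ} {v η : Idx d n → ℝ}
    (h : G.InDiscreteOneLaplacian A v η) :
    InOneLaplacian (G.inj₂ A) (G.inj v) (G.inj η) := by
  obtain ⟨w, h1, h2, h3, h4⟩ := h
  refine ⟨(G.memLp_inj v).integrable one_le_two, (G.memLp_inj η).integrable one_le_two,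
    G.inj₂ w, (G.memLp_inj₂ w).aestronglyMeasurable, G.abs_inj₂_le_one h1, ?_, ?_, ?_⟩
  · filter_upwards [G.isPartition₂.cover] with p hp
    obtain ⟨⟨i, j⟩, hi, hj⟩ := hp
    rw [G.inj₂_of_mem _ hi hj, G.inj₂_of_mem _ hj hi, h2]
  · filter_upwards [G.isPartition₂.cover] with p hp
    obtain ⟨⟨i, j⟩, hi, hj⟩ := hp
    rw [G.inj₂_of_mem _ hi hj, G.inj_of_mem _ hi, G.inj_of_mem _ hj]
    exact h3 i j
  · rw [show η = _ from funext h4]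
    exact G.inj_sum_eq A w

theorem inDiscreteOneLaplacian_sign (A : Idx d n → Idx d n → ℝ) (v : Idx d n → ℝ) :
    G.InDiscreteOneLaplacian A v (G.signLaplacian A v) :=
  ⟨fun i j => Real.sign (v j - v i), fun _ _ => abs_sign_le_one _,
    fun i j => by rw [← Real.sign_neg, neg_sub], fun _ _ => sign_mem_absSubdiff _, fun _ => rfl⟩

/-- Averaging preserves sign and symmetry. Hence the discrete operator is the continuum operator of
an admissible kernel and inherits its monotonicity. -/
theorem isKernel_inj₂_proj₂ (hK : IsKernel K) : IsKernel (G.inj₂ (G.proj₂ K)) where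
  memLp := G.memLp_inj₂ _
  nonneg := by
    filter_upwards [G.isPartition₂.cover] with p hp
    obtain ⟨⟨i, j⟩, hi, hj⟩ := hp
    rw [G.inj₂_of_mem _ hi hj]
    have e := congrFun (G.proj₂_eq_cellAvg K) (i, j)
    simp only [Function.uncurry_apply_pair] at e
    rw [e, cellAvg]
    exact mul_nonneg (inv_nonneg.2 measureReal_nonneg)
      (integral_nonneg_of_ae (ae_restrict_of_ae hK.nonneg))
  symm := by
    have hsymm : ∀ i j, G.proj₂ K i j = G.proj₂ K j i := by
      intro i j
      have e := fun i j => congrFun (G.proj₂_eq_cellAvg K) (i, j)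
      simp only [Function.uncurry_apply_pair] at e
      rw [e, e, cellAvg, cellAvg, cell₂, cell₂, measureReal_prod_prod, measureReal_prod_prod,
        mul_comm ((mu d).real (G.cell (i, j).1))]
      congr 1
      rw [← Measure.prod_restrict, ← Measure.prod_restrict, ← integral_prod_swap,
        Measure.prod_restrict]
      apply integral_congr_ae
      filter_upwards [ae_restrict_of_ae hK.symm] with p hp
      exact hp.symm
    filter_upwards [G.isPartition₂.cover] with p hp
    obtain ⟨⟨i, j⟩, hi, hj⟩ := hp
    rw [G.inj₂_of_mem _ hi hj, G.inj₂_of_mem _ hj hi, hsymm]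

theorem lapRel_injLp {A : Idx d n → Idx d n → ℝ} {v η : Idx d n → ℝ}
    (h : G.InDiscreteOneLaplacian A v η) : LapRel (G.inj₂ A) (G.injLp v) (G.injLp η) :=
  (G.inOneLaplacian_inj h).congr_ae (G.coeFn_injLp v).symm (G.coeFn_injLp η).symm

namespace IsForwardEuler

variable {G}

theorem norm_injLp_initial_le (hg : MemLp g 2 (mu d)) (h : G.IsForwardEuler K f g α t U) :
    ‖G.injLp (U 0)‖ ≤ ‖hg.toLp g‖ := by
  rw [h.initial]; exact G.norm_injLp_proj_le hg

theorem norm_injLp_le (hK : IsKernel K) (hf : MemLp f 2 (mu d)) (hg : MemLp g 2 (mu d))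
    (hα : IsStepSeq α) (h : G.IsForwardEuler K f g α t U) (k : ℕ) :
    ‖G.injLp (U k)‖ ≤ ‖hg.toLp g‖ + t k * (‖hf.toLp f‖ + l2norm₂ K) := by
  induction k with
  | zero => rw [h.time_zero, zero_mul, add_zero]; exact h.norm_injLp_initial_le hg
  | succ k ih =>
    rw [h.injLp_succ hα k]
    refine (norm_add_le _ _).trans ?_
    rw [norm_smul, Real.norm_of_nonneg (h.step_pos hα k).le]
    have := mul_le_mul_of_nonneg_left
      (G.norm_injLp_rhs_le hK (G.norm_injLp_proj_le hf) (U k)) (h.step_pos hα k).le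
    linarith

/-- Expand the square. The cross term is nonpositive by monotonicity, as `P f` belongs to the
operator at `us`; the quadratic term is at most `α k ^ 2` by the choice of the step. -/
theorem norm_sub_sq_succ_le (hK : IsKernel K) (hα : IsStepSeq α)
    (h : G.IsForwardEuler K f g α t U) {us : Idx d n → ℝ}
    (hus : G.InDiscreteOneLaplacian (G.proj₂ K) us (G.proj f)) (k : ℕ) :
    ‖G.injLp (U (k + 1)) - G.injLp us‖ ^ 2 ≤ ‖G.injLp (U k) - G.injLp us‖ ^ 2 + α k ^ 2 := by
  have hmono := LapRel.monotone (G.isKernel_inj₂_proj₂ hK) _ _ _ _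
    (G.lapRel_injLp (G.inDiscreteOneLaplacian_sign (G.proj₂ K) (U k))) (G.lapRel_injLp hus)
  have hpos := h.step_pos hα k
  have h1 : inner ℝ (G.injLp (U k) - G.injLp us) (G.injLp (G.rhs K f (U k))) ≤ 0 := by
    rw [injLp_rhs, real_inner_comm, ← neg_sub (G.injLp (G.signLaplacian (G.proj₂ K) (U k))),
      inner_neg_left]
    linarith
  have h2 : ((t (k + 1) - t k) * ‖G.injLp (G.rhs K f (U k))‖) ^ 2 ≤ α k ^ 2 :=
    pow_le_pow_left₀ (by positivity) (h.step_mul_norm_le hα k) 2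
  rw [h.injLp_succ hα k, add_sub_right_comm, norm_add_sq_real, inner_smul_right, norm_smul,
    Real.norm_of_nonneg hpos.le]
  nlinarith

theorem norm_sub_sq_le (hK : IsKernel K) (hα : IsStepSeq α)
    (h : G.IsForwardEuler K f g α t U) {us : Idx d n → ℝ}
    (hus : G.InDiscreteOneLaplacian (G.proj₂ K) us (G.proj f)) (k : ℕ) :
    ‖G.injLp (U k) - G.injLp us‖ ^ 2 ≤ ‖G.injLp (U 0) - G.injLp us‖ ^ 2 + ∑' j, α j ^ 2 := by
  have h1 : ‖G.injLp (U k) - G.injLp us‖ ^ 2 ≤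
      ‖G.injLp (U 0) - G.injLp us‖ ^ 2 + ∑ j ∈ Finset.range k, α j ^ 2 := by
    induction k with
    | zero => simp
    | succ k ih =>
      rw [Finset.sum_range_succ]
      linarith [h.norm_sub_sq_succ_le hK hα hus k]
  exact h1.trans (add_le_add_right (hα.2.sum_le_tsum _ fun j _ => sq_nonneg _) _)

theorem norm_injLp_le_of_proj_eq_zero (hK : IsKernel K) (hg : MemLp g 2 (mu d)) (hα : IsStepSeq α)
    (h : G.IsForwardEuler K f g α t U) (hf0 : ∀ i, G.proj f i = 0) (k : ℕ) :
    ‖G.injLp (U k)‖ ≤ √(‖hg.toLp g‖ ^ 2 + ∑' j, α j ^ 2) := by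
  -- With zero discrete source the zero vector is stationary, with `w = 0`. Its norm does not depend
  -- on the grid, which makes the bound uniform.
  have hus : G.InDiscreteOneLaplacian (G.proj₂ K) (fun _ => 0) (G.proj f) :=
    ⟨fun _ _ => 0, by simp, by simp, by simp [absSubdiff], by simp [hf0]⟩
  have h0 : G.injLp (fun _ => 0) = 0 := by
    have := G.injLp_smul 0 fun _ => 0
    simpa using this
  have h1 := h.norm_sub_sq_le hK hα hus k
  rw [h0, sub_zero, sub_zero] at h1
  apply Real.le_sqrt_of_sq_le
  have h2 := pow_le_pow_left₀ (norm_nonneg _) (h.norm_injLp_initial_le hg) 2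
  linarith

end IsForwardEuler

end Grid

end

/-! ### Piecewise constant approximation of Lipschitz functions -/

section

section Modulus

variable {E : Type*} [NormedAddCommGroup E] [MeasureSpace E]

theorem modulus_le_of_lipSeminorm (S : Set E) (s : ℝ) (q : ℝ≥0∞) (F : E → ℝ) {r : ℝ} (hr : 0 < r) :
    modulus S q F r ≤ ENNReal.ofReal (r ^ s) * lipSeminorm S s q F := by
  have h1 : ENNReal.ofReal (r ^ (-s)) * modulus S q F r ≤ lipSeminorm S s q F :=
    le_iSup₂ (f := fun (h : ℝ) (_ : 0 < h) => ENNReal.ofReal (h ^ (-s)) * modulus S q F h) r hr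
  calc modulus S q F r = ENNReal.ofReal (r ^ s) * (ENNReal.ofReal (r ^ (-s)) * modulus S q F r) := by
        rw [← mul_assoc, ← ENNReal.ofReal_mul (Real.rpow_nonneg hr.le _), ← Real.rpow_add hr,
          add_neg_cancel, Real.rpow_zero, ENNReal.ofReal_one, one_mul]
    _ ≤ _ := by gcongr

variable [BorelSpace E]

/-- Translations preserve null sets, so the modulus sees only the class of `F`, and a Borel
representative may be used where Tonelli requires one. -/
theorem modulus_congr_ae [(volume : Measure E).IsAddHaarMeasure] {S : Set E} {F F' : E → ℝ}
    (hS : MeasurableSet S) (h : F =ᵐ[volume.restrict S] F') (q : ℝ≥0∞) (r : ℝ) :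
    modulus S q F r = modulus S q F' r := by
  unfold modulus
  refine iSup_congr fun z => iSup_congr fun _ => eLpNorm_congr_ae ?_
  have hS' : MeasurableSet {x | x ∈ S ∧ x + z ∈ S} :=
    hS.inter (hS.preimage (by fun_prop))
  rw [Filter.EventuallyEq, ae_restrict_iff' hS] at h
  have hz : ∀ᵐ x : E, x + z ∈ S → F (x + z) = F' (x + z) :=
    (measurePreserving_add_right volume z).quasiMeasurePreserving.ae h
  rw [Filter.EventuallyEq, ae_restrict_iff' hS']
  filter_upwards [h, hz] with x h1 h2 hx
  rw [h1 hx.1, h2 hx.2]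

variable [SecondCountableTopology E] [SFinite (volume : Measure E)]

/-- Averages over shifts are controlled by the modulus of smoothness. -/
theorem lintegral_shift_le {S : Set E} (hS : MeasurableSet S) {F : E → ℝ} (hF : Measurable F)
    (r : ℝ) :
    ∫⁻ x in S, ∫⁻ z in Metric.ball 0 r, S.indicator (fun y => ‖F y - F x‖ₑ ^ 2) (x + z) ≤
      volume (Metric.ball (0 : E) r) * modulus S 2 F r ^ 2 := by
  have hm : Measurable fun p : E × E => S.indicator (fun y => ‖F y - F p.1‖ₑ ^ 2) (p.1 + p.2) := by
    have h1 : (fun p : E × E => S.indicator (fun y => ‖F y - F p.1‖ₑ ^ 2) (p.1 + p.2)) =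
        ((fun p : E × E => p.1 + p.2) ⁻¹' S).indicator
          fun p => ‖F (p.1 + p.2) - F p.1‖ₑ ^ 2 := by
      ext p
      by_cases h : p.1 + p.2 ∈ S <;> simp [h]
    rw [h1]
    refine Measurable.indicator ?_ (hS.preimage (measurable_fst.add measurable_snd))
    exact ((hF.comp (measurable_fst.add measurable_snd)).sub
      (hF.comp measurable_fst)).enorm.pow_const 2
  -- For a fixed shift `z` the integral over `x` is the square of one of the norms in the supremum
  -- defining the modulus.
  rw [lintegral_lintegral_swap hm.aemeasurable]
  calc ∫⁻ z in Metric.ball 0 r, ∫⁻ x in S, S.indicator (fun y => ‖F y - F x‖ₑ ^ 2) (x + z)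
      ≤ ∫⁻ _ in Metric.ball (0 : E) r, modulus S 2 F r ^ 2 := by
        apply setLIntegral_mono' Metric.isOpen_ball.measurableSet
        intro z hz
        have hS' : MeasurableSet {x | x + z ∈ S} := hS.preimage (measurable_add_const z)
        have e : (fun x => S.indicator (fun y => ‖F y - F x‖ₑ ^ 2) (x + z)) =
            {x | x + z ∈ S}.indicator fun x => ‖F (x + z) - F x‖ₑ ^ 2 := by
          ext x
          by_cases h : x + z ∈ S <;> simp [h]
        rw [e, setLIntegral_indicator hS', ← eLpNorm_two_sq]
        gcongr
        have e2 : {x | x + z ∈ S} ∩ S = {x | x ∈ S ∧ x + z ∈ S} := by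
          ext x; exact and_comm
        rw [e2]
        exact le_iSup₂ (f := fun (z : E) (_ : ‖z‖ < r) => eLpNorm (fun x => F (x + z) - F x) 2
          (volume.restrict {x | x ∈ S ∧ x + z ∈ S})) z (mem_ball_zero_iff.1 hz)
    _ = _ := by rw [setLIntegral_const, mul_comm]

variable [(volume : Measure E).IsAddHaarMeasure]

theorem sub_avg_sq_le {α : Type*} [MeasurableSpace α] {μ : Measure α} [IsFiniteMeasure μ]
    {F : α → ℝ} (hF : MemLp F 2 μ) {B : Set α} (hB : 0 < μ.real B) (c : ℝ) :
    μ B * ‖c - (μ.real B)⁻¹ * ∫ y in B, F y ∂μ‖ₑ ^ 2 ≤ ∫⁻ y in B, ‖F y - c‖ₑ ^ 2 ∂μ := by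
  have h1 := setIntegral_sub_const_sq hF hB c
  have h2 : MemLp (fun y => F y - c) 2 (μ.restrict B) := (hF.sub (memLp_const c)).restrict B
  have h3 : 0 ≤ ∫ x in B, (F x - (μ.real B)⁻¹ * ∫ y in B, F y ∂μ) ^ 2 ∂μ :=
    integral_nonneg fun _ => sq_nonneg _
  rw [← eLpNorm_two_sq, eLpNorm_two_sq_eq_integral h2, h1, ← ofReal_measureReal,
    ← ofReal_norm, ← ENNReal.ofReal_pow (norm_nonneg _), ← ENNReal.ofReal_mul measureReal_nonneg,
    Real.norm_eq_abs, sq_abs]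
  apply ENNReal.ofReal_le_ofReal
  rw [show (c - (μ.real B)⁻¹ * ∫ y in B, F y ∂μ) ^ 2 =
    ((μ.real B)⁻¹ * ∫ y in B, F y ∂μ - c) ^ 2 by ring]
  exact le_add_of_nonneg_left h3

/-- Piecewise constant approximation on a partition into cells `C i` whose points are closer than
`r` to the points of a set `B i ⊆ S` of measure at least `V`. -/
theorem eLpNorm_pc_cellAvg_sub_sq_le_of_measurable {ι : Type*} [Fintype ι] {S : Set E}
    (hS : MeasurableSet S) [IsFiniteMeasure (volume.restrict S)] {C B : ι → Set E}
    (hC : IsPartition (volume.restrict S) C)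
    (hBS : ∀ i, B i ⊆ S) {V : ℝ≥0∞} (hV : 0 < V) (hVB : ∀ i, V ≤ volume (B i)) {r : ℝ}
    (hr : ∀ i, ∀ x ∈ C i, ∀ y ∈ B i, ‖y - x‖ < r)
    {F : E → ℝ} (hFm : Measurable F) (hF : MemLp F 2 (volume.restrict S)) :
    V * eLpNorm (fun x => pc C (cellAvg (volume.restrict S) C F) x - F x) 2
      (volume.restrict S) ^ 2 ≤ volume (Metric.ball (0 : E) r) * modulus S 2 F r ^ 2 := by
  set μ := (volume : Measure E).restrict S with hμ
  have hμB : ∀ i, μ (B i) = volume (B i) := fun i =>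
    Measure.restrict_eq_self _ (hBS i)
  have hpos : ∀ i, 0 < μ.real (B i) := fun i => by
    rw [measureReal_def]
    refine ENNReal.toReal_pos ?_ (measure_ne_top _ _)
    rw [hμB]; exact (hV.trans_le (hVB i)).ne'
  -- Cell averages are optimal, so the averages over the larger sets `B i` may replace them. The
  -- measure of a cell, which has no lower bound in terms of its diameter, then drops out of the
  -- estimate.
  set c : ι → ℝ := fun i => (μ.real (B i))⁻¹ * ∫ y in B i, F y ∂μ with hc
  have h1 := hC.eLpNorm_pc_cellAvg_sub_le hF c
  calc V * eLpNorm (fun x => pc C (cellAvg μ C F) x - F x) 2 μ ^ 2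
      ≤ V * eLpNorm (fun x => F x - pc C c x) 2 μ ^ 2 := by gcongr
    _ = ∫⁻ x, V * ‖F x - pc C c x‖ₑ ^ 2 ∂μ := by
        rw [eLpNorm_two_sq, lintegral_const_mul]
        exact (hFm.sub (hC.measurable_pc c)).enorm.pow_const 2
    _ ≤ ∫⁻ x in S, ∫⁻ z in Metric.ball 0 r, S.indicator (fun y => ‖F y - F x‖ₑ ^ 2) (x + z) := by
        apply lintegral_mono_ae
        filter_upwards [hC.cover] with x hx
        obtain ⟨i, hi⟩ := hx
        rw [hC.pc_eq c hi]
        calc V * ‖F x - c i‖ₑ ^ 2 ≤ μ (B i) * ‖F x - c i‖ₑ ^ 2 := by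
              rw [hμB]; gcongr; exact hVB i
          _ ≤ ∫⁻ y in B i, ‖F y - F x‖ₑ ^ 2 ∂μ := sub_avg_sq_le hF (hpos i) (F x)
          _ ≤ ∫⁻ y in Metric.ball x r, ‖F y - F x‖ₑ ^ 2 ∂μ := by
              apply lintegral_mono_set
              intro y hy
              rw [mem_ball_iff_norm]
              exact hr i x hi y hy
          _ = ∫⁻ y, (Metric.ball x r).indicator (S.indicator fun y => ‖F y - F x‖ₑ ^ 2) y := by
              rw [hμ, Measure.restrict_restrict Metric.isOpen_ball.measurableSet,
                ← lintegral_indicator (Metric.isOpen_ball.measurableSet.inter hS),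
                Set.indicator_indicator]
          _ = ∫⁻ z, (Metric.ball x r).indicator
                (S.indicator fun y => ‖F y - F x‖ₑ ^ 2) (x + z) :=
              (lintegral_add_left_eq_self _ x).symm
          _ = ∫⁻ z in Metric.ball 0 r, S.indicator (fun y => ‖F y - F x‖ₑ ^ 2) (x + z) := by
              rw [← lintegral_indicator Metric.isOpen_ball.measurableSet]
              congr 1; ext z
              by_cases hz : z ∈ Metric.ball (0 : E) r
              · have : x + z ∈ Metric.ball x r := by
                  simpa [mem_ball_iff_norm] using hz
                simp only [indicator_of_mem hz, indicator_of_mem this]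
              · have : x + z ∉ Metric.ball x r := by
                  simpa [mem_ball_iff_norm] using hz
                simp only [indicator_of_notMem hz, indicator_of_notMem this]
    _ ≤ _ := lintegral_shift_le hS hFm r

theorem eLpNorm_pc_cellAvg_sub_sq_le {ι : Type*} [Fintype ι] {S : Set E}
    (hS : MeasurableSet S) [IsFiniteMeasure (volume.restrict S)] {C B : ι → Set E}
    (hC : IsPartition (volume.restrict S) C)
    (hBS : ∀ i, B i ⊆ S) {V : ℝ≥0∞} (hV : 0 < V) (hVB : ∀ i, V ≤ volume (B i)) {r : ℝ}
    (hr : ∀ i, ∀ x ∈ C i, ∀ y ∈ B i, ‖y - x‖ < r)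
    {F : E → ℝ} (hF : MemLp F 2 (volume.restrict S)) :
    V * eLpNorm (fun x => pc C (cellAvg (volume.restrict S) C F) x - F x) 2
      (volume.restrict S) ^ 2 ≤ volume (Metric.ball (0 : E) r) * modulus S 2 F r ^ 2 := by
  have hFF := hF.1.ae_eq_mk
  have h := eLpNorm_pc_cellAvg_sub_sq_le_of_measurable hS hC hBS hV hVB hr
    hF.1.stronglyMeasurable_mk.measurable ((memLp_congr_ae hFF).1 hF)
  rw [← modulus_congr_ae hS hFF] at h
  have e : cellAvg (volume.restrict S) C (hF.1.mk F) = cellAvg (volume.restrict S) C F := by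
    ext i
    rw [cellAvg, cellAvg]
    congr 1
    exact integral_congr_ae (ae_restrict_of_ae hFF.symm)
  rw [e] at h
  refine le_trans (le_of_eq ?_) h
  congr 2
  apply eLpNorm_congr_ae
  filter_upwards [hFF] with x hx
  rw [hx]

/-- Here `(6 * δ) ^ D` is the volume of a ball of radius `3 * δ` in the maximum norm, and `(3 * δ) ^
s * L` bounds the modulus at that radius. The factor `6 ^ D` is enlarged to its square to avoid a
root. -/
theorem toReal_le_of_mul_sq_le {δ s : ℝ} (hδ : 0 < δ) {L X : ℝ≥0∞} (hL : L < ⊤) (D : ℕ)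
    (h : ENNReal.ofReal (δ ^ D) * X ^ 2 ≤
      ENNReal.ofReal ((6 * δ) ^ D) * (ENNReal.ofReal ((3 * δ) ^ s) * L) ^ 2) :
    X.toReal ≤ 6 ^ D * 3 ^ s * L.toReal * δ ^ s := by
  have hδD : 0 < δ ^ D := pow_pos hδ D
  have h1 : X ^ 2 ≤ (ENNReal.ofReal (6 ^ D * 3 ^ s * L.toReal * δ ^ s)) ^ 2 := by
    have h2 : ENNReal.ofReal (δ ^ D) * X ^ 2 ≤ ENNReal.ofReal (δ ^ D) *
        (ENNReal.ofReal (6 ^ D * 3 ^ s * L.toReal * δ ^ s)) ^ 2 := by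
      refine h.trans ?_
      rw [← ENNReal.ofReal_toReal hL.ne, ENNReal.toReal_ofReal ENNReal.toReal_nonneg,
        ← ENNReal.ofReal_mul (by positivity),
        ← ENNReal.ofReal_pow (by positivity), ← ENNReal.ofReal_mul (by positivity),
        ← ENNReal.ofReal_pow (by positivity), ← ENNReal.ofReal_mul (by positivity)]
      apply ENNReal.ofReal_le_ofReal
      rw [mul_pow 6 δ D, Real.mul_rpow (by norm_num) hδ.le]
      have h6 : (1 : ℝ) ≤ 6 ^ D := one_le_pow₀ (by norm_num)
      have hp : 0 ≤ δ ^ D * (3 ^ s * δ ^ s * L.toReal) ^ 2 := by positivity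
      calc (6 : ℝ) ^ D * δ ^ D * (3 ^ s * δ ^ s * L.toReal) ^ 2
          = 6 ^ D * (δ ^ D * (3 ^ s * δ ^ s * L.toReal) ^ 2) := by ring
        _ ≤ 6 ^ D * (6 ^ D * (δ ^ D * (3 ^ s * δ ^ s * L.toReal) ^ 2)) := by
            exact mul_le_mul_of_nonneg_left (le_mul_of_one_le_left hp h6) (by positivity)
        _ = _ := by ring
    rwa [ENNReal.mul_le_mul_iff_right (ENNReal.ofReal_pos.2 hδD).ne' ENNReal.ofReal_ne_top] at h2
  exact ENNReal.toReal_le_of_le_ofReal (by positivity)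
    ((ENNReal.pow_le_pow_left_iff two_ne_zero).1 h1)

end Modulus

namespace Grid

variable {d n : ℕ} (G : Grid d n)

theorem side_le_delta (k : Fin d) (j : Fin n) :
    G.pts k j.succ - G.pts k j.castSucc ≤ G.delta :=
  le_ciSup (f := fun p : Fin d × Fin n => G.pts p.1 p.2.succ - G.pts p.1 p.2.castSucc)
    (Finite.bddAbove_range _) (k, j)

theorem n_pos (G : Grid d n) (hd : 1 ≤ d) : 0 < n := by
  rcases Nat.eq_zero_or_pos n with rfl | h
  · have h0 := G.first ⟨0, hd⟩
    have h1 := G.last ⟨0, hd⟩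
    have : (Fin.last 0) = 0 := rfl
    rw [this, h0] at h1
    exact absurd h1 zero_ne_one
  · exact h

theorem delta_pos (hd : 1 ≤ d) : 0 < G.delta :=
  lt_of_lt_of_le (sub_pos.2 (G.strictMono ⟨0, hd⟩ (Fin.castSucc_lt_succ (i := ⟨0, G.n_pos hd⟩))))
    (G.side_le_delta _ _)

theorem delta_le_one (hd : 1 ≤ d) : G.delta ≤ 1 := by
  have : Nonempty (Fin d × Fin n) := ⟨(⟨0, hd⟩, ⟨0, G.n_pos hd⟩)⟩
  refine ciSup_le fun p => ?_
  linarith [G.pts_nonneg p.1 p.2.castSucc, G.pts_le_one p.1 p.2.succ]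

/-- A box of side length `δ` in `Ω` near the cell `Ω_i`. -/
def box (i : Idx d n) : Set (Pt d) :=
  Icc (fun k => (1 - G.delta) * G.pts k (i k).castSucc)
    fun k => (1 - G.delta) * G.pts k (i k).castSucc + G.delta

theorem volume_box (i : Idx d n) (hd : 1 ≤ d) :
    volume (G.box i) = ENNReal.ofReal (G.delta ^ d) := by
  rw [box, Real.volume_Icc_pi]
  simp [ENNReal.ofReal_pow (G.delta_pos hd).le]

theorem box_subset (i : Idx d n) (hd : 1 ≤ d) : G.box i ⊆ Om d := by
  have h0 := G.delta_pos hd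
  have h1 := G.delta_le_one hd
  intro x hx
  refine ⟨fun k => le_trans ?_ (hx.1 k), fun k => (hx.2 k).trans ?_⟩
  · exact mul_nonneg (sub_nonneg.2 h1) (G.pts_nonneg _ _)
  · have := G.pts_le_one k (i k).castSucc
    simp only [Pi.one_apply]
    nlinarith

/-- If `a` is the lower corner of the cell along an axis, the box starts at `(1 - δ) a`, at most `δ`
below `a`. Coordinates thus differ by at most `2δ`, and `3δ` makes the inequality strict. -/
theorem norm_sub_lt_of_mem (hd : 1 ≤ d) {i : Idx d n} {x y : Pt d} (hx : x ∈ G.cell i)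
    (hy : y ∈ G.box i) : ‖y - x‖ < 3 * G.delta := by
  have h0 := G.delta_pos hd
  rw [pi_norm_lt_iff (by positivity)]
  intro k
  have h1 := G.side_le_delta k (i k)
  have h2 := hx k
  have h3 := hy.1 k
  have h4 := hy.2 k
  have h5 := G.pts_nonneg k (i k).castSucc
  have h6 := G.pts_le_one k (i k).castSucc
  simp only at h3 h4
  rw [Pi.sub_apply, Real.norm_eq_abs, abs_lt]
  constructor <;> nlinarith

theorem l2norm_inj_proj_sub_le (hd : 1 ≤ d) {f : Pt d → ℝ} {s : ℝ} (hf : MemLip (Om d) s 2 f) :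
    l2norm (fun x => G.inj (G.proj f) x - f x) ≤
      6 ^ d * 3 ^ s * (lipSeminorm (Om d) s 2 f).toReal * G.delta ^ s := by
  have h0 := G.delta_pos hd
  have : IsFiniteMeasure (volume.restrict (Om d)) := by
    have := isProbabilityMeasure_mu (d := d)
    unfold mu at this
    infer_instance
  refine toReal_le_of_mul_sq_le h0 hf.2 d ?_
  rw [proj_eq_cellAvg, inj_eq_pc]
  refine (eLpNorm_pc_cellAvg_sub_sq_le (S := Om d) (C := G.cell) (B := G.box) measurableSet_Icc
    G.isPartition (fun i => G.box_subset i hd) (ENNReal.ofReal_pos.2 (pow_pos h0 d))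
    (fun i => (G.volume_box i hd).ge) (fun i x hx y hy => G.norm_sub_lt_of_mem hd hx hy)
    hf.1).trans ?_
  gcongr
  · rw [Real.volume_pi_ball _ (by positivity), Fintype.card_fin]
    apply le_of_eq
    congr 2; ring
  · exact modulus_le_of_lipSeminorm _ _ _ _ (by positivity)

theorem l2norm₂_inj₂_proj₂_sub_le (hd : 1 ≤ d) {K : Pt d → Pt d → ℝ} {s : ℝ}
    (hK : MemLip (Om d ×ˢ Om d) s 2 (Function.uncurry K)) :
    l2norm₂ (fun x y => G.inj₂ (G.proj₂ K) x y - K x y) ≤ 6 ^ (d + d) * 3 ^ s *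
      (lipSeminorm (Om d ×ˢ Om d) s 2 (Function.uncurry K)).toReal * G.delta ^ s := by
  have h0 := G.delta_pos hd
  have : IsFiniteMeasure ((volume : Measure (Pt d × Pt d)).restrict (Om d ×ˢ Om d)) := by
    rw [← mu_prod_mu]; infer_instance
  have : (volume : Measure (Pt d × Pt d)).IsAddHaarMeasure :=
    Measure.prod.instIsAddHaarMeasure (volume : Measure (Pt d)) (volume : Measure (Pt d))
  refine toReal_le_of_mul_sq_le h0 hK.2 (d + d) ?_
  have e : (Function.uncurry fun x y => G.inj₂ (G.proj₂ K) x y - K x y) =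
      fun p => pc G.cell₂ (cellAvg ((mu d).prod (mu d)) G.cell₂ (Function.uncurry K)) p -
        Function.uncurry K p := by
    rw [← proj₂_eq_cellAvg, ← inj₂_eq_pc]; rfl
  have hpart := G.isPartition₂
  rw [e, mu_prod_mu]
  rw [mu_prod_mu] at hpart
  refine (eLpNorm_pc_cellAvg_sub_sq_le (S := Om d ×ˢ Om d) (C := G.cell₂)
    (B := fun p => G.box p.1 ×ˢ G.box p.2)
    (measurableSet_Icc.prod measurableSet_Icc) hpart
    (fun p => prod_mono (G.box_subset _ hd) (G.box_subset _ hd))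
    (ENNReal.ofReal_pos.2 (pow_pos h0 _)) (fun p => ?_)
    (r := 3 * G.delta) (fun p x hx y hy => ?_) hK.1).trans ?_
  · rw [Measure.volume_eq_prod, Measure.prod_prod, G.volume_box _ hd, G.volume_box _ hd,
      ← ENNReal.ofReal_mul (by positivity), pow_add]
  · exact max_lt (G.norm_sub_lt_of_mem hd hx.1 hy.1) (G.norm_sub_lt_of_mem hd hx.2 hy.2)
  · gcongr
    · have : (0 : Pt d × Pt d) = (0, 0) := rfl
      rw [this, ← ball_prod_same, Measure.volume_eq_prod, Measure.prod_prod,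
        Real.volume_pi_ball _ (by positivity), Fintype.card_fin,
        ← ENNReal.ofReal_mul (by positivity), ← pow_add]
      apply le_of_eq
      congr 2; ring
    · exact modulus_le_of_lipSeminorm _ _ _ _ (by positivity)

end Grid

end

end NonlocalOneLap

end

/-! ### Assembly of the theorem and its constants -/

theorem mainTheorem7 (d : ℕ) (hd : 1 ≤ d) (K : Pt d → Pt d → ℝ)
    (hK_meas : Measurable (Function.uncurry K))
    (hK_nonneg : ∀ x ∈ Om d, ∀ y ∈ Om d, 0 ≤ K x y)
    (hK_symm : ∀ x ∈ Om d, ∀ y ∈ Om d, K x y = K y x)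
    (hK_L2 : linf2norm K < ⊤) :
    -- (i) well-posedness and boundedness
    (∀ f g : Pt d → ℝ, MemLp f 2 (mu d) → MemLp g 2 (mu d) →
      -- existence and uniqueness for the continuum problem
      (∀ T : ℝ, 0 < T →
        (∃ u, IsSolution K (fun _ => f) g T u) ∧
        ∀ u v, IsSolution K (fun _ => f) g T u → IsSolution K (fun _ => f) g T v →
          ∀ t ∈ Set.Icc 0 T, u t = v t) ∧
      -- the scheme is uniquely defined
      (∀ (n : ℕ) (G : Grid d n) (α : ℕ → ℝ), IsStepSeq α →
        ∃! s : (ℕ → ℝ) × (ℕ → Idx d n → ℝ), G.IsForwardEuler K f g α s.1 s.2) ∧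
      -- boundedness up to a given time
      (∀ T : ℝ, 0 < T → ∃ M : ℝ, ∀ (n : ℕ) (G : Grid d n) (α t : ℕ → ℝ) (U : ℕ → Idx d n → ℝ),
        IsStepSeq α → G.IsForwardEuler K f g α t U →
          ∀ k, t k ≤ T → eLpNorm (G.inj (U k)) 2 (mu d) ≤ ENNReal.ofReal M) ∧
      -- boundedness of all iterates if there is a stationary solution
      (∀ (n : ℕ) (G : Grid d n) (α t : ℕ → ℝ) (U : ℕ → Idx d n → ℝ),
        IsStepSeq α → G.IsForwardEuler K f g α t U → G.HasStationary K f →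
          ∃ M : ℝ, ∀ k, eLpNorm (G.inj (U k)) 2 (mu d) ≤ ENNReal.ofReal M) ∧
      -- boundedness of all iterates, uniform in the mesh, if the discrete source vanishes
      (∀ S : ℝ, ∃ M : ℝ, ∀ (n : ℕ) (G : Grid d n) (α t : ℕ → ℝ) (U : ℕ → Idx d n → ℝ),
        IsStepSeq α → ∑' k, α k ^ 2 ≤ S → G.IsForwardEuler K f g α t U →
          (∀ i, G.proj f i = 0) →
          ∀ k, eLpNorm (G.inj (U k)) 2 (mu d) ≤ ENNReal.ofReal M)) ∧
    -- (ii) error estimate; the constant depends only on `K` if there is a stationary solution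
    (∃ C : ℝ, 0 < C ∧ ∀ f g : Pt d → ℝ, MemLp f 2 (mu d) → MemLp g 2 (mu d) →
      ∀ (n : ℕ) (G : Grid d n) (α t : ℕ → ℝ) (U : ℕ → Idx d n → ℝ) (N : ℕ)
        (u : ℝ → Lp ℝ 1 (mu d)),
        IsStepSeq α → G.IsForwardEuler K f g α t U → G.HasStationary K f →
        IsSolution K (fun _ => f) g (t N) u →
        G.ErrorLE t U N u (Real.exp (t N / 2) *
          (l2norm (fun x => G.inj (G.proj g) x - g x) +
            C * √(t N) * (√(maxStep t N) + l2norm (fun x => G.inj (G.proj f) x - f x) +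
              l2norm₂ (fun x y => G.inj₂ (G.proj₂ K) x y - K x y))))) ∧
    -- and only on `K` and `f` in general
    (∀ f : Pt d → ℝ, MemLp f 2 (mu d) → ∃ C : ℝ, 0 < C ∧
      ∀ g : Pt d → ℝ, MemLp g 2 (mu d) →
      ∀ (n : ℕ) (G : Grid d n) (α t : ℕ → ℝ) (U : ℕ → Idx d n → ℝ) (N : ℕ)
        (u : ℝ → Lp ℝ 1 (mu d)),
        IsStepSeq α → G.IsForwardEuler K f g α t U →
        IsSolution K (fun _ => f) g (t N) u →
        G.ErrorLE t U N u (Real.exp (t N / 2) *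
          (l2norm (fun x => G.inj (G.proj g) x - g x) +
            C * √(t N) * (√(maxStep t N) + l2norm (fun x => G.inj (G.proj f) x - f x) +
              l2norm₂ (fun x y => G.inj₂ (G.proj₂ K) x y - K x y))))) ∧
    -- (iii) rate of convergence under Lipschitz regularity
    (∀ (s : ℝ) (f g : Pt d → ℝ), 0 < s → s ≤ 1 →
      MemLip (Om d) s 2 f → MemLip (Om d) s 2 g →
      MemLip (Om d ×ˢ Om d) s 2 (Function.uncurry K) → ∃ C : ℝ, 0 < C ∧
      ∀ (n : ℕ) (G : Grid d n) (α t : ℕ → ℝ) (U : ℕ → Idx d n → ℝ) (N : ℕ)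
        (u : ℝ → Lp ℝ 1 (mu d)),
        IsStepSeq α → G.IsForwardEuler K f g α t U →
        IsSolution K (fun _ => f) g (t N) u →
        G.ErrorLE t U N u (C * Real.exp (t N / 2) *
          ((1 + √(t N)) * G.delta ^ s + √(t N) * √(maxStep t N)))) := by
  have hK := isKernel_of_linf2norm hK_meas hK_nonneg hK_symm hK_L2
  set M := l2norm₂ K with hM
  have hM0 : 0 ≤ M := l2norm₂_nonneg K
  refine ⟨fun f g hf hg => ⟨fun T hT => ⟨exists_isSolution hK hK_meas hf hg hT,
    fun u v hu hv t ht => hu.unique hK hf hg hT.le hv ht⟩,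
    fun n G α hα => G.existsUnique_isForwardEuler K f g hα, fun T hT => ?_, ?_, fun S => ?_⟩,
    ?_, fun f hf => ?_, fun s f g hs hs1 hf hg hKs => ?_⟩
  · refine ⟨‖hg.toLp g‖ + T * (‖hf.toLp f‖ + M), fun n G α t U hα h k hk => ?_⟩
    refine G.eLpNorm_inj_le_ofReal ((h.norm_injLp_le hK hf hg hα k).trans ?_)
    gcongr
  · rintro n G α t U hα h ⟨us, hus⟩
    refine ⟨‖G.injLp us‖ + √(‖G.injLp (U 0) - G.injLp us‖ ^ 2 + ∑' j, α j ^ 2), fun k => ?_⟩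
    apply G.eLpNorm_inj_le_ofReal
    calc ‖G.injLp (U k)‖ = ‖G.injLp us + (G.injLp (U k) - G.injLp us)‖ := by
          rw [add_sub_cancel]
      _ ≤ _ := (norm_add_le _ _).trans
          (add_le_add_right (Real.le_sqrt_of_sq_le (h.norm_sub_sq_le hK hα hus k)) _)
  · refine ⟨√(‖hg.toLp g‖ ^ 2 + S), fun n G α t U hα hS h hf0 k => ?_⟩
    refine G.eLpNorm_inj_le_ofReal ((h.norm_injLp_le_of_proj_eq_zero hK hg hα hf0 k).trans ?_)
    gcongr
  -- A stationary solution bounds the discrete source by `M`, so the constant involves the kernel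
  -- only.
  · refine ⟨1 + (M + M) + 2 * √(M * (M + M)), by positivity, ?_⟩
    intro f g hf hg n G α t U N u hα h hst hu
    exact h.errorLE hK hf hg hα (G.norm_injLp_proj_le_of_hasStationary hK hst) hu
  · refine ⟨1 + (‖hf.toLp f‖ + M) + 2 * √(M * (‖hf.toLp f‖ + M)), by positivity, ?_⟩
    intro g hg n G α t U N u hα h hu
    exact h.errorLE hK hf hg hα (G.norm_injLp_proj_le hf) hu
  · have hf2 : MemLp f 2 (mu d) := hf.1
    have hg2 : MemLp g 2 (mu d) := hg.1
    set A := 1 + (‖hf2.toLp f‖ + M) + 2 * √(M * (‖hf2.toLp f‖ + M)) with hA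
    have hA0 : 0 < A := by positivity
    set cf := 6 ^ d * 3 ^ s * (lipSeminorm (Om d) s 2 f).toReal with hcf
    set cg := 6 ^ d * 3 ^ s * (lipSeminorm (Om d) s 2 g).toReal with hcg
    set cK := 6 ^ (d + d) * 3 ^ s *
      (lipSeminorm (Om d ×ˢ Om d) s 2 (Function.uncurry K)).toReal with hcK
    have hcf0 : 0 ≤ cf := by positivity
    have hcg0 : 0 ≤ cg := by positivity
    have hcK0 : 0 ≤ cK := by positivity
    refine ⟨cg + A * (1 + cf + cK), by positivity, ?_⟩
    intro n G α t U N u hα h hu k hk r hr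
    refine (h.errorLE hK hf2 hg2 hα (G.norm_injLp_proj_le hf2) hu k hk r hr).trans
      (ENNReal.ofReal_le_ofReal ?_)
    have h1 := G.l2norm_inj_proj_sub_le hd hf
    have h2 := G.l2norm_inj_proj_sub_le hd hg
    have h3 := G.l2norm₂_inj₂_proj₂_sub_le hd hKs
    have hδ : 0 ≤ G.delta ^ s := Real.rpow_nonneg (G.delta_pos hd).le s
    calc _ ≤ Real.exp (t N / 2) * (cg * G.delta ^ s + A * √(t N) *
          (√(maxStep t N) + cf * G.delta ^ s + cK * G.delta ^ s)) := by gcongr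
      -- The added nonnegative terms are the missing products that let the single constant `cg + A *
      -- (1 + cf + cK)` factor out.
      _ ≤ Real.exp (t N / 2) * (cg * G.delta ^ s + A * √(t N) *
          (√(maxStep t N) + cf * G.delta ^ s + cK * G.delta ^ s)) + Real.exp (t N / 2) *
          (cg * √(t N) * G.delta ^ s + A * (1 + cf + cK) * G.delta ^ s + A * √(t N) * G.delta ^ s +
            (cg + A * (cf + cK)) * √(t N) * √(maxStep t N)) :=
          le_add_of_nonneg_right (by positivity)
      _ = _ := by ring
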